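/- **Setting.** All manifolds are smooth, finite dimensional, Hausdorff, second countable and without boundary; all actions are smooth left actions, and $\zeta_Y$ denotes the generator of an action in the direction of a Lie algebra element $Y$. Let $G$ be a Lie group acting freely, properly and by isometries on a Riemannian manifold $(Q,\mu)$, let $\pi:Q\to S=Q/G$ be the resulting principal $G$-bundle, and let $\mathcal A:TQ\to\mathfrak g$ be a principal connection form with kernel $\mathcal D$. Let $H$ be a Lie group that acts freely and properly on $S$, acts on $\mathfrak g$ by a linear representation, and acts on $Q$ by two actions $l$ and $d$, such that * $\pi(l_h q)=h.\pi(q)=\pi(d_h q)$ for all $h\in H$, $q\in Q$; * $\mathcal A_{d_h q}(Td_h\,v)=h.\mathcal A_q(v)$ for all $h\in H$, $v\in T_qQ$; * $\mathcal A(\zeta^l_Y)=0$ for all $Y\in\mathfrak h$; * $\mu$ is invariant under $l$ and under $d$. Let $\mathrm{hl}_q:T_{\pi(q)}S\to\mathcal D_q$ be the horizontal lift, that is, the inverse of $T_q\pi|_{\mathcal D_q}$, and let $\mu_0$ be the metric on $S$ with $\mu_0(u,v)=\mu(\mathrm{hl}_q u,\mathrm{hl}_q v)$; identify $T^*S=TS$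 by $\mu_0$ and $T^*Q=TQ$ by $\mu$. Let $\mathcal H_c:T^*S\to\mathbb R$, $\mathcal H_c(p)=\tfrac12\|\mathrm{hl}(p)\|_\mu^2$. Let $\Omega^S=-d\theta_S$ be the canonical two-form on $T^*S$, $\tau_S:T^*S\to S$ the projection, $K=d\mathcal A\circ\Lambda^2\mathrm{hor}$ the curvature form of $\mathcal A$, where $\mathrm{hor}:TQ\to\mathcal D$ is the projection along the vertical spaces, and $J_G:TQ=T^*Q\to\mathfrak g^*$, $\langle J_G(w),Z\rangle=\mu(w,\zeta^G_Z)$. Put $$\Omega_{\rm nh}=\Omega^S-\langle J_G\circ\mathrm{hl},\tau_S^*K\rangle ,$$ where $K$ is evaluated on horizontal lifts at the same point of $Q$ at which $J_G\circ\mathrm{hl}$ is taken (the result does not depend on this point). This two-form is non-degenerate; let $X_{\rm nh}$ be the vector field on $T^*S$ with $i(X_{\rm nh})\Omega_{\rm nh}=d\mathcal H_c$. Let $H$ act on $T^*S$ by the cotangent lifted action, with vertical spaces $\mathrm{Ver}(H)_p=\{\zeta_Y(p):Y\in\mathfrak h\}$, and put $$\mathcal E=\{p\in T^*S: X_{\rm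 nh}(p)\in\mathrm{Ver}(H)_p\},\qquad \mathcal U=T^*S\setminus\mathcal E .$$ **Proposition.** 1. $\mathcal E$ and $\mathcal U$ are $H$-invariant, and they are invariant under the flow of $X_{\rm nh}$: every integral curve of $X_{\rm nh}$ defined on an open interval that meets $\mathcal E$ (respectively $\mathcal U$) stays in $\mathcal E$ (respectively $\mathcal U$). 2. $\mathcal U$ is open, and there is a principal connection form $\sigma$ on $\mathcal U$ for the $H$-action, i.e. a smooth $\mathfrak h$-valued one-form on $\mathcal U$ with $\sigma(\zeta_Y)=Y$ for all $Y\in\mathfrak h$ and $\sigma_{h.p}(Th\,\xi)=\mathrm{Ad}_h\,\sigma_p(\xi)$ for all $h\in H$, $p\in\mathcal U$, $\xi\in T_p(T^*S)$, such that $\sigma(X_{\rm nh})=0$ on $\mathcal U$. -/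

import Mathlib

open Set Bundle Manifold ContDiff

noncomputable section

namespace Nonholonomic

/-! All manifolds are smooth, finite dimensional, without boundary and modelled on a normed space;
the Lie algebra of a Lie group `K` modelled on `E` is `T₁K`, which in Mathlib is the space `E`. -/

/-- The pull-back `(u, v) ↦ B(L u, L v)` of a bilinear map. -/
def pullbackBilin {V W F : Type*} [AddCommGroup V] [Module ℝ V] [TopologicalSpace V]
    [AddCommGroup W] [Module ℝ W] [TopologicalSpace W] [NormedAddCommGroup F] [NormedSpace ℝ F]
    (B : V →L[ℝ] V →L[ℝ] F) (L : W →L[ℝ] V) : W →L[ℝ] W →L[ℝ] F :=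
  (ContinuousLinearMap.precomp F L).comp (B.comp L)

theorem pullbackBilin_apply {V W F : Type*} [AddCommGroup V] [Module ℝ V] [TopologicalSpace V]
    [AddCommGroup W] [Module ℝ W] [TopologicalSpace W] [NormedAddCommGroup F] [NormedSpace ℝ F]
    (B : V →L[ℝ] V →L[ℝ] F) (L : W →L[ℝ] V) (u v : W) :
    pullbackBilin B L u v = B (L u) (L v) := rfl

section General

variable {E H F : Type*} [NormedAddCommGroup E] [NormedSpace ℝ E] [TopologicalSpace H]
  (I : ModelWithCorners ℝ E H) {M : Type*} [TopologicalSpace M] [ChartedSpace H M]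
  [NormedAddCommGroup F] [NormedSpace ℝ F]
  {EK : Type*} [NormedAddCommGroup EK] [NormedSpace ℝ EK]
  {K : Type*} [TopologicalSpace K] [ChartedSpace EK K] [Group K]

/-- The expression of a vector-valued one-form `α` in the preferred chart at `x`, that is, the
pull-back of `α` under the inverse of this chart. -/
def oneFormInChart (α : ∀ x : M, TangentSpace I x →L[ℝ] F) (x : M) : E → E →L[ℝ] F := fun y =>
  (α ((extChartAt I x).symm y)).comp
    (mfderiv 𝓘(ℝ, E) I (extChartAt I x).symm y :
      E →L[ℝ] TangentSpace I ((extChartAt I x).symm y))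

/-- The exterior derivative of a vector-valued one-form on a manifold without boundary,
`dα(u, v) = ∂ᵤ(α v) - ∂ᵥ(α u)` in the preferred chart at the given point
(whose differential at this point identifies `T_x M` with the model space). -/
def extDerivOneForm (α : ∀ x : M, TangentSpace I x →L[ℝ] F) (x : M) :
    TangentSpace I x →L[ℝ] TangentSpace I x →L[ℝ] F :=
  let D : E →L[ℝ] E →L[ℝ] F := fderiv ℝ (oneFormInChart I α x) (extChartAt I x x)
  (D - D.flip : E →L[ℝ] E →L[ℝ] F)

/-- The fundamental vector field map of a left action `a` at the point `x`: it sends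
`Z ∈ T₁K` to `ζ_Z(x) = d/dt|₀ exp(tZ).x`, the derivative of `k ↦ k.x` at `1` in direction `Z`. -/
def fundamental (a : K → M → M) (x : M) : EK →L[ℝ] TangentSpace I x :=
  (mfderiv 𝓘(ℝ, EK) I (fun k : K => a k x) 1 : EK →L[ℝ] TangentSpace I (a 1 x))

/-- The adjoint representation of a Lie group on its Lie algebra. -/
def adjoint (k : K) : EK →L[ℝ] EK :=
  (mfderiv 𝓘(ℝ, EK) 𝓘(ℝ, EK) (fun x : K => k * x * k⁻¹) 1 : EK →L[ℝ] _)

/-- `σ` is, on the `K`-invariant open set `U`, the connection form of a principal connection for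
the left action `a` of `K`: it is smooth, it reproduces the generators of the action
and it is `Ad`-equivariant. Only the values of `σ` on `U` matter. -/
structure IsPrincipalConnectionOn (a : K → M → M) (U : Set M)
    (σ : ∀ x : M, TangentSpace I x →L[ℝ] EK) [IsManifold I 1 M] : Prop where
  smooth : ContMDiffOn I.tangent 𝓘(ℝ, EK) ∞ (fun v : TangentBundle I M => (σ v.proj v.2 : EK))
    {v | v.proj ∈ U}
  fundamental_eq : ∀ x ∈ U, ∀ Z : EK, σ x (fundamental I a x Z) = Z
  equivariant : ∀ (k : K), ∀ x ∈ U, ∀ v : TangentSpace I x,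
    σ (a k x) (mfderiv I I (a k) x v) = adjoint k (σ x v)

/-- The set `A` is invariant under the flow of `X`: every integral curve of `X`, defined on an open
interval `J`, which meets `A` remains in `A`. -/
def IsFlowInvariant (X : ∀ x : M, TangentSpace I x) (A : Set M) : Prop :=
  ∀ (γ : ℝ → M) (J : Set ℝ), IsOpen J → J.OrdConnected → IsMIntegralCurveOn (I := I) γ X J →
    (∃ t ∈ J, γ t ∈ A) → ∀ t ∈ J, γ t ∈ A

end General

section PrincipalBundle

variable {EQ ES EG Q S G : Type*}
  [NormedAddCommGroup EQ] [NormedSpace ℝ EQ] [NormedAddCommGroup ES] [NormedSpace ℝ ES]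
  [NormedAddCommGroup EG] [NormedSpace ℝ EG]
  [TopologicalSpace Q] [ChartedSpace EQ Q] [TopologicalSpace S] [ChartedSpace ES S]
  [TopologicalSpace G] [ChartedSpace EG G] [Group G] [MulAction G Q]

variable (G) in
/-- `pr : Q → S` is a principal bundle for the left action of `G` on `Q`: it is `G`-invariant and
locally `G`-equivariantly diffeomorphic to the projection `V × G → V`. -/
structure IsPrincipalBundle (pr : Q → S) : Prop where
  invariant : ∀ (g : G) (q : Q), pr (g • q) = pr q
  locally_trivial : ∀ s : S, ∃ V : Set S, s ∈ V ∧ IsOpen V ∧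
    ∃ φ : PartialDiffeomorph 𝓘(ℝ, EQ) (𝓘(ℝ, ES).prod 𝓘(ℝ, EG)) Q (S × G) ∞,
      φ.source = pr ⁻¹' V ∧ φ.target = V ×ˢ univ ∧
      ∀ q ∈ φ.source, (φ q).1 = pr q ∧ ∀ g : G, (φ (g • q)).2 = g * (φ q).2

theorem IsPrincipalBundle.surjective {pr : Q → S}
    (h : IsPrincipalBundle (EQ := EQ) (ES := ES) (EG := EG) G pr) : Function.Surjective pr := by
  intro s
  obtain ⟨V, hs, -, φ, hsrc, htgt, hφ⟩ := h.locally_trivial s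
  have hmem : ((s, 1) : S × G) ∈ φ.target := by rw [htgt]; exact ⟨hs, mem_univ _⟩
  refine ⟨φ.toPartialEquiv.symm (s, 1), ?_⟩
  rw [← (hφ _ (φ.toPartialEquiv.map_target hmem)).1]
  exact congrArg Prod.fst (φ.toPartialEquiv.right_inv hmem)

end PrincipalBundle

section Cotangent

variable {ES : Type*} [NormedAddCommGroup ES] [NormedSpace ℝ ES]
  {S : Type*} [TopologicalSpace S] [ChartedSpace ES S]

variable (ES S) in
/-- The cotangent bundle `T*S`. A point `p` has foot point `p.proj` and covector `p.2`. -/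
abbrev CotangentBundle : Type _ :=
  TotalSpace (ES →L[ℝ] ℝ) (fun s : S => TangentSpace 𝓘(ℝ, ES) s →L[ℝ] Bundle.Trivial S ℝ s)

variable (ES) in
/-- The model with corners of the manifold `T*S`. -/
abbrev cotangentModel : ModelWithCorners ℝ (ES × (ES →L[ℝ] ℝ)) (ModelProd ES (ES →L[ℝ] ℝ)) :=
  𝓘(ℝ, ES).prod 𝓘(ℝ, ES →L[ℝ] ℝ)

variable [IsManifold 𝓘(ℝ, ES) ∞ S]

/-- The derivative at `p` of the foot point projection `τ : T*S → S`. -/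
def footDeriv (p : CotangentBundle ES S) :
    TangentSpace (cotangentModel ES) p →L[ℝ] TangentSpace 𝓘(ℝ, ES) p.proj :=
  mfderiv (cotangentModel ES) 𝓘(ℝ, ES) (fun p : CotangentBundle ES S => p.proj) p

/-- The canonical one-form `θ_p(ξ) = ⟨p, Tτ ξ⟩` on `T*S`. -/
def canonicalOneForm (p : CotangentBundle ES S) :
    TangentSpace (cotangentModel ES) p →L[ℝ] ℝ :=
  (p.2 : TangentSpace 𝓘(ℝ, ES) p.proj →L[ℝ] ℝ).comp (footDeriv p)

/-- The canonical symplectic form `Ω^S = -dθ` on `T*S`. -/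
def canonicalTwoForm (p : CotangentBundle ES S) :
    TangentSpace (cotangentModel ES) p →L[ℝ] TangentSpace (cotangentModel ES) p →L[ℝ] ℝ :=
  -extDerivOneForm (cotangentModel ES) (canonicalOneForm (ES := ES) (S := S)) p

/-- The cotangent lift of an action of `K` on `S`, `k.(s, p) = (k.s, p ∘ T(k⁻¹))`. The derivative
of `k⁻¹` at `k.s` takes its values in the tangent space at `k⁻¹.(k.s) = s`. -/
def cotangentLift {K : Type*} [Group K] [MulAction K S] (k : K) (p : CotangentBundle ES S) :
    CotangentBundle ES S :=
  ⟨k • p.proj, (p.2 : TangentSpace 𝓘(ℝ, ES) p.proj →L[ℝ] ℝ).comp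
    (mfderiv 𝓘(ℝ, ES) 𝓘(ℝ, ES) (fun s : S => k⁻¹ • s) (k • p.proj) :
      TangentSpace 𝓘(ℝ, ES) (k • p.proj) →L[ℝ] TangentSpace 𝓘(ℝ, ES) p.proj)⟩

end Cotangent

section System

variable (EQ ES EG EH Q S G H : Type*)
  [NormedAddCommGroup EQ] [NormedSpace ℝ EQ] [NormedAddCommGroup ES] [NormedSpace ℝ ES]
  [NormedAddCommGroup EG] [NormedSpace ℝ EG] [NormedAddCommGroup EH] [NormedSpace ℝ EH]
  [TopologicalSpace Q] [ChartedSpace EQ Q] [IsManifold 𝓘(ℝ, EQ) ∞ Q]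
  [TopologicalSpace S] [ChartedSpace ES S] [IsManifold 𝓘(ℝ, ES) ∞ S]
  [TopologicalSpace G] [ChartedSpace EG G] [Group G]
  [TopologicalSpace H] [ChartedSpace EH H] [Group H]
  [MulAction G Q] [MulAction H S]

/-- A `G`-Chaplygin system `(Q, μ, 𝒟 = ker 𝒜)` over `S = Q/G` with internal symmetry group `H`.
(Smoothness and properness of the actions of `G` on `Q` and of `H` on `S` are expressed by type
classes.) -/
structure ChaplyginSystem where
  /-- the bundle projection `π : Q → S` -/
  proj : Q → S
  /-- the kinetic energy metric `μ` -/
  metric : ContMDiffRiemannianMetric 𝓘(ℝ, EQ) ∞ EQ (fun q : Q => TangentSpace 𝓘(ℝ, EQ) q)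
  /-- the connection form `𝒜 : TQ → 𝔤` -/
  conn : ∀ q : Q, TangentSpace 𝓘(ℝ, EQ) q →L[ℝ] EG
  /-- the action `l` of `H` on `Q` -/
  l : H →* Equiv.Perm Q
  /-- the action `d` of `H` on `Q` -/
  d : H →* Equiv.Perm Q
  /-- the representation of `H` on `𝔤` -/
  rep : Representation ℝ H EG
  free_G : ∀ (g : G) (q : Q), g • q = q → g = 1
  free_H : ∀ (h : H) (s : S), h • s = s → h = 1
  principal : IsPrincipalBundle (EQ := EQ) (ES := ES) (EG := EG) G proj
  conn_principal : IsPrincipalConnectionOn 𝓘(ℝ, EQ) (fun (g : G) (q : Q) => g • q) univ conn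
  l_smooth : ContMDiff (𝓘(ℝ, EH).prod 𝓘(ℝ, EQ)) 𝓘(ℝ, EQ) ∞ (fun x : H × Q => l x.1 x.2)
  d_smooth : ContMDiff (𝓘(ℝ, EH).prod 𝓘(ℝ, EQ)) 𝓘(ℝ, EQ) ∞ (fun x : H × Q => d x.1 x.2)
  proj_l : ∀ (h : H) (q : Q), proj (l h q) = h • proj q
  proj_d : ∀ (h : H) (q : Q), proj (d h q) = h • proj q
  conn_d : ∀ (h : H) (q : Q) (v : TangentSpace 𝓘(ℝ, EQ) q),
    conn (d h q) (mfderiv 𝓘(ℝ, EQ) 𝓘(ℝ, EQ) (d h) q v) = rep h (conn q v)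
  /-- `l` acts by internal symmetries: its generators are tangent to `𝒟` -/
  conn_l : ∀ (q : Q) (Y : EH),
    conn q (fundamental 𝓘(ℝ, EQ) (fun (h : H) (q : Q) => l h q) q Y) = 0
  metric_G : ∀ (g : G) (q : Q) (v w : TangentSpace 𝓘(ℝ, EQ) q),
    metric.inner (g • q) (mfderiv 𝓘(ℝ, EQ) 𝓘(ℝ, EQ) (fun x : Q => g • x) q v)
      (mfderiv 𝓘(ℝ, EQ) 𝓘(ℝ, EQ) (fun x : Q => g • x) q w) = metric.inner q v w
  metric_l : ∀ (h : H) (q : Q) (v w : TangentSpace 𝓘(ℝ, EQ) q),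
    metric.inner (l h q) (mfderiv 𝓘(ℝ, EQ) 𝓘(ℝ, EQ) (l h) q v)
      (mfderiv 𝓘(ℝ, EQ) 𝓘(ℝ, EQ) (l h) q w) = metric.inner q v w
  metric_d : ∀ (h : H) (q : Q) (v w : TangentSpace 𝓘(ℝ, EQ) q),
    metric.inner (d h q) (mfderiv 𝓘(ℝ, EQ) 𝓘(ℝ, EQ) (d h) q v)
      (mfderiv 𝓘(ℝ, EQ) 𝓘(ℝ, EQ) (d h) q w) = metric.inner q v w

namespace ChaplyginSystem

variable {EQ ES EG EH Q S G H} (C : ChaplyginSystem EQ ES EG EH Q S G H)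

/-- A point in the fibre over `s`. By `G`-invariance none of the objects on `S` and `T*S` which are
defined below through this point depends on its choice. -/
def lift (s : S) : Q := Function.surjInv C.principal.surjective s

/-- The horizontal lift of the connection at `q`: `u ∈ T_{π(q)}S` is sent to the unique
`v ∈ T_q Q` with `Tπ v = u` and `𝒜 v = 0`, by inverting the isomorphism
`(Tπ, 𝒜) : T_q Q → T_{π(q)}S × 𝔤`. -/
def horLiftAt (q : Q) : TangentSpace 𝓘(ℝ, ES) (C.proj q) →L[ℝ] TangentSpace 𝓘(ℝ, EQ) q :=
  ((mfderiv 𝓘(ℝ, EQ) 𝓘(ℝ, ES) C.proj q).prod (C.conn q)).inverse.comp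
    (ContinuousLinearMap.inl ℝ (TangentSpace 𝓘(ℝ, ES) (C.proj q)) EG)

/-- The horizontal lift of `T_s S` to the chosen point `lift s` over `s = π (lift s)`. -/
def horLift (s : S) : TangentSpace 𝓘(ℝ, ES) s →L[ℝ] TangentSpace 𝓘(ℝ, EQ) (C.lift s) :=
  C.horLiftAt (C.lift s)

/-- The induced metric `μ₀` on `S`, for which `Tπ` restricts to isometries `𝒟_q → T_{π(q)}S`. -/
def baseMetric (s : S) :
    TangentSpace 𝓘(ℝ, ES) s →L[ℝ] TangentSpace 𝓘(ℝ, ES) s →L[ℝ] ℝ :=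
  pullbackBilin (C.metric.inner (C.lift s)) (C.horLift s)

/-- The vector of `T_s S` that corresponds to the covector `p ∈ T*_s S` under `μ₀`. -/
def sharp (p : CotangentBundle ES S) : TangentSpace 𝓘(ℝ, ES) p.proj :=
  (C.baseMetric p.proj).inverse (p.2 : TangentSpace 𝓘(ℝ, ES) p.proj →L[ℝ] ℝ)

/-- The horizontal lift `hl : T*S = TS → 𝒟` (with `𝒟 = ℳ` under `μ`) to the chosen point. -/
def hl (p : CotangentBundle ES S) : TangentSpace 𝓘(ℝ, EQ) (C.lift p.proj) :=
  C.horLift p.proj (C.sharp p)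

/-- The compressed Hamiltonian `ℋ_c = ℋ ∘ hl` with `ℋ = ½ ‖·‖²_μ`. -/
def compressedHamiltonian (p : CotangentBundle ES S) : ℝ :=
  (1 / 2 : ℝ) * C.metric.inner (C.lift p.proj) (C.hl p) (C.hl p)

/-- The momentum map `J_G : TQ = T*Q → 𝔤*`, `⟨J_G(w), Z⟩ = μ(w, ζ_Z)`. -/
def momentum (q : Q) (w : TangentSpace 𝓘(ℝ, EQ) q) : EG →L[ℝ] ℝ :=
  (C.metric.inner q w).comp (fundamental 𝓘(ℝ, EQ) (fun (g : G) (q : Q) => g • q) q)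

/-- The projection of `T_q Q` to `𝒟_q` along the vertical space. -/
def horProj (q : Q) : TangentSpace 𝓘(ℝ, EQ) q →L[ℝ] TangentSpace 𝓘(ℝ, EQ) q :=
  ContinuousLinearMap.id ℝ (TangentSpace 𝓘(ℝ, EQ) q) -
    (fundamental 𝓘(ℝ, EQ) (fun (g : G) (q : Q) => g • q) q).comp (C.conn q)

/-- The curvature form `K = d𝒜 ∘ Λ²(hor)` of the connection. -/
def curvature (q : Q) :
    TangentSpace 𝓘(ℝ, EQ) q →L[ℝ] TangentSpace 𝓘(ℝ, EQ) q →L[ℝ] EG :=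
  pullbackBilin (extDerivOneForm 𝓘(ℝ, EQ) C.conn q) (C.horProj q)

/-- The semi-basic two-form `⟨J_G ∘ hl, τ*K⟩` on `T*S`. -/
def gyroTwoForm (p : CotangentBundle ES S) :
    TangentSpace (cotangentModel ES) p →L[ℝ] TangentSpace (cotangentModel ES) p →L[ℝ] ℝ :=
  pullbackBilin
    ((ContinuousLinearMap.postcomp (TangentSpace 𝓘(ℝ, EQ) (C.lift p.proj))
      (C.momentum (C.lift p.proj) (C.hl p))).comp (C.curvature (C.lift p.proj)))
    ((C.horLift p.proj).comp (footDeriv p))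

/-- The almost symplectic form `Ω_nh = Ω^S - ⟨J_G ∘ hl, τ*K⟩` on `T*S`. -/
def nhTwoForm (p : CotangentBundle ES S) :
    TangentSpace (cotangentModel ES) p →L[ℝ] TangentSpace (cotangentModel ES) p →L[ℝ] ℝ :=
  canonicalTwoForm p - C.gyroTwoForm p

/-- The vector field `X_nh` on `T*S` with `i(X_nh) Ω_nh = dℋ_c`, obtained by inverting the
isomorphism `X ↦ Ω_nh(X, ·)`. -/
def nhField (p : CotangentBundle ES S) : TangentSpace (cotangentModel ES) p :=
  (C.nhTwoForm p).inverse
    (mfderiv (cotangentModel ES) 𝓘(ℝ, ℝ) C.compressedHamiltonian p :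
      TangentSpace (cotangentModel ES) p →L[ℝ] ℝ)

/-- The set `ℰ` of relative equilibria: the points of `T*S` at which `X_nh` is tangent to the orbit
of the cotangent lifted action of `H`. -/
def relativeEquilibria : Set (CotangentBundle ES S) :=
  {p | ∃ Y : EH, C.nhField p =
    fundamental (cotangentModel ES) (cotangentLift (K := H)) p Y}

end ChaplyginSystem

end System

end Nonholonomic

end

/-!
The proof works on `M = T*S` with the vector field `X = X_nh` and the metric `b = μ₀` on `S`.

**The structure on `S`.** Two points of `Q` over `s` and `h.s` are related by `d_h` followed by an
element of `G` (`exists_symmetry`). Such a map is an isometry which transforms `𝒜` by a linear map,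
hence it respects horizontal lifts, the curvature and the momentum. So `μ₀` and the gyroscopic form
do not depend on the chosen point of the fibre, are smooth (use local sections of `π`) and are
invariant under `H`. In a bundle chart `Ω^S((u, α), (v, β)) = β u - α v`; the gyroscopic form is
semi-basic, so `Ω_nh` is non-degenerate and `X` is smooth, `H`-invariant and of second order:
`b(Tτ X(p), ·) = p`, by the fibre derivative of `ℋ_c`.

**Flow invariance.** If `X(p) = ζ_Y(p)`, then by invariance the orbit of `p` under the one-parameter
group of `Y` is an integral curve of `X` in `ℰ`; so the set of times which an integral curve spends
in `ℰ` is open, and it is closed because `ℰ` is closed (`IsSmoothAction.isFlowInvariant`).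

**The connection.** Let `σ₁` be the pull-back to `T*S` of the mechanical connection of `b`, and let
`V = X - ζ_{σ₁(X)}`. Given an invariant one-form `α` with `α(ζ_Y) = 0` such that `α(X) = 0` exactly
on `ℰ`, the set `ℰ` is closed and `σ = σ₁ - α(X)⁻¹ α ⊗ σ₁(X)` is a principal connection on `𝒰` which
annihilates `X` (`IsPrincipalConnectionOn.exists_correction`). Such an `α` could be taken from an
invariant metric on `T*S`, but it can also be written down in terms of `b` and `X` alone
(`detectingForm`). Put `f = b(Tτ V, Tτ V)`, `g = df(V)` and `Ψ = d(σ₁(X))` on horizontal vectors;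
then `α(ξ) = b(Tτ V, Tτ ξ) + b(ζ_{Ψ V}, ζ_{Ψ ξ}) + dg(V) dg(ξ)` satisfies
`α(X) = ‖Tτ V‖² + ‖ζ_{Ψ V}‖² + dg(V)²`. If this vanishes at `p`, then `V(p)` is the vertical lift of
a covector `β`. Since `X` is of second order, the two squares which contain derivatives along the
line `p + tβ` then show that the mechanical connection annihilates the vector dual to `β` and that
`‖β‖² = 0`. Hence `V(p) = 0`, that is, `p ∈ ℰ` (`exists_generator_of_detectingForm`).
-/

set_option linter.unusedSectionVars false

noncomputable section

namespace Nonholonomic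

/-! ### Smooth vector fields, forms and bilinear forms in local frames -/

section VectorCalculus

instance {E H : Type*} [NormedAddCommGroup E] [NormedSpace ℝ E] [TopologicalSpace H]
    (I : ModelWithCorners ℝ E H) {M : Type*} [TopologicalSpace M] [ChartedSpace H M]
    [FiniteDimensional ℝ E] (x : M) : FiniteDimensional ℝ (TangentSpace I x) :=
  inferInstanceAs (FiniteDimensional ℝ E)

/-- In finite dimension, smoothness of a family of linear maps can be tested on vectors. -/
theorem contMDiffAt_clm_of_apply {EN HN N E F : Type*} [NormedAddCommGroup EN] [NormedSpace ℝ EN]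
    [TopologicalSpace HN] {J : ModelWithCorners ℝ EN HN} [TopologicalSpace N] [ChartedSpace HN N]
    [NormedAddCommGroup E] [NormedSpace ℝ E] [FiniteDimensional ℝ E]
    [NormedAddCommGroup F] [NormedSpace ℝ F] {f : N → E →L[ℝ] F} {n₀ : N}
    (h : ∀ e, ContMDiffAt J 𝓘(ℝ, F) ∞ (fun n => f n e) n₀) :
    ContMDiffAt J 𝓘(ℝ, E →L[ℝ] F) ∞ f n₀ := by
  let d := Module.finrank ℝ E
  have hd : d = Module.finrank ℝ (Fin d → ℝ) := (Module.finrank_fin_fun ℝ).symm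
  let e₁ := ContinuousLinearEquiv.ofFinrankEq hd
  let e₂ := (e₁.arrowCongr (1 : F ≃L[ℝ] F)).trans (ContinuousLinearEquiv.piRing (Fin d))
  have h2 : ContMDiffAt J 𝓘(ℝ, Fin d → F) ∞ (fun n => e₂ (f n)) n₀ := by
    rw [contMDiffAt_pi_space]
    intro i
    exact h (e₁.symm (Pi.single i 1))
  have h3 := (e₂.symm : (Fin d → F) →L[ℝ] (E →L[ℝ] F)).contMDiff.contMDiffAt.comp n₀ h2
  refine h3.congr_of_eventuallyEq (Filter.Eventually.of_forall fun n => ?_)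
  simp

theorem isInvertible_of_injective {V W : Type*} [AddCommGroup V] [Module ℝ V] [TopologicalSpace V]
    [IsTopologicalAddGroup V] [ContinuousSMul ℝ V] [T2Space V] [FiniteDimensional ℝ V]
    [AddCommGroup W] [Module ℝ W] [TopologicalSpace W]
    [IsTopologicalAddGroup W] [ContinuousSMul ℝ W] [T2Space W] [FiniteDimensional ℝ W]
    {L : V →L[ℝ] W} (hL : Function.Injective L)
    (hd : Module.finrank ℝ V = Module.finrank ℝ W) : L.IsInvertible :=
  ⟨(LinearEquiv.ofInjectiveOfFinrankEq (L : V →ₗ[ℝ] W) hL hd).toContinuousLinearEquiv, by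
    ext v; rfl⟩

theorem finrank_dual_eq {V : Type*} [NormedAddCommGroup V] [NormedSpace ℝ V]
    [FiniteDimensional ℝ V] :
    Module.finrank ℝ V = Module.finrank ℝ (V →L[ℝ] ℝ) := by
  rw [← (LinearMap.toContinuousLinearMap (𝕜 := ℝ) (E := V) (F' := ℝ)).finrank_eq]
  exact Subspace.dual_finrank_eq.symm

variable {E H M : Type*} [NormedAddCommGroup E] [NormedSpace ℝ E] [TopologicalSpace H]
  {I : ModelWithCorners ℝ E H} [TopologicalSpace M] [ChartedSpace H M] [IsManifold I ∞ M]
  {EN HN N : Type*} [NormedAddCommGroup EN] [NormedSpace ℝ EN]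
  [TopologicalSpace HN] {J : ModelWithCorners ℝ EN HN} [TopologicalSpace N] [ChartedSpace HN N]
  {F : Type*} [NormedAddCommGroup F] [NormedSpace ℝ F]

variable (I) in
/-- The frame of `TM` given by the preferred chart at `x₀`, as a linear map `E → T_x M`. It is an
isomorphism only for `x` in the domain of this chart. -/
def frame (x₀ x : M) : E →L[ℝ] TangentSpace I x :=
  (trivializationAt E (TangentSpace I) x₀).symmL ℝ x

variable (I) in
/-- The components of a tangent vector in `frame I x₀ x`. -/
def coord (x₀ x : M) : TangentSpace I x →L[ℝ] E :=
  (trivializationAt E (TangentSpace I) x₀).continuousLinearMapAt ℝ x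

theorem frame_coord {x₀ x : M} (hx : x ∈ (chartAt H x₀).source) (v : TangentSpace I x) :
    frame I x₀ x (coord I x₀ x v) = v :=
  Trivialization.symmL_continuousLinearMapAt _ hx v

theorem coord_frame {x₀ x : M} (hx : x ∈ (chartAt H x₀).source) (e : E) :
    coord I x₀ x (frame I x₀ x e) = e :=
  Trivialization.continuousLinearMapAt_symmL _ hx e

/-- Smoothness of a vector field along a map, in terms of components in a frame. -/
theorem contMDiffAt_vec_iff {g : N → M} {v : ∀ n, TangentSpace I (g n)} {n₀ : N} :
    ContMDiffAt J I.tangent ∞ (fun n => (⟨g n, v n⟩ : TangentBundle I M)) n₀ ↔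
      ContMDiffAt J I ∞ g n₀ ∧
        ContMDiffAt J 𝓘(ℝ, E) ∞ (fun n => coord I (g n₀) (g n) (v n)) n₀ := by
  refine contMDiffAt_totalSpace.trans (and_congr_right fun hg => ?_)
  refine Filter.EventuallyEq.contMDiffAt_iff ?_
  have := hg.continuousAt.preimage_mem_nhds
    ((chartAt H (g n₀)).open_source.mem_nhds (mem_chart_source H (g n₀)))
  filter_upwards [this] with n hn
  exact ((trivializationAt E (TangentSpace I) (g n₀)).coe_linearMapAt_of_mem (R := ℝ) hn ▸ rfl)

theorem contMDiffAt_coord {g : N → M} {v : ∀ n, TangentSpace I (g n)} {n₀ : N}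
    (h : ContMDiffAt J I.tangent ∞ (fun n => (⟨g n, v n⟩ : TangentBundle I M)) n₀) :
    ContMDiffAt J 𝓘(ℝ, E) ∞ (fun n => coord I (g n₀) (g n) (v n)) n₀ :=
  (contMDiffAt_vec_iff.1 h).2

theorem contMDiffAt_foot {g : N → M} {v : ∀ n, TangentSpace I (g n)} {n₀ : N}
    (h : ContMDiffAt J I.tangent ∞ (fun n => (⟨g n, v n⟩ : TangentBundle I M)) n₀) :
    ContMDiffAt J I ∞ g n₀ :=
  (contMDiffAt_vec_iff.1 h).1

theorem eventually_mem_chart {g : N → M} {n₀ : N} (hg : ContMDiffAt J I ∞ g n₀) :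
    ∀ᶠ n in nhds n₀, g n ∈ (chartAt H (g n₀)).source :=
  hg.continuousAt.preimage_mem_nhds
    ((chartAt H (g n₀)).open_source.mem_nhds (mem_chart_source H (g n₀)))

/-- Linear combinations with constant components in a frame are smooth along smooth maps. -/
theorem contMDiffAt_frame {g : N → M} {c : N → E} {n₀ : N} (hg : ContMDiffAt J I ∞ g n₀)
    (hc : ContMDiffAt J 𝓘(ℝ, E) ∞ c n₀) :
    ContMDiffAt J I.tangent ∞
      (fun n => (⟨g n, frame I (g n₀) (g n) (c n)⟩ : TangentBundle I M)) n₀ := by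
  refine contMDiffAt_vec_iff.2 ⟨hg, hc.congr_of_eventuallyEq ?_⟩
  filter_upwards [eventually_mem_chart hg] with n hn
  exact coord_frame hn _

theorem contMDiffAt_vec_sub {g : N → M} {v w : ∀ n, TangentSpace I (g n)} {n₀ : N}
    (hv : ContMDiffAt J I.tangent ∞ (fun n => (⟨g n, v n⟩ : TangentBundle I M)) n₀)
    (hw : ContMDiffAt J I.tangent ∞ (fun n => (⟨g n, w n⟩ : TangentBundle I M)) n₀) :
    ContMDiffAt J I.tangent ∞ (fun n => (⟨g n, v n - w n⟩ : TangentBundle I M)) n₀ := by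
  refine contMDiffAt_vec_iff.2 ⟨contMDiffAt_foot hv, ?_⟩
  simp only [map_sub]
  exact (contMDiffAt_coord hv).sub (contMDiffAt_coord hw)

/-- Smoothness of a vector-valued one-form, as a function on the tangent bundle. -/
def SmoothForm (α : ∀ x : M, TangentSpace I x →L[ℝ] F) : Prop :=
  ContMDiff I.tangent 𝓘(ℝ, F) ∞ (fun v : TangentBundle I M => (α v.proj v.2 : F))

theorem SmoothForm.apply {α : ∀ x : M, TangentSpace I x →L[ℝ] F} (hα : SmoothForm α)
    {g : N → M} {v : ∀ n, TangentSpace I (g n)} {n₀ : N}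
    (hv : ContMDiffAt J I.tangent ∞ (fun n => (⟨g n, v n⟩ : TangentBundle I M)) n₀) :
    ContMDiffAt J 𝓘(ℝ, F) ∞ (fun n => α (g n) (v n)) n₀ :=
  (hα ⟨g n₀, v n₀⟩).comp n₀ hv

/-- Smoothness of a field of vector-valued bilinear forms: its components in the frame of each
preferred chart are smooth at the centre of this chart. -/
def SmoothBilin (B : ∀ x : M, TangentSpace I x →L[ℝ] TangentSpace I x →L[ℝ] F) : Prop :=
  ∀ x₀, ContMDiffAt I 𝓘(ℝ, E →L[ℝ] E →L[ℝ] F) ∞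
    (fun x => (pullbackBilin (B x) (frame I x₀ x) : E →L[ℝ] E →L[ℝ] F)) x₀

theorem SmoothBilin.of_apply [FiniteDimensional ℝ E]
    {B : ∀ x : M, TangentSpace I x →L[ℝ] TangentSpace I x →L[ℝ] F}
    (h : ∀ (x₀ : M) (e e' : E), ContMDiffAt I 𝓘(ℝ, F) ∞
      (fun x => B x (frame I x₀ x e) (frame I x₀ x e')) x₀) : SmoothBilin B := fun x₀ =>
  contMDiffAt_clm_of_apply fun e => contMDiffAt_clm_of_apply fun e' => h x₀ e e'

theorem SmoothBilin.apply {B : ∀ x : M, TangentSpace I x →L[ℝ] TangentSpace I x →L[ℝ] F}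
    (hB : SmoothBilin B) {g : N → M} {v w : ∀ n, TangentSpace I (g n)} {n₀ : N}
    (hv : ContMDiffAt J I.tangent ∞ (fun n => (⟨g n, v n⟩ : TangentBundle I M)) n₀)
    (hw : ContMDiffAt J I.tangent ∞ (fun n => (⟨g n, w n⟩ : TangentBundle I M)) n₀) :
    ContMDiffAt J 𝓘(ℝ, F) ∞ (fun n => B (g n) (v n) (w n)) n₀ := by
  have hg := contMDiffAt_foot hv
  refine ((((hB (g n₀)).comp n₀ hg).clm_apply (contMDiffAt_coord hv)).clm_apply
    (contMDiffAt_coord hw)).congr_of_eventuallyEq ?_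
  filter_upwards [eventually_mem_chart hg] with n hn
  simp only [Function.comp_apply, pullbackBilin_apply, frame_coord hn]

theorem SmoothForm.of_apply [FiniteDimensional ℝ E] {α : ∀ x : M, TangentSpace I x →L[ℝ] F}
    (h : ∀ (x₀ : M) (e : E), ContMDiffAt I 𝓘(ℝ, F) ∞ (fun x => α x (frame I x₀ x e)) x₀) :
    SmoothForm α := by
  intro v₀
  have hid : ContMDiffAt I.tangent I.tangent ∞
      (fun v : TangentBundle I M => (⟨v.proj, v.2⟩ : TangentBundle I M)) v₀ := contMDiffAt_id
  have hg := contMDiffAt_foot hid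
  have h1 : ContMDiffAt I 𝓘(ℝ, E →L[ℝ] F) ∞
      (fun x => ((α x).comp (frame I v₀.proj x) : E →L[ℝ] F)) v₀.proj :=
    contMDiffAt_clm_of_apply fun e => h v₀.proj e
  refine ((h1.comp v₀ hg).clm_apply (contMDiffAt_coord hid)).congr_of_eventuallyEq ?_
  filter_upwards [eventually_mem_chart hg] with n hn
  simp only [Function.comp_apply, ContinuousLinearMap.comp_apply, frame_coord hn]

/-- The vector field along a map that corresponds to a smooth family of covectors under a smooth
non-degenerate bilinear form is smooth. -/
theorem SmoothBilin.contMDiffAt_inverse [FiniteDimensional ℝ E]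
    {B : ∀ x : M, TangentSpace I x →L[ℝ] TangentSpace I x →L[ℝ] ℝ}
    (hB : SmoothBilin B) (hinv : ∀ x, (B x).IsInvertible) {g : N → M}
    {α : ∀ n, TangentSpace I (g n) →L[ℝ] ℝ} {n₀ : N} (hg : ContMDiffAt J I ∞ g n₀)
    (hα : ∀ e : E, ContMDiffAt J 𝓘(ℝ, ℝ) ∞ (fun n => α n (frame I (g n₀) (g n) e)) n₀) :
    ContMDiffAt J I.tangent ∞
      (fun n => (⟨g n, (B (g n)).inverse (α n)⟩ : TangentBundle I M)) n₀ := by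
  have : CompleteSpace E := FiniteDimensional.complete ℝ E
  refine contMDiffAt_vec_iff.2 ⟨hg, ?_⟩
  have h1 : ContMDiffAt J 𝓘(ℝ, E →L[ℝ] ℝ) ∞
      (fun n => ((α n).comp (frame I (g n₀) (g n)) : E →L[ℝ] ℝ)) n₀ :=
    contMDiffAt_clm_of_apply hα
  let Bc : N → E →L[ℝ] E →L[ℝ] ℝ := fun n => pullbackBilin (B (g n)) (frame I (g n₀) (g n))
  have h2 : ContMDiffAt J 𝓘(ℝ, E →L[ℝ] E →L[ℝ] ℝ) ∞ Bc n₀ := (hB (g n₀)).comp n₀ hg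
  have hBinv : ∀ n, g n ∈ (chartAt H (g n₀)).source → (Bc n).IsInvertible := by
    intro n hn
    refine isInvertible_of_injective (fun e e' he => ?_) finrank_dual_eq
    have : B (g n) (frame I (g n₀) (g n) e) = B (g n) (frame I (g n₀) (g n) e') := by
      ext v
      rw [← frame_coord (I := I) hn v]
      exact congrArg (fun L : E →L[ℝ] ℝ => L (coord I (g n₀) (g n) v)) he
    have := (hinv (g n)).injective this
    rw [← coord_frame (I := I) hn e, this, coord_frame hn]
  have h3 : ContMDiffAt J 𝓘(ℝ, (E →L[ℝ] ℝ) →L[ℝ] E) ∞ (fun n => (Bc n).inverse) n₀ :=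
    ((hBinv n₀ (mem_chart_source H _)).contDiffAt_map_inverse (n := ∞)).contMDiffAt.comp n₀ h2
  refine (h3.clm_apply h1).congr_of_eventuallyEq ?_
  filter_upwards [eventually_mem_chart hg] with n hn
  symm
  have : (α n).comp (frame I (g n₀) (g n)) =
      Bc n (coord I (g n₀) (g n) ((B (g n)).inverse (α n))) := by
    ext w
    simp only [Bc, pullbackBilin_apply, frame_coord hn]
    rw [(hinv (g n)).self_apply_inverse]
    rfl
  rw [this, (hBinv n hn).inverse_apply_self]

end VectorCalculus

/-! ### The exterior derivative of one-forms -/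

section ExteriorDerivative

/-- In normed spaces, the exterior derivative of one-forms commutes with pull-backs; the second
derivatives of the map cancel by symmetry. -/
theorem fderiv_pullback_sub_flip {E₁ E₂ F : Type*} [NormedAddCommGroup E₁] [NormedSpace ℝ E₁]
    [NormedAddCommGroup E₂] [NormedSpace ℝ E₂] [NormedAddCommGroup F] [NormedSpace ℝ F]
    {η : E₂ → E₂ →L[ℝ] F} {ψ : E₁ → E₂} {y : E₁} (hη : DifferentiableAt ℝ η (ψ y))
    (hψ : ContDiffAt ℝ ∞ ψ y) (u v : E₁) :
    fderiv ℝ (fun z => (η (ψ z)).comp (fderiv ℝ ψ z)) y u v -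
        fderiv ℝ (fun z => (η (ψ z)).comp (fderiv ℝ ψ z)) y v u =
      fderiv ℝ η (ψ y) (fderiv ℝ ψ y u) (fderiv ℝ ψ y v) -
        fderiv ℝ η (ψ y) (fderiv ℝ ψ y v) (fderiv ℝ ψ y u) := by
  have hψ1 : DifferentiableAt ℝ ψ y := hψ.differentiableAt (by simp)
  have hψ2 : DifferentiableAt ℝ (fderiv ℝ ψ) y :=
    (hψ.fderiv_right (m := ∞) (by simp)).differentiableAt (by simp)
  have hsymm : IsSymmSndFDerivAt ℝ ψ y :=
    hψ.isSymmSndFDerivAt (by simpa using ENat.LEInfty.out)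
  have hc : DifferentiableAt ℝ (fun z => η (ψ z)) y := hη.comp y hψ1
  have hcomp : fderiv ℝ (fun z => η (ψ z)) y = (fderiv ℝ η (ψ y)).comp (fderiv ℝ ψ y) :=
    fderiv_comp y hη hψ1
  have key : ∀ a b : E₁, fderiv ℝ (fun z => (η (ψ z)).comp (fderiv ℝ ψ z)) y a b =
      η (ψ y) (fderiv ℝ (fderiv ℝ ψ) y a b) +
        fderiv ℝ η (ψ y) (fderiv ℝ ψ y a) (fderiv ℝ ψ y b) := by
    intro a b
    rw [fderiv_clm_comp hc hψ2, hcomp]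
    simp
  rw [key, key, hsymm.eq u v]
  abel

variable {E H M : Type*} [NormedAddCommGroup E] [NormedSpace ℝ E] [TopologicalSpace H]
  {I : ModelWithCorners ℝ E H} [TopologicalSpace M] [ChartedSpace H M]
  {EN HN N : Type*} [NormedAddCommGroup EN] [NormedSpace ℝ EN]
  [TopologicalSpace HN] {J : ModelWithCorners ℝ EN HN} [TopologicalSpace N] [ChartedSpace HN N]
  {F : Type*} [NormedAddCommGroup F] [NormedSpace ℝ F]

theorem tangentMap_congr {f g : N → M} {n : N} (h : f =ᶠ[nhds n] g) (v : TangentSpace J n) :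
    (⟨f n, mfderiv J I f n v⟩ : TangentBundle I M) = ⟨g n, mfderiv J I g n v⟩ := by
  have h1 : (mfderiv J I f n : EN →L[ℝ] E) = mfderiv J I g n := h.mfderiv_eq
  have h2 : ∀ (a b : M) (_ : a = b) (u w : E) (_ : u = w),
      (⟨a, u⟩ : TangentBundle I M) = ⟨b, w⟩ := by
    rintro a _ rfl u _ rfl; rfl
  exact h2 _ _ h.eq_of_nhds _ _ (congrArg (fun L : EN →L[ℝ] E => L v) h1)

theorem extDerivOneForm_apply (α : ∀ x : M, TangentSpace I x →L[ℝ] F) (x : M)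
    (u v : TangentSpace I x) : extDerivOneForm I α x u v =
      fderiv ℝ (oneFormInChart I α x) (extChartAt I x x) u v -
        fderiv ℝ (oneFormInChart I α x) (extChartAt I x x) v u := rfl

/-- On a normed space, `extDerivOneForm` is the antisymmetrised derivative. -/
theorem extDerivOneForm_vectorSpace (η : E → E →L[ℝ] F) (y : E) (u v : E) :
    extDerivOneForm 𝓘(ℝ, E) (M := E) (fun z => η z) y u v =
      fderiv ℝ η y u v - fderiv ℝ η y v u := by
  have : oneFormInChart 𝓘(ℝ, E) (M := E) (fun z => η z) y = η := by
    funext z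
    ext w
    simp only [oneFormInChart]
    have h1 : (extChartAt 𝓘(ℝ, E) y).symm = PartialEquiv.refl E := by
      rw [extChartAt_model_space_eq_id, PartialEquiv.refl_symm]
    have h2 : mfderiv 𝓘(ℝ, E) 𝓘(ℝ, E) (extChartAt 𝓘(ℝ, E) y).symm z =
        ContinuousLinearMap.id ℝ E := by
      rw [h1]; exact mfderiv_id
    rw [h2, h1]
    rfl
  refine (extDerivOneForm_apply (I := 𝓘(ℝ, E)) (M := E) (fun z => η z) y u v).trans ?_
  rw [this]
  rfl

variable [IsManifold I ∞ M] [IsManifold J ∞ N] [I.Boundaryless] [J.Boundaryless]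

theorem frame_eq_mfderiv {x₀ x : M} (hx : x ∈ (chartAt H x₀).source) :
    (frame I x₀ x : E →L[ℝ] E) =
      mfderiv 𝓘(ℝ, E) I (extChartAt I x₀).symm (extChartAt I x₀ x) := by
  rw [frame, TangentBundle.symmL_trivializationAt hx, I.range_eq_univ, mfderivWithin_univ]

theorem frame_self (x : M) : (frame I x x : E →L[ℝ] E) = ContinuousLinearMap.id ℝ E := by
  have := mfderivWithin_range_extChartAt_symm (I := I) (x := x)
  rw [I.range_eq_univ, mfderivWithin_univ] at this
  rw [frame_eq_mfderiv (mem_chart_source H x)]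
  exact this

theorem extChartAt_symm_contMDiffAt {x₀ : M} {y : E} (hy : y ∈ (extChartAt I x₀).target) :
    ContMDiffAt 𝓘(ℝ, E) I ∞ (extChartAt I x₀).symm y :=
  (contMDiffOn_extChartAt_symm x₀).contMDiffAt ((isOpen_extChartAt_target x₀).mem_nhds hy)

theorem eventually_mem_extChartAt_target (x₀ : M) :
    ∀ᶠ y in nhds (extChartAt I x₀ x₀), y ∈ (extChartAt I x₀).target :=
  (isOpen_extChartAt_target x₀).mem_nhds (mem_extChartAt_target x₀)

theorem contDiffAt_oneFormInChart [FiniteDimensional ℝ E]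
    {α : ∀ x : M, TangentSpace I x →L[ℝ] F} (hα : SmoothForm α)
    (x₀ : M) : ContDiffAt ℝ ∞ (oneFormInChart I α x₀) (extChartAt I x₀ x₀) := by
  rw [← contMDiffAt_iff_contDiffAt]
  refine contMDiffAt_clm_of_apply fun e => ?_
  have hs : (extChartAt I x₀).symm (extChartAt I x₀ x₀) = x₀ := extChartAt_to_inv x₀
  have hg : ContMDiffAt 𝓘(ℝ, E) I ∞ (extChartAt I x₀).symm (extChartAt I x₀ x₀) :=
    extChartAt_symm_contMDiffAt (mem_extChartAt_target x₀)
  have h1 := contMDiffAt_frame hg (contMDiffAt_const (c := e))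
  rw [hs] at h1
  refine (hα.apply h1).congr_of_eventuallyEq ?_
  filter_upwards [eventually_mem_extChartAt_target x₀] with y hy
  have hy' : (extChartAt I x₀).symm y ∈ (chartAt H x₀).source := by
    rw [← extChartAt_source (I := I)]; exact (extChartAt I x₀).map_target hy
  have h2 := frame_eq_mfderiv (I := I) hy'
  rw [(extChartAt I x₀).right_inv hy] at h2
  exact congrArg (α ((extChartAt I x₀).symm y)) (congrArg (fun L : E →L[ℝ] E => L e) h2.symm)

/-- The exterior derivative of one-forms commutes with pull-backs. -/
theorem extDerivOneForm_pullback [FiniteDimensional ℝ E]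
    {α : ∀ x : M, TangentSpace I x →L[ℝ] F} (hα : SmoothForm α)
    {β : ∀ n : N, TangentSpace J n →L[ℝ] F} {f : N → M} {n₀ : N} (hf : ContMDiffAt J I ∞ f n₀)
    (hβ : ∀ᶠ n in nhds n₀, ∀ v, β n v = α (f n) (mfderiv J I f n v)) (u v : TangentSpace J n₀) :
    extDerivOneForm J β n₀ u v =
      extDerivOneForm I α (f n₀) (mfderiv J I f n₀ u) (mfderiv J I f n₀ v) := by
  let φ := extChartAt J n₀
  let χ := extChartAt I (f n₀)
  let ψ : EN → E := fun y => χ (f (φ.symm y))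
  have hφ0 : φ.symm (φ n₀) = n₀ := extChartAt_to_inv n₀
  have hψ0 : ψ (φ n₀) = χ (f n₀) := by simp only [ψ, hφ0]
  have hψ : ContDiffAt ℝ ∞ ψ (φ n₀) := by
    have := (contMDiffAt_iff_of_mem_source (mem_chart_source HN n₀)
      (mem_chart_source H (f n₀))).1 hf
    have h2 := this.2
    rw [J.range_eq_univ, contDiffWithinAt_univ] at h2
    exact h2
  have hmf : (mfderiv J I f n₀ : EN →L[ℝ] E) = fderiv ℝ ψ (φ n₀) := by
    rw [(hf.mdifferentiableAt (by simp)).mfderiv, J.range_eq_univ, fderivWithin_univ]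
    rfl
  have hφc : ContinuousAt φ.symm (φ n₀) :=
    (extChartAt_symm_contMDiffAt (mem_extChartAt_target n₀)).continuousAt
  have hφt : Filter.Tendsto φ.symm (nhds (φ n₀)) (nhds n₀) := by
    have := hφc.tendsto
    rwa [hφ0] at this
  have hsrc : ∀ᶠ n in nhds n₀, f n ∈ χ.source :=
    hf.continuousAt.preimage_mem_nhds (extChartAt_source_mem_nhds (f n₀))
  have hf1 : ∀ᶠ n in nhds n₀, ContMDiffAt J I 1 f n :=
    (contMDiffAt_iff_contMDiffAt_nhds (by simp)).1 (hf.of_le (by exact_mod_cast le_top))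
  have hψ1 : ∀ᶠ y in nhds (φ n₀), ContDiffAt ℝ 1 ψ y :=
    (hψ.of_le (m := 1) (by exact_mod_cast le_top)).eventually (by simp)
  have hchart : oneFormInChart J β n₀ =ᶠ[nhds (φ n₀)]
      fun y => (oneFormInChart I α (f n₀) (ψ y)).comp (fderiv ℝ ψ y) := by
    filter_upwards [hφt.eventually hβ, hφt.eventually hf1, hψ1, hφt.eventually hsrc,
      (hφt.eventually hsrc).eventually_nhds, eventually_mem_extChartAt_target (I := J) n₀]
      with y hy1 hy2 hy3 hy4 hy5 hy6
    ext v
    have hφd : MDifferentiableAt 𝓘(ℝ, EN) J φ.symm y :=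
      (extChartAt_symm_contMDiffAt hy6).mdifferentiableAt (by simp)
    have hχd : MDifferentiableAt 𝓘(ℝ, E) I χ.symm (ψ y) :=
      (extChartAt_symm_contMDiffAt (χ.map_source hy4)).mdifferentiableAt (by simp)
    have hψd : MDifferentiableAt 𝓘(ℝ, EN) 𝓘(ℝ, E) ψ y :=
      (hy3.differentiableAt (by simp)).mdifferentiableAt
    have heq : (f ∘ φ.symm) =ᶠ[nhds y] (χ.symm ∘ ψ) := by
      filter_upwards [hy5] with z hz
      exact (χ.left_inv hz).symm
    have h1 := tangentMap_congr (I := I) (J := 𝓘(ℝ, EN)) heq v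
    rw [mfderiv_comp y (hy2.mdifferentiableAt (by simp)) hφd, mfderiv_comp y hχd hψd,
      mfderiv_eq_fderiv] at h1
    have h2 := congrArg (fun w : TangentBundle I M => (α w.proj w.2 : F)) h1
    exact (hy1 _).trans h2
  rw [extDerivOneForm_apply, extDerivOneForm_apply]
  have hα1 : DifferentiableAt ℝ (oneFormInChart I α (f n₀)) (ψ (φ n₀)) := by
    rw [hψ0]
    exact (contDiffAt_oneFormInChart hα (f n₀)).differentiableAt (by simp)
  have := fderiv_pullback_sub_flip hα1 hψ u v
  rw [hchart.fderiv_eq]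
  rw [← hmf, hψ0] at this
  exact this

theorem extDerivOneForm_comp {F' : Type*} [NormedAddCommGroup F'] [NormedSpace ℝ F']
    [FiniteDimensional ℝ E] {α : ∀ x : M, TangentSpace I x →L[ℝ] F} (hα : SmoothForm α)
    (L : F →L[ℝ] F') (x : M) (u v : TangentSpace I x) :
    extDerivOneForm I (fun x => L.comp (α x)) x u v = L (extDerivOneForm I α x u v) := by
  have h1 : oneFormInChart I (fun x => L.comp (α x)) x =
      fun y => (ContinuousLinearMap.compL ℝ E F F' L) (oneFormInChart I α x y) := rfl
  have h2 : DifferentiableAt ℝ (oneFormInChart I α x) (extChartAt I x x) :=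
    (contDiffAt_oneFormInChart hα x).differentiableAt (by simp)
  have h3 : fderiv ℝ (oneFormInChart I (fun x => L.comp (α x)) x) (extChartAt I x x) =
      (ContinuousLinearMap.compL ℝ E F F' L).comp
        (fderiv ℝ (oneFormInChart I α x) (extChartAt I x x)) := by
    rw [h1]
    exact ((ContinuousLinearMap.compL ℝ E F F' L).hasFDerivAt.comp _ h2.hasFDerivAt).fderiv
  rw [extDerivOneForm_apply, extDerivOneForm_apply, h3, map_sub]
  rfl

/-- The exterior derivative is computed in a different chart at each point; that the result is
smooth follows from the pull-back under a single chart. -/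
theorem SmoothForm.extDeriv [FiniteDimensional ℝ E] {α : ∀ x : M, TangentSpace I x →L[ℝ] F}
    (hα : SmoothForm α) : SmoothBilin (extDerivOneForm I α) := by
  refine SmoothBilin.of_apply fun x₀ e e' => ?_
  have h0 : ContDiffAt ℝ ∞ (fderiv ℝ (oneFormInChart I α x₀)) (extChartAt I x₀ x₀) :=
    (contDiffAt_oneFormInChart hα x₀).fderiv_right (by simp)
  have h1 : ContMDiffAt I 𝓘(ℝ, E →L[ℝ] E →L[ℝ] F) ∞
      (fun x => fderiv ℝ (oneFormInChart I α x₀) (extChartAt I x₀ x)) x₀ :=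
    h0.contMDiffAt.comp x₀ (contMDiffAt_extChartAt (n := ∞))
  have h2 : ∀ a b : E, ContMDiffAt I 𝓘(ℝ, F) ∞
      (fun x => fderiv ℝ (oneFormInChart I α x₀) (extChartAt I x₀ x) a b) x₀ := fun a b =>
    (h1.clm_apply contMDiffAt_const).clm_apply contMDiffAt_const
  refine ((h2 e e').sub (h2 e' e)).congr_of_eventuallyEq ?_
  filter_upwards [extChartAt_source_mem_nhds (I := I) x₀] with x hx
  have hx' : x ∈ (chartAt H x₀).source := by rwa [extChartAt_source] at hx
  have hy := (extChartAt I x₀).map_source hx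
  have h3 := extDerivOneForm_pullback (J := 𝓘(ℝ, E)) (N := E) hα
    (β := fun z => oneFormInChart I α x₀ z)
    (extChartAt_symm_contMDiffAt hy) (Filter.Eventually.of_forall fun n v => rfl) e e'
  rw [extDerivOneForm_vectorSpace, ← frame_eq_mfderiv hx', (extChartAt I x₀).left_inv hx] at h3
  exact h3.symm

end ExteriorDerivative

/-! ### Smooth actions and their generators -/

section Actions

variable {E H M : Type*} [NormedAddCommGroup E] [NormedSpace ℝ E] [TopologicalSpace H]
  {I : ModelWithCorners ℝ E H} [TopologicalSpace M] [ChartedSpace H M]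
  {EN HN N : Type*} [NormedAddCommGroup EN] [NormedSpace ℝ EN]
  [TopologicalSpace HN] {J : ModelWithCorners ℝ EN HN} [TopologicalSpace N] [ChartedSpace HN N]
  {EK K : Type*} [NormedAddCommGroup EK] [NormedSpace ℝ EK]
  [TopologicalSpace K] [ChartedSpace EK K] [Group K]

/-- The tangent spaces at different points are the same model space, so that derivatives at equal
points can be compared without transport. -/
theorem mfderiv_congr_base {f : N → M} {x y : N} (h : x = y) (v : EN) :
    (mfderiv J I f x : EN →L[ℝ] E) v = (mfderiv J I f y : EN →L[ℝ] E) v := by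
  subst h; rfl

theorem tangent_mk_congr {x y : M} (h : x = y) (v : E) :
    (⟨x, v⟩ : TangentBundle I M) = ⟨y, v⟩ := by
  subst h; rfl

variable (I EK) in
/-- The map `a : K → M → M` is a smooth left action of the Lie group `K`. -/
structure IsSmoothAction (a : K → M → M) : Prop where
  smooth : ContMDiff (𝓘(ℝ, EK).prod I) I ∞ (fun x : K × M => a x.1 x.2)
  one : ∀ x, a 1 x = x
  mul : ∀ k j x, a (k * j) x = a k (a j x)

namespace IsSmoothAction

variable {a : K → M → M} (ha : IsSmoothAction I EK a)
include ha

theorem contMDiff_left (k : K) : ContMDiff I I ∞ (a k) :=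
  ha.smooth.comp (contMDiff_const.prodMk contMDiff_id)

theorem contMDiff_orbit (x : M) : ContMDiff 𝓘(ℝ, EK) I ∞ (fun k => a k x) :=
  ha.smooth.comp (contMDiff_id.prodMk contMDiff_const)

theorem mdifferentiableAt_left (k : K) (x : M) : MDifferentiableAt I I (a k) x :=
  (ha.contMDiff_left k).mdifferentiableAt (by simp)

theorem mdifferentiableAt_orbit (x : M) (k : K) :
    MDifferentiableAt 𝓘(ℝ, EK) I (fun k => a k x) k :=
  (ha.contMDiff_orbit x).mdifferentiableAt (by simp)

theorem inv_left (k : K) (x : M) : a k⁻¹ (a k x) = x := by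
  rw [← ha.mul, inv_mul_cancel, ha.one]

theorem mfderiv_inv_left (k : K) (x : M) (v : TangentSpace I x) :
    (mfderiv I I (a k⁻¹) (a k x) (mfderiv I I (a k) x v) : E) = v := by
  have h1 := mfderiv_comp_apply x (ha.mdifferentiableAt_left k⁻¹ _)
    (ha.mdifferentiableAt_left k x) v
  have h2 : a k⁻¹ ∘ a k = id := funext fun y => ha.inv_left k y
  rw [h2, mfderiv_id] at h1
  exact h1.symm

theorem mfderiv_injective (k : K) (x : M) : Function.Injective (mfderiv I I (a k) x) := by
  intro v w h
  have h1 := ha.mfderiv_inv_left k x v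
  rw [h] at h1
  exact h1.symm.trans (ha.mfderiv_inv_left k x w)

theorem mfderiv_surjective [FiniteDimensional ℝ E] (k : K) (x : M) :
    Function.Surjective (mfderiv I I (a k) x) :=
  (LinearMap.injective_iff_surjective_of_finrank_eq_finrank
    (f := (mfderiv I I (a k) x : TangentSpace I x →ₗ[ℝ] TangentSpace I (a k x))) rfl).1
    (ha.mfderiv_injective k x)

/-- The derivative of an orbit map along a left-invariant vector field of the group. -/
theorem mfderiv_orbit_mulInvariant [LieGroup 𝓘(ℝ, EK) ∞ K] (k : K) (x : M) (Z : EK) :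
    mfderiv 𝓘(ℝ, EK) I (fun k => a k x) k
        (mulInvariantVectorField (I := 𝓘(ℝ, EK)) (G := K) Z k) =
      mfderiv I I (a k) x (fundamental I a x Z) := by
  have hk : MDifferentiableAt 𝓘(ℝ, EK) 𝓘(ℝ, EK) (fun j : K => k * j) 1 :=
    (contMDiff_mul_left (n := ∞)).mdifferentiableAt (by simp)
  have h1 := mfderiv_comp_apply (1 : K) (ha.mdifferentiableAt_orbit x (k * 1)) hk Z
  have h2 := mfderiv_comp_apply (1 : K) (ha.mdifferentiableAt_left k (a 1 x))
    (ha.mdifferentiableAt_orbit x 1) Z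
  have h3 : (fun k => a k x) ∘ (fun j : K => k * j) = a k ∘ fun k => a k x :=
    funext fun j => ha.mul k j x
  rw [h3, h2] at h1
  refine Eq.trans ?_ (h1.symm.trans (mfderiv_congr_base (ha.one x) _))
  exact mfderiv_congr_base (mul_one k).symm _

/-- The generators are equivariant with respect to the adjoint representation. -/
theorem mfderiv_fundamental [LieGroup 𝓘(ℝ, EK) ∞ K] (k : K) (x : M) (Z : EK) :
    mfderiv I I (a k) x (fundamental I a x Z) = fundamental I a (a k x) (adjoint k Z) := by
  have hk : MDifferentiableAt 𝓘(ℝ, EK) 𝓘(ℝ, EK) (fun j : K => k * j * k⁻¹) 1 :=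
    (((contMDiff_mul_right (I := 𝓘(ℝ, EK)) (n := ∞) (a := k⁻¹)).comp
      (contMDiff_mul_left (I := 𝓘(ℝ, EK)) (n := ∞) (a := k))).mdifferentiableAt (by simp) :)
  have h1 := mfderiv_comp_apply (1 : K) (ha.mdifferentiableAt_orbit (a k x) (k * 1 * k⁻¹)) hk Z
  have h2 := mfderiv_comp_apply (1 : K) (ha.mdifferentiableAt_left k (a 1 x))
    (ha.mdifferentiableAt_orbit x 1) Z
  have h3 : (fun j => a j (a k x)) ∘ (fun j : K => k * j * k⁻¹) = a k ∘ fun k => a k x := by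
    funext j
    simp only [Function.comp_apply]
    rw [← ha.mul, ← ha.mul]
    simp
  rw [h3, h2] at h1
  refine Eq.trans (mfderiv_congr_base (ha.one x).symm _) (h1.trans ?_)
  exact mfderiv_congr_base (by simp) _

/-- The generator of a function which is invariant along the orbits vanishes. -/
theorem mfderiv_fundamental_of_invariant {f : M → N} (hf : ∀ k x, f (a k x) = f x) {x : M}
    (hfd : MDifferentiableAt I J f x) (Z : EK) :
    mfderiv I J f x (fundamental I a x Z) = 0 := by
  have h2 := mfderiv_comp_apply (1 : K) (f := fun k => a k x) (g := f) (I'' := J)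
    (by rw [ha.one]; exact hfd) (ha.mdifferentiableAt_orbit x 1) Z
  have h3 : f ∘ (fun k => a k x) = fun _ => f x := funext fun k => hf k x
  rw [h3, mfderiv_const] at h2
  exact (mfderiv_congr_base (ha.one x).symm _).trans h2.symm

theorem contMDiffAt_fundamental [LieGroup 𝓘(ℝ, EK) ∞ K] [IsManifold I ∞ M]
    {g : N → M} {Z : N → EK} {n₀ : N} (hg : ContMDiffAt J I ∞ g n₀)
    (hZ : ContMDiffAt J 𝓘(ℝ, EK) ∞ Z n₀) :
    ContMDiffAt J I.tangent ∞
      (fun n => (⟨g n, fundamental I a (g n) (Z n)⟩ : TangentBundle I M)) n₀ := by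
  have h1 : ContMDiffAt J 𝓘(ℝ, EK).tangent ∞
      (fun n => (⟨1, Z n⟩ : TangentBundle 𝓘(ℝ, EK) K)) n₀ := by
    have := contMDiffAt_frame (I := 𝓘(ℝ, EK)) (g := fun _ : N => (1 : K)) contMDiffAt_const hZ
    rwa [frame_self] at this
  have h2 : ContMDiffAt J I.tangent ∞ (fun n => (⟨g n, 0⟩ : TangentBundle I M)) n₀ := by
    refine contMDiffAt_vec_iff.2 ⟨hg, ?_⟩
    simp only [map_zero]
    exact contMDiffAt_const
  have h3 := ((contMDiff_equivTangentBundleProd_symm (I := 𝓘(ℝ, EK)) (I' := I) (M := K) (M' := M)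
    (n := ∞)) _).comp n₀ (h1.prodMk h2)
  have h4 := ((ha.smooth.contMDiff_tangentMap (m := ∞) (by simp)) _).comp n₀ h3
  refine h4.congr_of_eventuallyEq (Filter.Eventually.of_forall fun n => ?_)
  simp only [Function.comp_apply, tangentMap]
  rw [mfderiv_prod_eq_add_apply (ha.smooth.mdifferentiableAt (by simp))]
  refine (tangent_mk_congr (ha.one (g n)).symm _).trans ?_
  congr 1
  have : ∀ u : TangentSpace I (a 1 (g n)), u = u + 0 := fun u => (add_zero u).symm
  refine (this _).trans ?_
  congr 1
  exact (map_zero (mfderiv I I (fun z => a 1 z) (g n))).symm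

/-- The velocity of `t ↦ c(t).x`, where `c` is an integral curve of a left-invariant vector field:
for such curves no exponential map is needed. -/
theorem hasMFDerivAt_orbit_comp [LieGroup 𝓘(ℝ, EK) ∞ K] {Z : EK} {c : ℝ → K} {t : ℝ}
    (hc : HasMFDerivAt 𝓘(ℝ, ℝ) 𝓘(ℝ, EK) c t ((1 : ℝ →L[ℝ] ℝ).smulRight
      (mulInvariantVectorField (I := 𝓘(ℝ, EK)) (G := K) Z (c t)))) (x : M) :
    HasMFDerivAt 𝓘(ℝ, ℝ) I (fun t => a (c t) x) t ((1 : ℝ →L[ℝ] ℝ).smulRight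
      (mfderiv I I (a (c t)) x (fundamental I a x Z))) := by
  have h := (ha.mdifferentiableAt_orbit x (c t)).hasMFDerivAt.comp t hc
  refine h.congr_mfderiv ?_
  refine ContinuousLinearMap.ext fun (r : ℝ) => ?_
  change mfderiv 𝓘(ℝ, EK) I (fun k => a k x) (c t)
    (r • mulInvariantVectorField (I := 𝓘(ℝ, EK)) (G := K) Z (c t)) =
      r • mfderiv I I (a (c t)) x (fundamental I a x Z)
  rw [map_smul, ha.mfderiv_orbit_mulInvariant]

end IsSmoothAction

/-- A local one-parameter subgroup, as an integral curve of a left-invariant vector field. -/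
theorem exists_leftInvariant_curve [LieGroup 𝓘(ℝ, EK) ∞ K] [FiniteDimensional ℝ EK] (Z : EK) :
    ∃ c : ℝ → K, c 0 = 1 ∧ IsMIntegralCurveAt (I := 𝓘(ℝ, EK)) c
      (mulInvariantVectorField (I := 𝓘(ℝ, EK)) (G := K) Z) 0 := by
  have : CompleteSpace EK := FiniteDimensional.complete ℝ EK
  have : LieGroup 𝓘(ℝ, EK) (minSmoothness ℝ 3) K := by
    rw [minSmoothness_of_isRCLikeNormedField]
    exact LieGroup.of_le (n := ∞) ENat.LEInfty.out
  exact exists_isMIntegralCurveAt_of_contMDiffAt_boundaryless 0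
    ((contMDiff_mulInvariantVectorField (I := 𝓘(ℝ, EK)) (G := K) Z).contMDiffAt.of_le (by
      rw [minSmoothness_of_isRCLikeNormedField]; exact_mod_cast one_le_two))

namespace IsSmoothAction

variable {a : K → M → M} (ha : IsSmoothAction I EK a) [LieGroup 𝓘(ℝ, EK) ∞ K]
  [FiniteDimensional ℝ EK] [IsManifold I ∞ M] [I.Boundaryless]
include ha

/-- The generators of a free action vanish nowhere: at a zero of `ζ_Z` the orbit of the
one-parameter group of `Z` is an integral curve of the zero field, hence constant, and then freeness
makes this group trivial. -/
theorem fundamental_injective (hfree : ∀ k x, a k x = x → k = 1) (x : M) :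
    Function.Injective (fundamental I a x : EK →L[ℝ] TangentSpace I x) := by
  rw [injective_iff_map_eq_zero]
  intro Z hZ
  obtain ⟨c, hc0, hc⟩ := exists_leftInvariant_curve (K := K) Z
  have h1 : IsMIntegralCurveAt (I := I) (fun t => a (c t) x) (fun _ => 0) 0 := by
    filter_upwards [hc] with t ht
    have := ha.hasMFDerivAt_orbit_comp ht x
    rw [hZ, map_zero] at this
    exact this
  have h2 : IsMIntegralCurveAt (I := I) (fun _ => x) (fun _ => 0) (0 : ℝ) :=
    (isMIntegralCurve_const rfl).isMIntegralCurveAt 0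
  have hz : ContMDiffAt I I.tangent 1 (fun y : M => (⟨y, 0⟩ : TangentBundle I M)) (a (c 0) x) :=
    (contMDiff_zeroSection ℝ (TangentSpace I : M → Type _)).contMDiffAt
  have h3 := isMIntegralCurveAt_eventuallyEq_of_contMDiffAt_boundaryless hz h1 h2
    (by simp only [hc0, ha.one])
  have h4 : c =ᶠ[nhds 0] fun _ => 1 := h3.mono fun t ht => hfree _ _ ht
  have h5 := (hc.hasMFDerivAt).congr_of_eventuallyEq h4.symm
  have h6 : (0 : ℝ →L[ℝ] EK) = _ :=
    (hasMFDerivAt_const (I := 𝓘(ℝ, ℝ)) (I' := 𝓘(ℝ, EK)) (1 : K) (0 : ℝ)).mfderiv.symm.trans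
      h5.mfderiv
  have h7 := congrArg (fun L : ℝ →L[ℝ] EK => L 1) h6
  have h8 : (0 : EK) = (1 : ℝ) • (mulInvariantVectorField (I := 𝓘(ℝ, EK)) (G := K) Z (c 0) : EK) :=
    h7
  rw [one_smul, hc0] at h8
  rw [h8]
  have h9 : (fun x : K => 1 * x) = id := funext one_mul
  have h10 : (mfderiv 𝓘(ℝ, EK) 𝓘(ℝ, EK) (fun x : K => 1 * x) 1 : EK →L[ℝ] EK) =
      ContinuousLinearMap.id ℝ EK := by
    rw [h9]; exact mfderiv_id
  exact (congrArg (fun L : EK →L[ℝ] EK => L Z) h10).symm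

variable {X : ∀ x : M, TangentSpace I x}

/-- The set where an invariant vector field is tangent to the orbits is invariant. -/
theorem tangent_set_invariant (hX : ∀ k x, X (a k x) = mfderiv I I (a k) x (X x)) (k : K) {x : M}
    (hx : ∃ Y : EK, X x = fundamental I a x Y) :
    ∃ Y : EK, X (a k x) = fundamental I a (a k x) Y := by
  obtain ⟨Y, hY⟩ := hx
  exact ⟨adjoint k Y, by rw [hX, hY, ha.mfderiv_fundamental]⟩

/-- Near a point where the invariant vector field `X` equals the generator of `Y`, its integral
curve is the orbit of the one-parameter subgroup generated by `Y`. -/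
theorem eventually_tangent (hX : ∀ k x, X (a k x) = mfderiv I I (a k) x (X x))
    (hXs : ContMDiff I I.tangent ∞ (fun x => (⟨x, X x⟩ : TangentBundle I M)))
    {γ : ℝ → M} {t₀ : ℝ} (hγ : IsMIntegralCurveAt (I := I) γ X t₀)
    (h0 : ∃ Y : EK, X (γ t₀) = fundamental I a (γ t₀) Y) :
    ∀ᶠ t in nhds t₀, ∃ Y : EK, X (γ t) = fundamental I a (γ t) Y := by
  obtain ⟨Y, hY⟩ := h0
  obtain ⟨c, hc0, hc⟩ := exists_leftInvariant_curve (K := K) Y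
  have h1 : IsMIntegralCurveAt (I := I) (fun t => a (c t) (γ t₀)) X 0 := by
    filter_upwards [hc] with t ht
    have := ha.hasMFDerivAt_orbit_comp ht (γ t₀)
    rwa [← hY, ← hX] at this
  have h2 := h1.comp_add (-t₀)
  rw [zero_sub, neg_neg] at h2
  have h3 := isMIntegralCurveAt_eventuallyEq_of_contMDiffAt_boundaryless
    (hXs.contMDiffAt.of_le (by exact_mod_cast le_top)) hγ h2
    (by simp [hc0, ha.one])
  filter_upwards [h3] with t ht
  rw [ht]
  exact ha.tangent_set_invariant hX _ ⟨Y, hY⟩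

/-- The set where an invariant vector field is tangent to the orbits is flow invariant, as soon as
it is closed: along an integral curve this set of times is closed, and it is open because near such
a time the curve is the orbit of a one-parameter group. -/
theorem isFlowInvariant (hX : ∀ k x, X (a k x) = mfderiv I I (a k) x (X x))
    (hXs : ContMDiff I I.tangent ∞ (fun x => (⟨x, X x⟩ : TangentBundle I M)))
    (hcl : IsClosed {x | ∃ Y : EK, X x = fundamental I a x Y}) :
    IsFlowInvariant I X {x | ∃ Y : EK, X x = fundamental I a x Y} ∧
      IsFlowInvariant I X {x | ∃ Y : EK, X x = fundamental I a x Y}ᶜ := by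
  set A := {x | ∃ Y : EK, X x = fundamental I a x Y} with hA
  have key : ∀ (γ : ℝ → M) (s : Set ℝ), IsOpen s → s.OrdConnected →
      IsMIntegralCurveOn (I := I) γ X s → ∀ t ∈ s, ∀ t' ∈ s, γ t ∈ A → γ t' ∈ A := by
    intro γ s hs hsc hγ t ht t' ht' hta
    by_contra hne
    have hγc : ContinuousOn γ s := hγ.continuousOn
    have ho1 : IsOpen (s ∩ γ ⁻¹' A) := by
      rw [isOpen_iff_mem_nhds]
      rintro r ⟨hr, hrA⟩
      exact Filter.inter_mem (hs.mem_nhds hr)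
        (ha.eventually_tangent hX hXs (hγ.isMIntegralCurveAt (hs.mem_nhds hr)) hrA)
    have ho2 : IsOpen (s ∩ γ ⁻¹' Aᶜ) := hγc.isOpen_inter_preimage hs hcl.isOpen_compl
    obtain ⟨r, hr, ⟨-, h1⟩, -, h2⟩ := hsc.isPreconnected _ _ ho1 ho2
      (fun r hr => by
        by_cases h : γ r ∈ A
        · exact Or.inl ⟨hr, h⟩
        · exact Or.inr ⟨hr, h⟩) ⟨t, ht, ht, hta⟩ ⟨t', ht', ht', hne⟩
    exact h2 h1
  refine ⟨?_, ?_⟩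
  · rintro γ s hs hsc hγ ⟨t, ht, hta⟩ t' ht'
    exact key γ s hs hsc hγ t ht t' ht' hta
  · rintro γ s hs hsc hγ ⟨t, ht, hta⟩ t' ht' h
    exact hta (key γ s hs hsc hγ t' ht' t ht h)

end IsSmoothAction

end Actions

section Actions

variable {E H M : Type*} [NormedAddCommGroup E] [NormedSpace ℝ E] [TopologicalSpace H]
  {I : ModelWithCorners ℝ E H} [TopologicalSpace M] [ChartedSpace H M]
  {EN HN N : Type*} [NormedAddCommGroup EN] [NormedSpace ℝ EN]
  [TopologicalSpace HN] {J : ModelWithCorners ℝ EN HN} [TopologicalSpace N] [ChartedSpace HN N]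
  {EK K : Type*} [NormedAddCommGroup EK] [NormedSpace ℝ EK]
  [TopologicalSpace K] [ChartedSpace EK K] [Group K]

theorem contMDiffAt_vec_zero [IsManifold I ∞ M] {g : N → M} {n₀ : N}
    (hg : ContMDiffAt J I ∞ g n₀) :
    ContMDiffAt J I.tangent ∞ (fun n => (⟨g n, 0⟩ : TangentBundle I M)) n₀ := by
  refine contMDiffAt_vec_iff.2 ⟨hg, ?_⟩
  simp only [map_zero]
  exact contMDiffAt_const

theorem IsSmoothAction.contMDiffAt_mfderiv_left {a : K → M → M} (ha : IsSmoothAction I EK a)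
    [LieGroup 𝓘(ℝ, EK) ∞ K] [IsManifold I ∞ M]
    {g : N → M} {v : ∀ n, TangentSpace I (g n)} {k : N → K} {n₀ : N}
    (hv : ContMDiffAt J I.tangent ∞ (fun n => (⟨g n, v n⟩ : TangentBundle I M)) n₀)
    (hk : ContMDiffAt J 𝓘(ℝ, EK) ∞ k n₀) :
    ContMDiffAt J I.tangent ∞
      (fun n => (⟨a (k n) (g n), mfderiv I I (a (k n)) (g n) (v n)⟩ : TangentBundle I M)) n₀ := by
  have h3 := ((contMDiff_equivTangentBundleProd_symm (I := 𝓘(ℝ, EK)) (I' := I) (M := K) (M' := M)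
    (n := ∞)) _).comp n₀ ((contMDiffAt_vec_zero hk).prodMk hv)
  have h4 := ((ha.smooth.contMDiff_tangentMap (m := ∞) (by simp)) _).comp n₀ h3
  refine h4.congr_of_eventuallyEq (Filter.Eventually.of_forall fun n => ?_)
  simp only [Function.comp_apply, tangentMap]
  rw [mfderiv_prod_eq_add_apply (ha.smooth.mdifferentiableAt (by simp))]
  have h0 : ∀ u : TangentSpace I (a (k n) (g n)), u = 0 + u := fun u => (zero_add u).symm
  change (⟨a (k n) (g n), _⟩ : TangentBundle I M) = ⟨a (k n) (g n), _⟩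
  congr 1
  refine (h0 _).trans ?_
  congr 1
  exact (map_zero (mfderiv 𝓘(ℝ, EK) I (fun z => a z (g n)) (k n))).symm

/-- The vector `T f (v)` depends smoothly on `v`. -/
theorem contMDiffAt_mfderiv_vec [IsManifold I ∞ M] [IsManifold J ∞ N] {EP HP P : Type*}
    [NormedAddCommGroup EP] [NormedSpace ℝ EP] [TopologicalSpace HP] {L : ModelWithCorners ℝ EP HP}
    [TopologicalSpace P] [ChartedSpace HP P] {f : M → N} (hf : ContMDiff I J ∞ f)
    {g : P → M} {v : ∀ n, TangentSpace I (g n)} {n₀ : P}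
    (hv : ContMDiffAt L I.tangent ∞ (fun n => (⟨g n, v n⟩ : TangentBundle I M)) n₀) :
    ContMDiffAt L J.tangent ∞
      (fun n => (⟨f (g n), mfderiv I J f (g n) (v n)⟩ : TangentBundle J N)) n₀ :=
  ((hf.contMDiff_tangentMap (m := ∞) (by simp)) _).comp n₀ hv

end Actions

/-! ### The cotangent bundle -/

section CotangentCharts

variable {ES : Type*} [NormedAddCommGroup ES] [NormedSpace ℝ ES]
  {S : Type*} [TopologicalSpace S] [ChartedSpace ES S] [IsManifold 𝓘(ℝ, ES) ∞ S]
  {EN HN N : Type*} [NormedAddCommGroup EN] [NormedSpace ℝ EN]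
  [TopologicalSpace HN] {J : ModelWithCorners ℝ EN HN} [TopologicalSpace N] [ChartedSpace HN N]

theorem cotangent_ext {p q : CotangentBundle ES S} (h : p.proj = q.proj)
    (h2 : ∀ v : ES, (p.2 : ES →L[ℝ] ℝ) v = (q.2 : ES →L[ℝ] ℝ) v) : p = q := by
  obtain ⟨s, l⟩ := p
  obtain ⟨s', l'⟩ := q
  obtain rfl : s = s' := h
  have : l = l' := ContinuousLinearMap.ext h2
  rw [this]

theorem cotangent_inCoordinates (s : S) (p : CotangentBundle ES S) :
    ContinuousLinearMap.inCoordinates ES (fun s : S => TangentSpace 𝓘(ℝ, ES) s) ℝ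
      (Bundle.Trivial S ℝ) s p.proj s p.proj p.2 =
      (p.2 : TangentSpace 𝓘(ℝ, ES) p.proj →L[ℝ] ℝ).comp (frame 𝓘(ℝ, ES) s p.proj) := by
  ext v
  simp [ContinuousLinearMap.inCoordinates, frame]

/-- The bundle chart at `p` in terms of the chart of `S` and of its frame. -/
theorem extChartAt_cotangent_apply (p q : CotangentBundle ES S) :
    extChartAt (cotangentModel ES) p q = (extChartAt 𝓘(ℝ, ES) p.proj q.proj,
      (q.2 : TangentSpace 𝓘(ℝ, ES) q.proj →L[ℝ] ℝ).comp (frame 𝓘(ℝ, ES) p.proj q.proj)) := by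
  rw [← cotangent_inCoordinates]
  simp only [extChartAt, OpenPartialHomeomorph.extend_coe, hom_chart, Function.comp_apply]
  rfl

theorem extChartAt_cotangent_source (p : CotangentBundle ES S) :
    (extChartAt (cotangentModel ES) p).source = {q | q.proj ∈ (chartAt ES p.proj).source} := by
  rw [FiberBundle.extChartAt]
  ext q
  simp only [mfld_simps, hom_trivializationAt_source, hom_trivializationAt_apply]
  simp

theorem contMDiffAt_cotangent_iff [FiniteDimensional ℝ ES] {g : N → CotangentBundle ES S} {n₀ : N} :
    ContMDiffAt J (cotangentModel ES) ∞ g n₀ ↔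
      ContMDiffAt J 𝓘(ℝ, ES) ∞ (fun n => (g n).proj) n₀ ∧
        ∀ e : ES, ContMDiffAt J 𝓘(ℝ, ℝ) ∞ (fun n => ((g n).2 :
          TangentSpace 𝓘(ℝ, ES) (g n).proj →L[ℝ] ℝ)
            (frame 𝓘(ℝ, ES) (g n₀).proj (g n).proj e)) n₀ := by
  refine (contMDiffAt_hom_bundle g).trans (and_congr_right fun hg => ?_)
  simp only [cotangent_inCoordinates]
  exact ⟨fun h e => h.clm_apply contMDiffAt_const, fun h => contMDiffAt_clm_of_apply h⟩

theorem contMDiff_cotangent_proj : ContMDiff (cotangentModel ES) 𝓘(ℝ, ES) ∞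
    (fun p : CotangentBundle ES S => p.proj) := contMDiff_proj _

theorem contMDiffAt_pairing [FiniteDimensional ℝ ES] {g : N → CotangentBundle ES S}
    {v : ∀ n, TangentSpace 𝓘(ℝ, ES) (g n).proj} {n₀ : N}
    (hg : ContMDiffAt J (cotangentModel ES) ∞ g n₀)
    (hv : ContMDiffAt J 𝓘(ℝ, ES).tangent ∞
      (fun n => (⟨(g n).proj, v n⟩ : TangentBundle 𝓘(ℝ, ES) S)) n₀) :
    ContMDiffAt J 𝓘(ℝ, ℝ) ∞
      (fun n => ((g n).2 : TangentSpace 𝓘(ℝ, ES) (g n).proj →L[ℝ] ℝ) (v n)) n₀ := by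
  have h1 := (contMDiffAt_cotangent_iff.1 hg).2
  have h2 : ContMDiffAt J 𝓘(ℝ, ES →L[ℝ] ℝ) ∞ (fun n => (((g n).2 :
      TangentSpace 𝓘(ℝ, ES) (g n).proj →L[ℝ] ℝ).comp
        (frame 𝓘(ℝ, ES) (g n₀).proj (g n).proj) : ES →L[ℝ] ℝ)) n₀ := contMDiffAt_clm_of_apply h1
  refine (h2.clm_apply (contMDiffAt_coord hv)).congr_of_eventuallyEq ?_
  filter_upwards [eventually_mem_chart (contMDiffAt_foot hv)] with n hn
  simp only [ContinuousLinearMap.comp_apply, frame_coord hn]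

theorem smoothForm_canonicalOneForm [FiniteDimensional ℝ ES] :
    SmoothForm (canonicalOneForm (ES := ES) (S := S)) := by
  intro w
  have hid : ContMDiffAt (cotangentModel ES).tangent (cotangentModel ES).tangent ∞
    (fun w : TangentBundle (cotangentModel ES) (CotangentBundle ES S) =>
      (⟨w.proj, w.2⟩ : TangentBundle (cotangentModel ES) (CotangentBundle ES S))) w :=
    contMDiffAt_id
  exact contMDiffAt_pairing (contMDiffAt_foot hid)
    (contMDiffAt_mfderiv_vec contMDiff_cotangent_proj hid)

theorem frame_coord_pairing (s : S) (p : CotangentBundle ES S)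
    (h : p.proj ∈ (chartAt ES s).source) (w : TangentSpace 𝓘(ℝ, ES) p.proj) :
    (p.2 : TangentSpace 𝓘(ℝ, ES) p.proj →L[ℝ] ℝ) w =
      ((p.2 : TangentSpace 𝓘(ℝ, ES) p.proj →L[ℝ] ℝ).comp (frame 𝓘(ℝ, ES) s p.proj))
        (mfderiv 𝓘(ℝ, ES) 𝓘(ℝ, ES) (extChartAt 𝓘(ℝ, ES) s) p.proj w) := by
  have h1 := TangentBundle.continuousLinearMapAt_trivializationAt (I := 𝓘(ℝ, ES)) h
  have h2 := frame_coord (I := 𝓘(ℝ, ES)) h w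
  rw [coord, h1] at h2
  exact congrArg (p.2 : TangentSpace 𝓘(ℝ, ES) p.proj →L[ℝ] ℝ) h2.symm

/-- In a bundle chart, the derivative of the foot point projection is the first projection. -/
theorem mfderiv_extChartAt_footDeriv (p q : CotangentBundle ES S)
    (hq : q ∈ (extChartAt (cotangentModel ES) p).source)
    (ξ : TangentSpace (cotangentModel ES) q) :
    (mfderiv 𝓘(ℝ, ES) 𝓘(ℝ, ES) (extChartAt 𝓘(ℝ, ES) p.proj) q.proj (footDeriv q ξ) : ES) =
      (mfderiv (cotangentModel ES) 𝓘(ℝ, ES × (ES →L[ℝ] ℝ)) (extChartAt (cotangentModel ES) p) q ξ :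
        ES × (ES →L[ℝ] ℝ)).1 := by
  have hq' : q.proj ∈ (chartAt ES p.proj).source := by
    rwa [extChartAt_cotangent_source] at hq
  have hq'' : q ∈ (chartAt (ModelProd ES (ES →L[ℝ] ℝ)) p).source := by
    rwa [← extChartAt_source (I := cotangentModel ES)]
  have h1 := mfderiv_comp_apply q (f := fun p : CotangentBundle ES S => p.proj)
    (g := extChartAt 𝓘(ℝ, ES) p.proj) (mdifferentiableAt_extChartAt hq')
    (contMDiff_cotangent_proj.mdifferentiableAt (by simp)) ξ
  have h2 := mfderiv_comp_apply q (f := extChartAt (cotangentModel ES) p)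
    (g := (Prod.fst : ES × (ES →L[ℝ] ℝ) → ES)) (I' := 𝓘(ℝ, ES × (ES →L[ℝ] ℝ)))
    (I'' := 𝓘(ℝ, ES)) differentiableAt_fst.mdifferentiableAt
    (mdifferentiableAt_extChartAt hq'') ξ
  have h3 : (Prod.fst : ES × (ES →L[ℝ] ℝ) → ES) ∘ extChartAt (cotangentModel ES) p =
      extChartAt 𝓘(ℝ, ES) p.proj ∘ fun p : CotangentBundle ES S => p.proj := by
    funext q
    simp only [Function.comp_apply, extChartAt_cotangent_apply]
  rw [h3, mfderiv_eq_fderiv, fderiv_fst] at h2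
  exact h1.symm.trans h2

/-- In the coordinates of the preferred chart at `p` itself, the derivative of the foot point
projection is the first projection. -/
theorem footDeriv_apply (p : CotangentBundle ES S) (ξ : TangentSpace (cotangentModel ES) p) :
    (footDeriv p ξ : ES) = (ξ : ES × (ES →L[ℝ] ℝ)).1 := by
  have h := mfderiv_extChartAt_footDeriv p p (mem_extChartAt_source p) ξ
  rwa [mfderiv_extChartAt_self, mfderiv_extChartAt_self] at h

/-- The canonical one-form is `p dq` in every bundle chart. -/
theorem oneFormInChart_canonicalOneForm (p : CotangentBundle ES S) {y : ES × (ES →L[ℝ] ℝ)}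
    (hy : y ∈ (extChartAt (cotangentModel ES) p).target) (v : ES × (ES →L[ℝ] ℝ)) :
    oneFormInChart (cotangentModel ES) (canonicalOneForm (ES := ES) (S := S)) p y v =
      y.2 v.1 := by
  set q := (extChartAt (cotangentModel ES) p).symm y with hq
  have hqs : q ∈ (extChartAt (cotangentModel ES) p).source :=
    (extChartAt (cotangentModel ES) p).map_target hy
  have hq' : q.proj ∈ (chartAt ES p.proj).source := by
    rwa [extChartAt_cotangent_source] at hqs
  have h0 : extChartAt (cotangentModel ES) p q = y := (extChartAt _ p).right_inv hy
  have h1 := frame_coord_pairing p.proj q hq' (footDeriv q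
    (mfderiv 𝓘(ℝ, ES × (ES →L[ℝ] ℝ)) (cotangentModel ES) (extChartAt (cotangentModel ES) p).symm
      y v))
  have h2 := mfderiv_extChartAt_footDeriv p q hqs
    (mfderiv 𝓘(ℝ, ES × (ES →L[ℝ] ℝ)) (cotangentModel ES) (extChartAt (cotangentModel ES) p).symm
      y v)
  have h3 := mfderiv_extChartAt_comp_mfderivWithin_extChartAt_symm hy
  rw [ModelWithCorners.range_eq_univ, mfderivWithin_univ] at h3
  have h4 := congrArg (fun L : (ES × (ES →L[ℝ] ℝ)) →L[ℝ] (ES × (ES →L[ℝ] ℝ)) => L v) h3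
  rw [h2] at h1
  rw [extChartAt_cotangent_apply] at h0
  have h5 : ((q.2 : TangentSpace 𝓘(ℝ, ES) q.proj →L[ℝ] ℝ).comp
    (frame 𝓘(ℝ, ES) p.proj q.proj) : ES →L[ℝ] ℝ) = y.2 := congrArg Prod.snd h0
  rw [h5] at h1
  exact h1.trans (congrArg (fun w : ES × (ES →L[ℝ] ℝ) => y.2 w.1) h4)

/-- The canonical symplectic form in the preferred chart at the given point. -/
theorem canonicalTwoForm_apply (p : CotangentBundle ES S)
    (ξ η : TangentSpace (cotangentModel ES) p) :
    canonicalTwoForm p ξ η =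
      (η : ES × (ES →L[ℝ] ℝ)).2 (ξ : ES × (ES →L[ℝ] ℝ)).1 -
        (ξ : ES × (ES →L[ℝ] ℝ)).2 (η : ES × (ES →L[ℝ] ℝ)).1 := by
  let Θ : (ES × (ES →L[ℝ] ℝ)) →L[ℝ] (ES × (ES →L[ℝ] ℝ)) →L[ℝ] ℝ :=
    (ContinuousLinearMap.precomp ℝ (ContinuousLinearMap.fst ℝ ES (ES →L[ℝ] ℝ))).comp
      (ContinuousLinearMap.snd ℝ ES (ES →L[ℝ] ℝ))
  have h1 : oneFormInChart (cotangentModel ES) (canonicalOneForm (ES := ES) (S := S)) p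
      =ᶠ[nhds (extChartAt (cotangentModel ES) p p)] Θ := by
    filter_upwards [eventually_mem_extChartAt_target (I := cotangentModel ES) p] with y hy
    exact ContinuousLinearMap.ext fun v => oneFormInChart_canonicalOneForm p hy v
  have h2 : fderiv ℝ (oneFormInChart (cotangentModel ES)
      (canonicalOneForm (ES := ES) (S := S)) p) (extChartAt (cotangentModel ES) p p) = Θ := by
    rw [h1.fderiv_eq, ContinuousLinearMap.fderiv]
  have h3 : canonicalTwoForm p ξ η = -(extDerivOneForm (cotangentModel ES)
    (canonicalOneForm (ES := ES) (S := S)) p ξ η) := rfl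
  rw [h3, extDerivOneForm_apply, h2, neg_sub]
  rfl

/-- The line `t ↦ p + t β` in the fibre of `T*S` through `p`. -/
def fibreLine (p : CotangentBundle ES S) (β : ES →L[ℝ] ℝ) (t : ℝ) : CotangentBundle ES S :=
  let l : ES →L[ℝ] ℝ := p.2
  ⟨p.proj, (l + t • β : ES →L[ℝ] ℝ)⟩

/-- The straight lines in the fibres of `T*S` are straight in the bundle charts. -/
theorem extChartAt_fibreLine (p : CotangentBundle ES S) (β : ES →L[ℝ] ℝ) (t : ℝ) :
    extChartAt (cotangentModel ES) p p + t • ((0, β) : ES × (ES →L[ℝ] ℝ)) ∈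
        (extChartAt (cotangentModel ES) p).target ∧
      (extChartAt (cotangentModel ES) p).symm
        (extChartAt (cotangentModel ES) p p + t • ((0, β) : ES × (ES →L[ℝ] ℝ))) =
      fibreLine p β t := by
  have hqs : fibreLine p β t ∈ (extChartAt (cotangentModel ES) p).source := by
    rw [extChartAt_cotangent_source]; exact mem_chart_source ES p.proj
  have h1 : extChartAt (cotangentModel ES) p (fibreLine p β t) =
      extChartAt (cotangentModel ES) p p + t • ((0, β) : ES × (ES →L[ℝ] ℝ)) := by
    have hf : (fibreLine p β t).proj = p.proj := rfl
    have hfr : ∀ v : ES, (frame 𝓘(ℝ, ES) p.proj p.proj : ES →L[ℝ] ES) v = v := fun v =>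
      congrArg (fun L : ES →L[ℝ] ES => L v) (frame_self (I := 𝓘(ℝ, ES)) p.proj)
    rw [extChartAt_cotangent_apply, extChartAt_cotangent_apply]
    refine Prod.ext ?_ (ContinuousLinearMap.ext fun v => ?_)
    · change _ = extChartAt 𝓘(ℝ, ES) p.proj p.proj + t • (0 : ES)
      rw [smul_zero, add_zero]
      rfl
    · change (p.2 : ES →L[ℝ] ℝ) ((frame 𝓘(ℝ, ES) p.proj p.proj : ES →L[ℝ] ES) v) +
        t • β ((frame 𝓘(ℝ, ES) p.proj p.proj : ES →L[ℝ] ES) v) =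
        (p.2 : ES →L[ℝ] ℝ) ((frame 𝓘(ℝ, ES) p.proj p.proj : ES →L[ℝ] ES) v) + t • β v
      rw [hfr]
  rw [← h1]
  exact ⟨(extChartAt _ p).map_source hqs, (extChartAt _ p).left_inv hqs⟩

/-- The velocity of the line `t ↦ p + t β` at `t = 0` is the vertical lift of `β`. -/
theorem mfderiv_comp_fibreLine {F : Type*} [NormedAddCommGroup F] [NormedSpace ℝ F]
    (p : CotangentBundle ES S) (β : ES →L[ℝ] ℝ) {f : CotangentBundle ES S → F}
    (hf : MDifferentiableAt (cotangentModel ES) 𝓘(ℝ, F) f p) :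
    HasDerivAt (fun t => f (fibreLine p β t))
      (mfderiv (cotangentModel ES) 𝓘(ℝ, F) f p
        (((0, β) : ES × (ES →L[ℝ] ℝ)) : TangentSpace (cotangentModel ES) p) : F) 0 := by
  set χ := extChartAt (cotangentModel ES) p
  have h1 : DifferentiableAt ℝ (f ∘ χ.symm) (χ p) := by
    have h2 : MDifferentiableAt 𝓘(ℝ, ES × (ES →L[ℝ] ℝ)) (cotangentModel ES) χ.symm (χ p) :=
      (extChartAt_symm_contMDiffAt (mem_extChartAt_target p)).mdifferentiableAt (by simp)
    rw [← mdifferentiableAt_iff_differentiableAt]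
    refine MDifferentiableAt.comp _ ?_ h2
    rw [extChartAt_to_inv]
    exact hf
  have h2 : (mfderiv (cotangentModel ES) 𝓘(ℝ, F) f p : ES × (ES →L[ℝ] ℝ) →L[ℝ] F) =
      fderiv ℝ (f ∘ χ.symm) (χ p) := by
    rw [hf.mfderiv, ModelWithCorners.range_eq_univ, fderivWithin_univ]
    rfl
  have h3 : HasDerivAt (fun t : ℝ => χ p + t • ((0, β) : ES × (ES →L[ℝ] ℝ)))
      ((0, β) : ES × (ES →L[ℝ] ℝ)) 0 := by
    simpa using ((hasDerivAt_id (0 : ℝ)).smul_const ((0, β) : ES × (ES →L[ℝ] ℝ))).const_add (χ p)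
  have h4 : χ p = χ p + (0 : ℝ) • ((0, β) : ES × (ES →L[ℝ] ℝ)) := by simp
  have h5 : HasFDerivAt (f ∘ χ.symm) (fderiv ℝ (f ∘ χ.symm) (χ p))
      (χ p + (0 : ℝ) • ((0, β) : ES × (ES →L[ℝ] ℝ))) := by
    rw [← h4]; exact h1.hasFDerivAt
  have h6 := h5.comp_hasDerivAt (0 : ℝ) h3
  rw [← h2] at h6
  refine h6.congr_of_eventuallyEq (Filter.Eventually.of_forall fun t => ?_)
  exact congrArg f (extChartAt_fibreLine p β t).2.symm

end CotangentCharts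

/-! ### The cotangent lift of an action -/

section CotangentLift

variable {ES : Type*} [NormedAddCommGroup ES] [NormedSpace ℝ ES]
  {S : Type*} [TopologicalSpace S] [ChartedSpace ES S] [IsManifold 𝓘(ℝ, ES) ∞ S]
  {EK K : Type*} [NormedAddCommGroup EK] [NormedSpace ℝ EK]
  [TopologicalSpace K] [ChartedSpace EK K] [Group K]
  [MulAction K S]

theorem isSmoothAction_smul [ContMDiffSMul 𝓘(ℝ, EK) 𝓘(ℝ, ES) ∞ K S] :
    IsSmoothAction 𝓘(ℝ, ES) EK (fun (k : K) (s : S) => k • s) where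
  smooth := contMDiff_smul
  one := one_smul K
  mul := mul_smul

variable (EK) in
/-- The defining property of the cotangent lift: it preserves the pairing with vectors. -/
theorem cotangentLift_mfderiv [ContMDiffSMul 𝓘(ℝ, EK) 𝓘(ℝ, ES) ∞ K S] (k : K)
    (p : CotangentBundle ES S)
    (w : TangentSpace 𝓘(ℝ, ES) p.proj) :
    ((cotangentLift k p).2 : TangentSpace 𝓘(ℝ, ES) (k • p.proj) →L[ℝ] ℝ)
        (mfderiv 𝓘(ℝ, ES) 𝓘(ℝ, ES) (fun s : S => k • s) p.proj w) =
      (p.2 : TangentSpace 𝓘(ℝ, ES) p.proj →L[ℝ] ℝ) w :=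
  congrArg (p.2 : ES →L[ℝ] ℝ)
    ((isSmoothAction_smul (EK := EK) (ES := ES) (K := K) (S := S)).mfderiv_inv_left k p.proj w)

theorem isSmoothAction_cotangentLift [LieGroup 𝓘(ℝ, EK) ∞ K]
    [ContMDiffSMul 𝓘(ℝ, EK) 𝓘(ℝ, ES) ∞ K S]
    [FiniteDimensional ℝ ES] :
    IsSmoothAction (cotangentModel ES) EK
      (cotangentLift (ES := ES) (S := S) (K := K)) where
  smooth := by
    have hS := isSmoothAction_smul (EK := EK) (ES := ES) (K := K) (S := S)
    rintro ⟨k₀, p₀⟩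
    have hfst : ContMDiffAt (𝓘(ℝ, EK).prod (cotangentModel ES)) 𝓘(ℝ, EK) ∞
      (fun x : K × CotangentBundle ES S => x.1) (k₀, p₀) := contMDiffAt_fst
    have hsnd : ContMDiffAt (𝓘(ℝ, EK).prod (cotangentModel ES)) (cotangentModel ES) ∞
      (fun x : K × CotangentBundle ES S => x.2) (k₀, p₀) := contMDiffAt_snd
    have hproj : ContMDiffAt (𝓘(ℝ, EK).prod (cotangentModel ES)) 𝓘(ℝ, ES) ∞
        (fun x : K × CotangentBundle ES S => x.2.proj) (k₀, p₀) :=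
      (contMDiff_cotangent_proj _).comp _ hsnd
    have hfoot : ContMDiffAt (𝓘(ℝ, EK).prod (cotangentModel ES)) 𝓘(ℝ, ES) ∞
        (fun x : K × CotangentBundle ES S => x.1 • x.2.proj) (k₀, p₀) :=
      (hS.smooth _).comp (k₀, p₀) (hfst.prodMk hproj)
    refine contMDiffAt_cotangent_iff.2 ⟨hfoot, fun e => ?_⟩
    have hfr := contMDiffAt_frame hfoot (contMDiffAt_const (c := e))
    have hinv : ContMDiffAt (𝓘(ℝ, EK).prod (cotangentModel ES)) 𝓘(ℝ, EK) ∞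
      (fun x : K × CotangentBundle ES S => x.1⁻¹) (k₀, p₀) := hfst.inv
    have h1 := hS.contMDiffAt_mfderiv_left hfr hinv
    refine contMDiffAt_pairing (v := fun x => (mfderiv 𝓘(ℝ, ES) 𝓘(ℝ, ES)
      (fun s : S => x.1⁻¹ • s) (x.1 • x.2.proj)
      (frame 𝓘(ℝ, ES) (k₀ • p₀.proj) (x.1 • x.2.proj) e) : ES)) hsnd ?_
    refine h1.congr_of_eventuallyEq (Filter.Eventually.of_forall fun x => ?_)
    exact tangent_mk_congr (inv_smul_smul x.1 x.2.proj).symm _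
  one p := by
    refine cotangent_ext (one_smul K p.proj) fun v => ?_
    have h1 : (fun s : S => (1 : K)⁻¹ • s) = id := by
      funext s; simp
    have h2 : ∀ s : S, (mfderiv 𝓘(ℝ, ES) 𝓘(ℝ, ES) (fun s : S => (1 : K)⁻¹ • s) s : ES →L[ℝ] ES) =
        ContinuousLinearMap.id ℝ ES := by
      rw [h1]; exact fun s => mfderiv_id
    exact congrArg (p.2 : ES →L[ℝ] ℝ) (congrArg (fun L : ES →L[ℝ] ES => L v) (h2 _))
  mul k j p := by
    have hS := isSmoothAction_smul (EK := EK) (ES := ES) (K := K) (S := S)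
    refine cotangent_ext (mul_smul k j p.proj) fun v => ?_
    have h1 := mfderiv_comp_apply (k • j • p.proj) (hS.mdifferentiableAt_left j⁻¹ _)
      (hS.mdifferentiableAt_left k⁻¹ (k • j • p.proj)) v
    have h2 : (fun s : S => j⁻¹ • s) ∘ (fun s : S => k⁻¹ • s) = fun s => (k * j)⁻¹ • s := by
      funext s; simp [mul_smul]
    rw [h2] at h1
    refine congrArg (p.2 : ES →L[ℝ] ℝ) ?_
    refine (mfderiv_congr_base (mul_smul k j p.proj) v).trans (h1.trans ?_)
    exact mfderiv_congr_base (inv_smul_smul k (j • p.proj)) _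

variable [FiniteDimensional ℝ ES]

variable (EK) in
theorem footDeriv_cotangentLift [LieGroup 𝓘(ℝ, EK) ∞ K]
    [ContMDiffSMul 𝓘(ℝ, EK) 𝓘(ℝ, ES) ∞ K S]
    (k : K) (p : CotangentBundle ES S)
    (ξ : TangentSpace (cotangentModel ES) p) :
    footDeriv (cotangentLift k p)
        (mfderiv (cotangentModel ES) (cotangentModel ES) (cotangentLift k) p ξ) =
      mfderiv 𝓘(ℝ, ES) 𝓘(ℝ, ES) (fun s : S => k • s) p.proj (footDeriv p ξ) := by
  have hS := isSmoothAction_smul (EK := EK) (ES := ES) (K := K) (S := S)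
  have hT := isSmoothAction_cotangentLift (EK := EK) (ES := ES) (K := K) (S := S)
  have hp : ∀ p, MDifferentiableAt (cotangentModel ES) 𝓘(ℝ, ES)
    (fun p : CotangentBundle ES S => p.proj) p :=
    fun p => contMDiff_cotangent_proj.mdifferentiableAt (by simp)
  have h1 := mfderiv_comp_apply p (hp (cotangentLift k p)) (hT.mdifferentiableAt_left k p) ξ
  have h2 := mfderiv_comp_apply p (hS.mdifferentiableAt_left k p.proj) (hp p) ξ
  exact h1.symm.trans h2

theorem footDeriv_fundamental [LieGroup 𝓘(ℝ, EK) ∞ K]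
    [ContMDiffSMul 𝓘(ℝ, EK) 𝓘(ℝ, ES) ∞ K S]
    (p : CotangentBundle ES S) (Y : EK) :
    footDeriv p (fundamental (cotangentModel ES) (cotangentLift (K := K)) p Y) =
      fundamental 𝓘(ℝ, ES) (fun (k : K) (s : S) => k • s) p.proj Y := by
  have hT := isSmoothAction_cotangentLift (EK := EK) (ES := ES) (K := K) (S := S)
  have hp : ∀ p, MDifferentiableAt (cotangentModel ES) 𝓘(ℝ, ES)
    (fun p : CotangentBundle ES S => p.proj) p :=
    fun p => contMDiff_cotangent_proj.mdifferentiableAt (by simp)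
  have h1 := mfderiv_comp_apply (1 : K) (hp (cotangentLift 1 p)) (hT.mdifferentiableAt_orbit p 1) Y
  exact (mfderiv_congr_base (hT.one p).symm _).trans h1.symm

variable (EK) in
theorem canonicalOneForm_cotangentLift [LieGroup 𝓘(ℝ, EK) ∞ K]
    [ContMDiffSMul 𝓘(ℝ, EK) 𝓘(ℝ, ES) ∞ K S]
    (k : K) (p : CotangentBundle ES S)
    (ξ : TangentSpace (cotangentModel ES) p) :
    canonicalOneForm (cotangentLift k p)
        (mfderiv (cotangentModel ES) (cotangentModel ES) (cotangentLift k) p ξ) =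
      canonicalOneForm p ξ := by
  have h := cotangentLift_mfderiv EK k p (footDeriv p ξ)
  rw [← footDeriv_cotangentLift EK] at h
  exact h

variable (EK) in
/-- Cotangent lifts are symplectic. -/
theorem canonicalTwoForm_cotangentLift [LieGroup 𝓘(ℝ, EK) ∞ K]
    [ContMDiffSMul 𝓘(ℝ, EK) 𝓘(ℝ, ES) ∞ K S]
    (k : K) (p : CotangentBundle ES S)
    (ξ η : TangentSpace (cotangentModel ES) p) :
    canonicalTwoForm (cotangentLift k p)
        (mfderiv (cotangentModel ES) (cotangentModel ES) (cotangentLift k) p ξ)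
        (mfderiv (cotangentModel ES) (cotangentModel ES) (cotangentLift k) p η) =
      canonicalTwoForm p ξ η := by
  have hT := isSmoothAction_cotangentLift (EK := EK) (ES := ES) (K := K) (S := S)
  have h := extDerivOneForm_pullback smoothForm_canonicalOneForm
    (β := canonicalOneForm (ES := ES) (S := S)) (hT.contMDiff_left k p)
    (Filter.Eventually.of_forall fun q v => (canonicalOneForm_cotangentLift EK k q v).symm) ξ η
  exact congrArg Neg.neg h.symm

end CotangentLift

/-! ### Differentials of functions, Hessians and the correction of a principal connection -/

section Differentials

variable {E H M : Type*} [NormedAddCommGroup E] [NormedSpace ℝ E] [TopologicalSpace H]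
  {I : ModelWithCorners ℝ E H} [TopologicalSpace M] [ChartedSpace H M] [IsManifold I ∞ M]
  {F : Type*} [NormedAddCommGroup F] [NormedSpace ℝ F]
  {EK K : Type*} [NormedAddCommGroup EK] [NormedSpace ℝ EK]
  [TopologicalSpace K] [ChartedSpace EK K] [Group K]

theorem smoothForm_mfderiv {f : M → F} (hf : ContMDiff I 𝓘(ℝ, F) ∞ f) :
    SmoothForm (fun x => (mfderiv I 𝓘(ℝ, F) f x : TangentSpace I x →L[ℝ] F)) :=
  contMDiff_snd_tangentBundle_modelSpace F 𝓘(ℝ, F) |>.comp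
    (hf.contMDiff_tangentMap (m := ∞) (by simp))

/-- The derivative of an equivariant function is equivariant. -/
theorem IsSmoothAction.mfderiv_equivariant {a : K → M → M} (ha : IsSmoothAction I EK a)
    {f : M → F} (hf : ContMDiff I 𝓘(ℝ, F) ∞ f) {k : K} {L : F →L[ℝ] F}
    (h : ∀ x, f (a k x) = L (f x)) (x : M) (v : TangentSpace I x) :
    (mfderiv I 𝓘(ℝ, F) f (a k x) (mfderiv I I (a k) x v) : F) =
      L (mfderiv I 𝓘(ℝ, F) f x v : F) := by
  have hfd : ∀ x, MDifferentiableAt I 𝓘(ℝ, F) f x := fun x => hf.mdifferentiableAt (by simp)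
  have h1 := mfderiv_comp_apply x (hfd (a k x)) (ha.mdifferentiableAt_left k x) v
  have h2 := mfderiv_comp_apply x (I'' := 𝓘(ℝ, F)) (g := (L : F → F))
    L.mdifferentiableAt (hfd x) v
  have h3 : f ∘ a k = L ∘ f := funext h
  rw [h3, h2, ContinuousLinearMap.mfderiv_eq] at h1
  exact h1.symm

theorem contMDiff_mfderiv_apply {f : M → F} (hf : ContMDiff I 𝓘(ℝ, F) ∞ f)
    {X : ∀ x : M, TangentSpace I x}
    (hX : ContMDiff I I.tangent ∞ (fun x => (⟨x, X x⟩ : TangentBundle I M))) :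
    ContMDiff I 𝓘(ℝ, F) ∞ (fun x => (mfderiv I 𝓘(ℝ, F) f x (X x) : F)) := fun x =>
  (smoothForm_mfderiv hf).apply (hX x)

/-- At a critical point of `f`, the derivative of `y ↦ df(V y)` along `V` is the second derivative
of `f` along the line with velocity `V`. -/
theorem fderiv_fderiv_apply_of_line {f : E → ℝ} {V : E → E} {y : E} {v : E} {N : ℝ}
    (hf : ContDiffAt ℝ ∞ f y) (hV : DifferentiableAt ℝ V y) (hv : V y = v)
    (hcrit : fderiv ℝ f y = 0) (hN : ∀ t : ℝ, f (y + t • v) = t ^ 2 * N) :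
    fderiv ℝ (fun y => fderiv ℝ f y (V y)) y v = 2 * N := by
  have hd2 : ContDiffAt ℝ ∞ (fderiv ℝ f) y := hf.fderiv_right (by simp)
  have h2 : (fderiv ℝ (fun y => fderiv ℝ f y (V y)) y) v = fderiv ℝ (fderiv ℝ f) y v v := by
    rw [fderiv_clm_apply (hd2.differentiableAt (by simp)) hV, hcrit, hv]
    simp
  have hl : ∀ t : ℝ, HasDerivAt (fun t : ℝ => y + t • v) v t := fun t => by
    simpa using ((hasDerivAt_id t).smul_const v).const_add y
  have h0 : y + (0 : ℝ) • v = y := by simp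
  have h3 : HasDerivAt (fun t : ℝ => fderiv ℝ f (y + t • v) v)
      (fderiv ℝ (fderiv ℝ f) y v v) 0 := by
    have h4 : HasFDerivAt (fderiv ℝ f) (fderiv ℝ (fderiv ℝ f) y) (y + (0 : ℝ) • v) := by
      rw [h0]; exact (hd2.differentiableAt (by simp)).hasFDerivAt
    have h5 : HasDerivAt (fun t : ℝ => fderiv ℝ f (y + t • v)) (fderiv ℝ (fderiv ℝ f) y v) 0 :=
      h4.comp_hasDerivAt (0 : ℝ) (hl 0)
    exact (ContinuousLinearMap.apply ℝ ℝ v).hasFDerivAt.comp_hasDerivAt (0 : ℝ) h5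
  have h5 : (fun t : ℝ => fderiv ℝ f (y + t • v) v) =ᶠ[nhds 0] fun t => 2 * t * N := by
    have hev : ∀ᶠ z in nhds y, ContDiffAt ℝ 1 f z :=
      (hf.of_le (m := 1) (by exact_mod_cast le_top)).eventually (by simp)
    have htend : Filter.Tendsto (fun t : ℝ => y + t • v) (nhds 0) (nhds y) := by
      have := (hl 0).continuousAt.tendsto
      rwa [h0] at this
    filter_upwards [htend.eventually hev] with t ht
    have h6 := ((ht.differentiableAt (by simp)).hasFDerivAt.comp_hasDerivAt t (hl t))
    have h7 : f ∘ (fun t : ℝ => y + t • v) = fun t => t ^ 2 * N := funext hN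
    rw [h7] at h6
    refine h6.unique ?_
    simpa using (hasDerivAt_pow 2 t).mul_const N
  have h8 : HasDerivAt (fun t : ℝ => 2 * t * N) (2 * N) 0 := by
    simpa using ((hasDerivAt_id (0 : ℝ)).const_mul 2).mul_const N
  rw [h2]
  exact h3.unique (h8.congr_of_eventuallyEq h5)

/-- At a minimum of `f`, the iterated derivative of `f` along a vector field `V` is the second
derivative of `f` along the line, in a chart, with the velocity `V`. -/
theorem mfderiv_mfderiv_of_isMin [I.Boundaryless] {f : M → ℝ} (hf : ContMDiff I 𝓘(ℝ, ℝ) ∞ f)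
    {V : ∀ x : M, TangentSpace I x}
    (hV : ContMDiff I I.tangent ∞ (fun x => (⟨x, V x⟩ : TangentBundle I M))) {p : M}
    (hmin : ∀ x, f p ≤ f x) {N : ℝ} {v : E} (hv : V p = v)
    (hN : ∀ t : ℝ, f ((extChartAt I p).symm (extChartAt I p p + t • v)) = t ^ 2 * N) :
    (mfderiv I 𝓘(ℝ, ℝ) (fun x => (mfderiv I 𝓘(ℝ, ℝ) f x (V x) : ℝ)) p (V p) : ℝ) = 2 * N := by
  let Vx : M → E := fun x => coord I p x (V x)
  let fc : E → ℝ := fun y => f ((extChartAt I p).symm y)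
  let Vc : E → E := fun y => Vx ((extChartAt I p).symm y)
  have hχs : ContMDiffAt 𝓘(ℝ, E) I ∞ (extChartAt I p).symm (extChartAt I p p) :=
    extChartAt_symm_contMDiffAt (mem_extChartAt_target p)
  have hp : (extChartAt I p).symm (extChartAt I p p) = p := extChartAt_to_inv p
  have hfc : ContDiffAt ℝ ∞ fc (extChartAt I p p) :=
    contMDiffAt_iff_contDiffAt.1 ((hf _).comp _ hχs)
  have hVx : ContMDiffAt I 𝓘(ℝ, E) ∞ Vx p :=
    contMDiffAt_coord (J := I) (g := fun x : M => x) (v := V) (n₀ := p) (hV p)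
  have hVc : ContDiffAt ℝ ∞ Vc (extChartAt I p p) :=
    contMDiffAt_iff_contDiffAt.1 (hVx.comp_of_eq hχs hp)
  have hVxp : Vx p = v := by
    have h1 := frame_coord (I := I) (mem_chart_source H p) (V p)
    have h2 := congrArg (fun L : E →L[ℝ] E => L (coord I p p (V p))) (frame_self (I := I) p)
    exact h2.symm.trans (h1.trans hv)
  have hVp : Vc (extChartAt I p p) = v := (congrArg Vx hp).trans hVxp
  have hcrit : fderiv ℝ fc (extChartAt I p p) = 0 := by
    refine IsLocalMin.fderiv_eq_zero (Filter.Eventually.of_forall fun y => ?_)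
    exact (congrArg f hp).le.trans (hmin _)
  have hg : (fun y => (mfderiv I 𝓘(ℝ, ℝ) f ((extChartAt I p).symm y)
      (V ((extChartAt I p).symm y)) : ℝ)) =ᶠ[nhds (extChartAt I p p)]
      fun y => fderiv ℝ fc y (Vc y) := by
    filter_upwards [eventually_mem_extChartAt_target (I := I) p] with y hy
    have hy' : (extChartAt I p).symm y ∈ (chartAt H p).source := by
      rw [← extChartAt_source (I := I)]; exact (extChartAt I p).map_target hy
    have h1 := frame_coord (I := I) hy' (V ((extChartAt I p).symm y))
    have h2 := frame_eq_mfderiv (I := I) hy'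
    rw [(extChartAt I p).right_inv hy] at h2
    have h3 := mfderiv_comp_apply y (f := (extChartAt I p).symm) (g := f)
      (hf.mdifferentiableAt (by simp))
      ((extChartAt_symm_contMDiffAt hy).mdifferentiableAt (by simp)) (Vc y)
    rw [mfderiv_eq_fderiv] at h3
    refine Eq.trans ?_ h3.symm
    have h4 : (mfderiv 𝓘(ℝ, E) I (extChartAt I p).symm y (Vc y) : E) =
        V ((extChartAt I p).symm y) :=
      (congrArg (fun L : E →L[ℝ] E => L (Vc y)) h2.symm).trans h1
    exact congrArg (mfderiv I 𝓘(ℝ, ℝ) f ((extChartAt I p).symm y)) h4.symm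
  have h1 : (mfderiv I 𝓘(ℝ, ℝ) (fun x => (mfderiv I 𝓘(ℝ, ℝ) f x (V x) : ℝ)) p : E →L[ℝ] ℝ) =
      fderiv ℝ (fun y => fderiv ℝ fc y (Vc y)) (extChartAt I p p) := by
    rw [← hg.fderiv_eq, ((contMDiff_mfderiv_apply hf hV).mdifferentiableAt (by simp)).mfderiv,
      I.range_eq_univ, fderivWithin_univ]
    rfl
  rw [hv]
  exact (congrArg (fun L : E →L[ℝ] ℝ => L v) h1).trans
    (fderiv_fderiv_apply_of_line hfc (hVc.differentiableAt (by simp)) hVp hcrit hN)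

/-- A principal connection `σ₁` can be corrected so that it annihilates an invariant vector field
`X` wherever `X` is not tangent to the orbits, once an invariant one-form `α` is known which
annihilates the generators and detects the points where `X` is tangent to the orbits. -/
theorem IsPrincipalConnectionOn.exists_correction {a : K → M → M}
    {σ₁ : ∀ x : M, TangentSpace I x →L[ℝ] EK} (hσ : IsPrincipalConnectionOn I a univ σ₁)
    {X : ∀ x : M, TangentSpace I x} (hX : ∀ k x, X (a k x) = mfderiv I I (a k) x (X x))
    (hXs : ContMDiff I I.tangent ∞ (fun x => (⟨x, X x⟩ : TangentBundle I M)))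
    {α : ∀ x : M, TangentSpace I x →L[ℝ] ℝ} (hα : SmoothForm α)
    (hαinv : ∀ k x v, α (a k x) (mfderiv I I (a k) x v) = α x v)
    (hαζ : ∀ x (Z : EK), α x (fundamental I a x Z) = 0)
    (hαX : ∀ x, α x (X x) = 0 → ∃ Y : EK, X x = fundamental I a x Y) :
    IsOpen {x | ∃ Y : EK, X x = fundamental I a x Y}ᶜ ∧
      ∃ σ : ∀ x : M, TangentSpace I x →L[ℝ] EK,
        IsPrincipalConnectionOn I a {x | ∃ Y : EK, X x = fundamental I a x Y}ᶜ σ ∧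
        ∀ x ∈ {x | ∃ Y : EK, X x = fundamental I a x Y}ᶜ, σ x (X x) = 0 := by
  have hiff : ∀ x, α x (X x) = 0 ↔ ∃ Y : EK, X x = fundamental I a x Y := fun x =>
    ⟨hαX x, fun ⟨Y, hY⟩ => by rw [hY, hαζ]⟩
  have hset : {x | ∃ Y : EK, X x = fundamental I a x Y} = {x | α x (X x) = 0} := by
    ext x; exact (hiff x).symm
  rw [hset]
  have hαXs : ContMDiff I 𝓘(ℝ, ℝ) ∞ (fun x => α x (X x)) := fun x => hα.apply (hXs x)
  have hσs : SmoothForm σ₁ := by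
    have := hσ.smooth
    rwa [show {v : TangentBundle I M | v.proj ∈ (univ : Set M)} = univ from by ext; simp,
      contMDiffOn_univ] at this
  refine ⟨(isClosed_eq hαXs.continuous continuous_const).isOpen_compl,
    fun x => σ₁ x - (α x (X x))⁻¹ • (α x).smulRight (σ₁ x (X x)), ⟨?_, ?_, ?_⟩, ?_⟩
  · intro v hv
    have hv' : α v.proj (X v.proj) ≠ 0 := hv
    have hproj : ContMDiffAt I.tangent I ∞ (fun v : TangentBundle I M => v.proj) v :=
      contMDiff_proj _ v
    have h1 : ContMDiffAt I.tangent 𝓘(ℝ, ℝ) ∞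
      (fun v : TangentBundle I M => (α v.proj (X v.proj))⁻¹) v :=
      (contDiffAt_inv ℝ hv').contMDiffAt.comp v ((hαXs _).comp v hproj)
    have h2 : ContMDiffAt I.tangent 𝓘(ℝ, EK) ∞
      (fun v : TangentBundle I M => σ₁ v.proj (X v.proj)) v :=
      ((fun x => hσs.apply (hXs x) : ContMDiff I 𝓘(ℝ, EK) ∞ (fun x => σ₁ x (X x))) _).comp v hproj
    exact ((hσs v).sub (h1.smul ((hα v).smul h2))).contMDiffWithinAt
  · intro x _ Z
    simp [hαζ, hσ.fundamental_eq x (mem_univ x) Z]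
  · intro k x _ v
    have h1 := hσ.equivariant k x (mem_univ x)
    have h2 : α (a k x) (X (a k x)) = α x (X x) := by rw [hX, hαinv]
    have h3 : σ₁ (a k x) (X (a k x)) = adjoint k (σ₁ x (X x)) := by rw [hX, h1]
    change σ₁ (a k x) (mfderiv I I (a k) x v) - (α (a k x) (X (a k x)))⁻¹ •
      (α (a k x) (mfderiv I I (a k) x v) • σ₁ (a k x) (X (a k x))) =
      adjoint k (σ₁ x v - (α x (X x))⁻¹ • (α x v • σ₁ x (X x)))
    rw [h2, h3, h1, hαinv, map_sub, map_smul, map_smul]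
  · intro x hx
    have hx' : α x (X x) ≠ 0 := hx
    change σ₁ x (X x) - (α x (X x))⁻¹ • (α x (X x) • σ₁ x (X x)) = 0
    rw [smul_smul, inv_mul_cancel₀ hx', one_smul, sub_self]

end Differentials

/-! ### The mechanical connection of an invariant metric -/

section MechanicalConnection

variable {ES : Type*} [NormedAddCommGroup ES] [NormedSpace ℝ ES]
  {S : Type*} [TopologicalSpace S] [ChartedSpace ES S]
  {EK K : Type*} [NormedAddCommGroup EK] [NormedSpace ℝ EK]
  [TopologicalSpace K] [ChartedSpace EK K] [Group K] [MulAction K S]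

variable (EK K) in
/-- The generators `Z ↦ ζ_Z(s)` of the action of `K` on `S`. -/
def baseGenerator (s : S) : EK →L[ℝ] TangentSpace 𝓘(ℝ, ES) s :=
  fundamental 𝓘(ℝ, ES) (fun (k : K) (s : S) => k • s) s

variable (K) in
/-- `b` is a Riemannian metric on `S` which is invariant under the action of `K`. -/
structure IsInvariantMetric [IsManifold 𝓘(ℝ, ES) ∞ S]
    (b : ∀ s : S, TangentSpace 𝓘(ℝ, ES) s →L[ℝ] TangentSpace 𝓘(ℝ, ES) s →L[ℝ] ℝ) : Prop where
  smooth : SmoothBilin b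
  symm : ∀ s u v, b s u v = b s v u
  pos : ∀ s u, u ≠ 0 → 0 < b s u u
  invariant : ∀ (k : K) (s : S) (u v : TangentSpace 𝓘(ℝ, ES) s),
    b (k • s) (mfderiv 𝓘(ℝ, ES) 𝓘(ℝ, ES) (fun s : S => k • s) s u)
      (mfderiv 𝓘(ℝ, ES) 𝓘(ℝ, ES) (fun s : S => k • s) s v) = b s u v

variable (EK K) in
/-- The locked inertia tensor `(Y, Z) ↦ b(ζ_Y, ζ_Z)`. -/
def lockedInertia (b : ∀ s : S, TangentSpace 𝓘(ℝ, ES) s →L[ℝ] TangentSpace 𝓘(ℝ, ES) s →L[ℝ] ℝ)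
    (s : S) : EK →L[ℝ] EK →L[ℝ] ℝ :=
  pullbackBilin (b s) (baseGenerator EK K s)

variable (EK K) in
/-- The mechanical connection of the metric `b`: its horizontal spaces are the orthogonal
complements of the orbits. -/
def mechanicalConnection
    (b : ∀ s : S, TangentSpace 𝓘(ℝ, ES) s →L[ℝ] TangentSpace 𝓘(ℝ, ES) s →L[ℝ] ℝ)
    (s : S) : TangentSpace 𝓘(ℝ, ES) s →L[ℝ] EK :=
  (lockedInertia EK K b s).inverse.comp
    ((ContinuousLinearMap.precomp ℝ (baseGenerator EK K s)).comp (b s))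

theorem baseGenerator_injective [IsManifold 𝓘(ℝ, ES) ∞ S] [FiniteDimensional ℝ EK]
    [LieGroup 𝓘(ℝ, EK) ∞ K] [ContMDiffSMul 𝓘(ℝ, EK) 𝓘(ℝ, ES) ∞ K S]
    (hfree : ∀ (k : K) (s : S), k • s = s → k = 1) (s : S) :
    Function.Injective (baseGenerator (ES := ES) EK K s) :=
  (isSmoothAction_smul (EK := EK) (ES := ES) (K := K) (S := S)).fundamental_injective hfree s

namespace IsInvariantMetric

variable [IsManifold 𝓘(ℝ, ES) ∞ S] [FiniteDimensional ℝ ES] [FiniteDimensional ℝ EK]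
  {b : ∀ s : S, TangentSpace 𝓘(ℝ, ES) s →L[ℝ] TangentSpace 𝓘(ℝ, ES) s →L[ℝ] ℝ}
  (hb : IsInvariantMetric K b)
include hb

theorem eq_zero_of_apply_self {s : S} {u : TangentSpace 𝓘(ℝ, ES) s} (h : b s u u = 0) :
    u = 0 := by
  by_contra hu
  exact (hb.pos s u hu).ne' h

theorem nonneg (s : S) (u : TangentSpace 𝓘(ℝ, ES) s) : 0 ≤ b s u u := by
  by_cases hu : u = 0
  · rw [hu]; simp
  · exact (hb.pos s u hu).le

theorem isInvertible (s : S) : (b s).IsInvertible := by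
  have h : Function.Injective (b s) :=
    (injective_iff_map_eq_zero (b s)).2 fun u hu => hb.eq_zero_of_apply_self (by rw [hu]; rfl)
  exact isInvertible_of_injective (V := ES) (W := ES →L[ℝ] ℝ) h finrank_dual_eq

section Free

variable [LieGroup 𝓘(ℝ, EK) ∞ K] [ContMDiffSMul 𝓘(ℝ, EK) 𝓘(ℝ, ES) ∞ K S]
  (hfree : ∀ (k : K) (s : S), k • s = s → k = 1)

include hfree

theorem isInvertible_lockedInertia (s : S) : (lockedInertia EK K b s).IsInvertible := by
  refine isInvertible_of_injective ?_ finrank_dual_eq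
  rw [injective_iff_map_eq_zero]
  intro Z hZ
  have h1 : b s (baseGenerator EK K s Z) (baseGenerator EK K s Z) = 0 :=
    congrArg (fun L : EK →L[ℝ] ℝ => L Z) hZ
  exact baseGenerator_injective hfree s ((hb.eq_zero_of_apply_self h1).trans (map_zero _).symm)

theorem apply_mechanicalConnection (s : S) (v : TangentSpace 𝓘(ℝ, ES) s) (Z : EK) :
    b s (baseGenerator EK K s (mechanicalConnection EK K b s v)) (baseGenerator EK K s Z) =
      b s v (baseGenerator EK K s Z) :=
  congrArg (fun L : EK →L[ℝ] ℝ => L Z)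
    ((hb.isInvertible_lockedInertia hfree s).self_apply_inverse
      ((ContinuousLinearMap.precomp ℝ (baseGenerator EK K s)).comp (b s) v))

theorem mechanicalConnection_unique {s : S} {v : TangentSpace 𝓘(ℝ, ES) s} {Y : EK}
    (h : ∀ Z, b s (baseGenerator EK K s Y) (baseGenerator EK K s Z) =
      b s v (baseGenerator EK K s Z)) : mechanicalConnection EK K b s v = Y := by
  refine (hb.isInvertible_lockedInertia hfree s).injective ?_
  ext Z
  exact (hb.apply_mechanicalConnection hfree s v Z).trans (h Z).symm

theorem mechanicalConnection_generator (s : S) (Z : EK) :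
    mechanicalConnection EK K b s (baseGenerator EK K s Z) = Z :=
  hb.mechanicalConnection_unique hfree fun _ => rfl

theorem orthogonal_generator (s : S) (v : TangentSpace 𝓘(ℝ, ES) s) (Z : EK) :
    b s (v - baseGenerator EK K s (mechanicalConnection EK K b s v)) (baseGenerator EK K s Z) =
      0 := by
  rw [map_sub, sub_apply, hb.apply_mechanicalConnection hfree, sub_self]

theorem mechanicalConnection_equivariant (k : K) (s : S) (v : TangentSpace 𝓘(ℝ, ES) s) :
    mechanicalConnection EK K b (k • s) (mfderiv 𝓘(ℝ, ES) 𝓘(ℝ, ES) (fun s : S => k • s) s v) =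
      adjoint k (mechanicalConnection EK K b s v) := by
  have hS := isSmoothAction_smul (EK := EK) (ES := ES) (K := K) (S := S)
  have hζ : ∀ Z : EK, baseGenerator EK K (k • s) (adjoint k Z) =
      mfderiv 𝓘(ℝ, ES) 𝓘(ℝ, ES) (fun s : S => k • s) s (baseGenerator EK K s Z) := fun Z =>
    (hS.mfderiv_fundamental k s Z).symm
  have hinj : Function.Injective (adjoint k : EK →L[ℝ] EK) := by
    intro Z Z' h
    have h1 := (hζ Z).symm.trans ((congrArg (baseGenerator EK K (k • s)) h).trans (hζ Z'))
    exact baseGenerator_injective hfree s (hS.mfderiv_injective k s h1)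
  have hsurj : Function.Surjective (adjoint k : EK →L[ℝ] EK) :=
    (LinearMap.injective_iff_surjective (f := (adjoint k : EK →L[ℝ] EK).toLinearMap)).1 hinj
  refine hb.mechanicalConnection_unique hfree fun Z => ?_
  obtain ⟨Z, rfl⟩ := hsurj Z
  rw [hζ, hζ, hb.invariant, hb.invariant, hb.apply_mechanicalConnection hfree]

theorem smoothForm_mechanicalConnection :
    SmoothForm (mechanicalConnection (ES := ES) (S := S) EK K b) := by
  have hS := isSmoothAction_smul (EK := EK) (ES := ES) (K := K) (S := S)
  have hζ : ∀ (s : S) (Z : EK), ContMDiffAt 𝓘(ℝ, ES) 𝓘(ℝ, ES).tangent ∞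
      (fun s => (⟨s, baseGenerator EK K s Z⟩ : TangentBundle 𝓘(ℝ, ES) S)) s := fun s Z =>
    hS.contMDiffAt_fundamental (g := fun s : S => s) contMDiffAt_id contMDiffAt_const
  have : CompleteSpace EK := FiniteDimensional.complete ℝ EK
  refine SmoothForm.of_apply fun s₀ e => ?_
  have h1 : ContMDiffAt 𝓘(ℝ, ES) 𝓘(ℝ, EK →L[ℝ] EK →L[ℝ] ℝ) ∞ (lockedInertia EK K b) s₀ :=
    contMDiffAt_clm_of_apply fun Z => contMDiffAt_clm_of_apply fun Z' =>
      hb.smooth.apply (hζ s₀ Z) (hζ s₀ Z')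
  have h2 : ContMDiffAt 𝓘(ℝ, ES) 𝓘(ℝ, (EK →L[ℝ] ℝ) →L[ℝ] EK) ∞
      (fun s => (lockedInertia EK K b s).inverse) s₀ :=
    ((hb.isInvertible_lockedInertia hfree s₀).contDiffAt_map_inverse (n := ∞)).contMDiffAt.comp
      s₀ h1
  have h3 : ContMDiffAt 𝓘(ℝ, ES) 𝓘(ℝ, EK →L[ℝ] ℝ) ∞ (fun s : S =>
      ((b s (frame 𝓘(ℝ, ES) s₀ s e)).comp (baseGenerator EK K s) : EK →L[ℝ] ℝ)) s₀ :=
    contMDiffAt_clm_of_apply fun Z => hb.smooth.apply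
      (contMDiffAt_frame (g := fun s : S => s) contMDiffAt_id contMDiffAt_const) (hζ s₀ Z)
  exact h2.clm_apply h3

end Free

end IsInvariantMetric

end MechanicalConnection

/-! ### Invariant second order vector fields on the cotangent bundle -/

section SecondOrder

variable {ES : Type*} [NormedAddCommGroup ES] [NormedSpace ℝ ES] [FiniteDimensional ℝ ES]
  {S : Type*} [TopologicalSpace S] [ChartedSpace ES S] [IsManifold 𝓘(ℝ, ES) ∞ S]
  {EK K : Type*} [NormedAddCommGroup EK] [NormedSpace ℝ EK] [FiniteDimensional ℝ EK]
  [TopologicalSpace K] [ChartedSpace EK K] [Group K] [LieGroup 𝓘(ℝ, EK) ∞ K]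
  [MulAction K S] [ContMDiffSMul 𝓘(ℝ, EK) 𝓘(ℝ, ES) ∞ K S]
  {b : ∀ s : S, TangentSpace 𝓘(ℝ, ES) s →L[ℝ] TangentSpace 𝓘(ℝ, ES) s →L[ℝ] ℝ}

/-- The differential of a vector-valued function on `T*S`, as a one-form. -/
def differential {F : Type*} [NormedAddCommGroup F] [NormedSpace ℝ F] (f : CotangentBundle ES S → F)
    (p : CotangentBundle ES S) : TangentSpace (cotangentModel ES) p →L[ℝ] F :=
  mfderiv (cotangentModel ES) 𝓘(ℝ, F) f p

variable (EK K) in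
/-- The generators `Z ↦ ζ_Z(p)` of the cotangent lifted action. -/
def liftedGenerator (p : CotangentBundle ES S) : EK →L[ℝ] TangentSpace (cotangentModel ES) p :=
  fundamental (cotangentModel ES) (cotangentLift (K := K)) p

variable (EK K) in
/-- The pull-back of the mechanical connection to `T*S`. -/
def liftedConnection
    (b : ∀ s : S, TangentSpace 𝓘(ℝ, ES) s →L[ℝ] TangentSpace 𝓘(ℝ, ES) s →L[ℝ] ℝ)
    (p : CotangentBundle ES S) : TangentSpace (cotangentModel ES) p →L[ℝ] EK :=
  (mechanicalConnection EK K b p.proj).comp (footDeriv p)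

theorem footDeriv_liftedGenerator (p : CotangentBundle ES S) (Z : EK) :
    footDeriv p (liftedGenerator EK K p Z) = baseGenerator EK K p.proj Z :=
  footDeriv_fundamental p Z

theorem contMDiffAt_footDeriv {EN HN N : Type*} [NormedAddCommGroup EN] [NormedSpace ℝ EN]
    [TopologicalSpace HN] {J : ModelWithCorners ℝ EN HN} [TopologicalSpace N] [ChartedSpace HN N]
    {g : N → CotangentBundle ES S} {v : ∀ n, TangentSpace (cotangentModel ES) (g n)} {n₀ : N}
    (hv : ContMDiffAt J (cotangentModel ES).tangent ∞ (fun n =>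
      (⟨g n, v n⟩ : TangentBundle (cotangentModel ES) (CotangentBundle ES S))) n₀) :
    ContMDiffAt J 𝓘(ℝ, ES).tangent ∞
      (fun n => (⟨(g n).proj, footDeriv (g n) (v n)⟩ : TangentBundle 𝓘(ℝ, ES) S)) n₀ :=
  contMDiffAt_mfderiv_vec contMDiff_cotangent_proj hv

theorem IsInvariantMetric.isPrincipalConnectionOn_liftedConnection (hb : IsInvariantMetric K b)
    (hfree : ∀ (k : K) (s : S), k • s = s → k = 1) :
    IsPrincipalConnectionOn (cotangentModel ES) (cotangentLift (ES := ES) (S := S) (K := K)) univ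
      (liftedConnection EK K b) where
  smooth := by
    refine ContMDiff.contMDiffOn fun v => ?_
    have hid : ContMDiffAt (cotangentModel ES).tangent (cotangentModel ES).tangent ∞
      (fun w : TangentBundle (cotangentModel ES) (CotangentBundle ES S) =>
        (⟨w.proj, w.2⟩ : TangentBundle (cotangentModel ES) (CotangentBundle ES S))) v :=
      contMDiffAt_id
    exact (hb.smoothForm_mechanicalConnection hfree).apply (contMDiffAt_footDeriv hid)
  fundamental_eq p _ Z := by
    refine (congrArg (mechanicalConnection EK K b p.proj) (footDeriv_fundamental p Z)).trans ?_
    exact hb.mechanicalConnection_generator hfree p.proj Z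
  equivariant k p _ ξ := by
    refine (congrArg (mechanicalConnection EK K b (k • p.proj))
      (footDeriv_cotangentLift EK k p ξ)).trans ?_
    exact hb.mechanicalConnection_equivariant hfree k p.proj (footDeriv p ξ)

variable (EK K) in
/-- The orbital velocity `σ(X)`, where `σ` is the lifted mechanical connection. -/
def orbitalVelocity (b : ∀ s : S, TangentSpace 𝓘(ℝ, ES) s →L[ℝ] TangentSpace 𝓘(ℝ, ES) s →L[ℝ] ℝ)
    (X : ∀ p : CotangentBundle ES S, TangentSpace (cotangentModel ES) p)
    (p : CotangentBundle ES S) : EK :=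
  liftedConnection EK K b p (X p)

variable (EK K) in
/-- The component `X - ζ_{σ(X)}` of `X` which is horizontal for the lifted mechanical connection
`σ`. -/
def horizontalPart (b : ∀ s : S, TangentSpace 𝓘(ℝ, ES) s →L[ℝ] TangentSpace 𝓘(ℝ, ES) s →L[ℝ] ℝ)
    (X : ∀ p : CotangentBundle ES S, TangentSpace (cotangentModel ES) p)
    (p : CotangentBundle ES S) : TangentSpace (cotangentModel ES) p :=
  X p - liftedGenerator EK K p (orbitalVelocity EK K b X p)

variable (EK K) in
/-- The square of the norm of the foot velocity of the horizontal part of `X`. -/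
def horizontalSpeedSq
    (b : ∀ s : S, TangentSpace 𝓘(ℝ, ES) s →L[ℝ] TangentSpace 𝓘(ℝ, ES) s →L[ℝ] ℝ)
    (X : ∀ p : CotangentBundle ES S, TangentSpace (cotangentModel ES) p)
    (p : CotangentBundle ES S) : ℝ :=
  b p.proj (footDeriv p (horizontalPart EK K b X p)) (footDeriv p (horizontalPart EK K b X p))

variable (EK K) in
/-- The derivative of the function `horizontalSpeedSq` along the horizontal part of `X`. -/
def horizontalSpeedSqDeriv
    (b : ∀ s : S, TangentSpace 𝓘(ℝ, ES) s →L[ℝ] TangentSpace 𝓘(ℝ, ES) s →L[ℝ] ℝ)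
    (X : ∀ p : CotangentBundle ES S, TangentSpace (cotangentModel ES) p)
    (p : CotangentBundle ES S) : ℝ :=
  differential (horizontalSpeedSq EK K b X) p (horizontalPart EK K b X p)

variable (EK K) in
/-- The covariant derivative of the orbital velocity: its derivative on horizontal vectors. -/
def orbitalVelocityDeriv
    (b : ∀ s : S, TangentSpace 𝓘(ℝ, ES) s →L[ℝ] TangentSpace 𝓘(ℝ, ES) s →L[ℝ] ℝ)
    (X : ∀ p : CotangentBundle ES S, TangentSpace (cotangentModel ES) p)
    (p : CotangentBundle ES S) : TangentSpace (cotangentModel ES) p →L[ℝ] EK :=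
  (differential (orbitalVelocity EK K b X) p).comp
      (ContinuousLinearMap.id ℝ (TangentSpace (cotangentModel ES) p) -
        (liftedGenerator EK K p).comp (liftedConnection EK K b p))

variable (EK K) in
/-- A one-form on `T*S` which is invariant and annihilates the orbits if `X` is invariant, and whose
value on `X` is a sum of three squares. These vanish simultaneously only where `X` is tangent to the
orbits, if `X` is of second order. -/
def detectingForm
    (b : ∀ s : S, TangentSpace 𝓘(ℝ, ES) s →L[ℝ] TangentSpace 𝓘(ℝ, ES) s →L[ℝ] ℝ)
    (X : ∀ p : CotangentBundle ES S, TangentSpace (cotangentModel ES) p)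
    (p : CotangentBundle ES S) : TangentSpace (cotangentModel ES) p →L[ℝ] ℝ :=
  (b p.proj (footDeriv p (horizontalPart EK K b X p))).comp (footDeriv p) +
  (lockedInertia EK K b p.proj
    (orbitalVelocityDeriv EK K b X p (horizontalPart EK K b X p))).comp
      (orbitalVelocityDeriv EK K b X p) +
  differential (horizontalSpeedSqDeriv EK K b X) p (horizontalPart EK K b X p) •
    differential (horizontalSpeedSqDeriv EK K b X) p

namespace IsInvariantMetric

variable (hb : IsInvariantMetric K b) (hfree : ∀ (k : K) (s : S), k • s = s → k = 1)
  {X : ∀ p : CotangentBundle ES S, TangentSpace (cotangentModel ES) p}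
include hb hfree

theorem contMDiff_orbitalVelocity
    (hXs : ContMDiff (cotangentModel ES) (cotangentModel ES).tangent ∞ (fun p =>
      (⟨p, X p⟩ : TangentBundle (cotangentModel ES) (CotangentBundle ES S)))) :
    ContMDiff (cotangentModel ES) 𝓘(ℝ, EK) ∞ (orbitalVelocity EK K b X) := fun p =>
  (hb.smoothForm_mechanicalConnection hfree).apply (contMDiffAt_footDeriv (hXs p))

theorem contMDiff_horizontalPart
    (hXs : ContMDiff (cotangentModel ES) (cotangentModel ES).tangent ∞ (fun p =>
      (⟨p, X p⟩ : TangentBundle (cotangentModel ES) (CotangentBundle ES S)))) :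
    ContMDiff (cotangentModel ES) (cotangentModel ES).tangent ∞ (fun p =>
      (⟨p, horizontalPart EK K b X p⟩ :
        TangentBundle (cotangentModel ES) (CotangentBundle ES S))) := fun p =>
  contMDiffAt_vec_sub (hXs p)
    ((isSmoothAction_cotangentLift (EK := EK) (K := K)).contMDiffAt_fundamental
      (g := fun p : CotangentBundle ES S => p) contMDiffAt_id
      (hb.contMDiff_orbitalVelocity (EK := EK) hfree hXs p))

theorem contMDiff_horizontalSpeedSq
    (hXs : ContMDiff (cotangentModel ES) (cotangentModel ES).tangent ∞ (fun p =>
      (⟨p, X p⟩ : TangentBundle (cotangentModel ES) (CotangentBundle ES S)))) :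
    ContMDiff (cotangentModel ES) 𝓘(ℝ, ℝ) ∞ (horizontalSpeedSq EK K b X) := fun p =>
  have h := contMDiffAt_footDeriv (hb.contMDiff_horizontalPart (EK := EK) hfree hXs p)
  hb.smooth.apply h h

theorem contMDiff_horizontalSpeedSqDeriv
    (hXs : ContMDiff (cotangentModel ES) (cotangentModel ES).tangent ∞ (fun p =>
      (⟨p, X p⟩ : TangentBundle (cotangentModel ES) (CotangentBundle ES S)))) :
    ContMDiff (cotangentModel ES) 𝓘(ℝ, ℝ) ∞ (horizontalSpeedSqDeriv EK K b X) :=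
  contMDiff_mfderiv_apply (hb.contMDiff_horizontalSpeedSq hfree hXs)
    (hb.contMDiff_horizontalPart (EK := EK) hfree hXs)

theorem smoothForm_orbitalVelocityDeriv
    (hXs : ContMDiff (cotangentModel ES) (cotangentModel ES).tangent ∞ (fun p =>
      (⟨p, X p⟩ : TangentBundle (cotangentModel ES) (CotangentBundle ES S)))) :
    SmoothForm (orbitalVelocityDeriv (ES := ES) (S := S) EK K b X) := by
  intro v
  have hid : ContMDiffAt (cotangentModel ES).tangent (cotangentModel ES).tangent ∞
    (fun w : TangentBundle (cotangentModel ES) (CotangentBundle ES S) =>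
      (⟨w.proj, w.2⟩ : TangentBundle (cotangentModel ES) (CotangentBundle ES S))) v :=
    contMDiffAt_id
  have h1 : ContMDiffAt (cotangentModel ES).tangent 𝓘(ℝ, EK) ∞
    (fun w : TangentBundle (cotangentModel ES) (CotangentBundle ES S) =>
      liftedConnection EK K b w.proj w.2) v :=
    (hb.smoothForm_mechanicalConnection hfree).apply (contMDiffAt_footDeriv hid)
  have h2 := (isSmoothAction_cotangentLift (EK := EK) (K := K)).contMDiffAt_fundamental
      (contMDiffAt_foot hid) h1
  exact (smoothForm_mfderiv (hb.contMDiff_orbitalVelocity (EK := EK) hfree hXs)).apply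
    (contMDiffAt_vec_sub hid h2)

theorem smoothForm_detectingForm
    (hXs : ContMDiff (cotangentModel ES) (cotangentModel ES).tangent ∞ (fun p =>
      (⟨p, X p⟩ : TangentBundle (cotangentModel ES) (CotangentBundle ES S)))) :
    SmoothForm (detectingForm (ES := ES) (S := S) EK K b X) := by
  intro v
  have hid : ContMDiffAt (cotangentModel ES).tangent (cotangentModel ES).tangent ∞
    (fun w : TangentBundle (cotangentModel ES) (CotangentBundle ES S) =>
      (⟨w.proj, w.2⟩ : TangentBundle (cotangentModel ES) (CotangentBundle ES S))) v :=
    contMDiffAt_id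
  have hp := contMDiffAt_foot hid
  have hV : ContMDiffAt (cotangentModel ES).tangent (cotangentModel ES).tangent ∞
    (fun w : TangentBundle (cotangentModel ES) (CotangentBundle ES S) =>
      (⟨w.proj, horizontalPart EK K b X w.proj⟩ :
        TangentBundle (cotangentModel ES) (CotangentBundle ES S))) v :=
    (hb.contMDiff_horizontalPart (EK := EK) hfree hXs v.proj).comp v hp
  have hΨ := hb.smoothForm_orbitalVelocityDeriv (EK := EK) hfree hXs
  have hS := isSmoothAction_smul (EK := EK) (ES := ES) (K := K) (S := S)
  have hpp := contMDiffAt_foot (contMDiffAt_footDeriv hid)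
  have h1 := hb.smooth.apply (contMDiffAt_footDeriv hV) (contMDiffAt_footDeriv hid)
  have h2 := hb.smooth.apply (hS.contMDiffAt_fundamental hpp (hΨ.apply hV))
    (hS.contMDiffAt_fundamental hpp (hΨ.apply hid))
  have hg := smoothForm_mfderiv (hb.contMDiff_horizontalSpeedSqDeriv (EK := EK) hfree hXs)
  exact (h1.add h2).add ((hg.apply hV).smul (hg.apply hid))

section Equivariance

variable (hX : ∀ (k : K) p, X (cotangentLift k p) =
  mfderiv (cotangentModel ES) (cotangentModel ES) (cotangentLift k) p (X p))
include hX

theorem orbitalVelocity_equivariant (k : K) (p : CotangentBundle ES S) :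
    orbitalVelocity EK K b X (cotangentLift k p) = adjoint k (orbitalVelocity EK K b X p) := by
  have h := (hb.isPrincipalConnectionOn_liftedConnection (EK := EK) hfree).equivariant k p
    (mem_univ p) (X p)
  rw [← hX] at h
  exact h

theorem horizontalPart_equivariant (k : K) (p : CotangentBundle ES S) :
    horizontalPart EK K b X (cotangentLift k p) =
      mfderiv (cotangentModel ES) (cotangentModel ES) (cotangentLift k) p
        (horizontalPart EK K b X p) := by
  have hT := isSmoothAction_cotangentLift (EK := EK) (ES := ES) (K := K) (S := S)
  have h := hT.mfderiv_fundamental k p (orbitalVelocity EK K b X p)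
  rw [← hb.orbitalVelocity_equivariant (EK := EK) hfree hX] at h
  rw [horizontalPart, horizontalPart, ContinuousLinearMap.map_sub, hX]
  exact congrArg _ h.symm

theorem horizontalSpeedSq_invariant (k : K) (p : CotangentBundle ES S) :
    horizontalSpeedSq EK K b X (cotangentLift k p) = horizontalSpeedSq EK K b X p := by
  have h := footDeriv_cotangentLift EK k p (horizontalPart EK K b X p)
  rw [← hb.horizontalPart_equivariant (EK := EK) hfree hX] at h
  rw [horizontalSpeedSq, h]
  exact hb.invariant k p.proj _ _

theorem horizontalSpeedSqDeriv_invariant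
    (hXs : ContMDiff (cotangentModel ES) (cotangentModel ES).tangent ∞ (fun p =>
      (⟨p, X p⟩ : TangentBundle (cotangentModel ES) (CotangentBundle ES S))))
    (k : K) (p : CotangentBundle ES S) :
    horizontalSpeedSqDeriv EK K b X (cotangentLift k p) = horizontalSpeedSqDeriv EK K b X p := by
  have hT := isSmoothAction_cotangentLift (EK := EK) (ES := ES) (K := K) (S := S)
  rw [horizontalSpeedSqDeriv, hb.horizontalPart_equivariant (EK := EK) hfree hX]
  exact hT.mfderiv_equivariant (L := ContinuousLinearMap.id ℝ ℝ)
    (hb.contMDiff_horizontalSpeedSq hfree hXs)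
    (hb.horizontalSpeedSq_invariant (EK := EK) hfree hX k) p _

theorem orbitalVelocityDeriv_equivariant
    (hXs : ContMDiff (cotangentModel ES) (cotangentModel ES).tangent ∞ (fun p =>
      (⟨p, X p⟩ : TangentBundle (cotangentModel ES) (CotangentBundle ES S))))
    (k : K) (p : CotangentBundle ES S) (ξ : TangentSpace (cotangentModel ES) p) :
    orbitalVelocityDeriv EK K b X (cotangentLift k p)
        (mfderiv (cotangentModel ES) (cotangentModel ES) (cotangentLift k) p ξ) =
      adjoint k (orbitalVelocityDeriv EK K b X p ξ) := by
  have hT := isSmoothAction_cotangentLift (EK := EK) (ES := ES) (K := K) (S := S)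
  have h1 := (hb.isPrincipalConnectionOn_liftedConnection (EK := EK) hfree).equivariant k p
    (mem_univ p) ξ
  have h2 := hT.mfderiv_fundamental k p (liftedConnection EK K b p ξ)
  have h3 := hT.mfderiv_equivariant (L := adjoint k)
    (hb.contMDiff_orbitalVelocity (EK := EK) hfree hXs)
    (hb.orbitalVelocity_equivariant (EK := EK) hfree hX k) p
    (ξ - liftedGenerator EK K p (liftedConnection EK K b p ξ))
  refine Eq.trans ?_ h3
  rw [ContinuousLinearMap.map_sub]
  refine congrArg (differential (orbitalVelocity EK K b X) (cotangentLift k p)) ?_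
  refine congrArg (fun η => mfderiv (cotangentModel ES) (cotangentModel ES) (cotangentLift k) p ξ -
    η) ?_
  exact (congrArg (liftedGenerator EK K (cotangentLift k p)) h1).trans h2.symm

theorem detectingForm_invariant
    (hXs : ContMDiff (cotangentModel ES) (cotangentModel ES).tangent ∞ (fun p =>
      (⟨p, X p⟩ : TangentBundle (cotangentModel ES) (CotangentBundle ES S))))
    (k : K) (p : CotangentBundle ES S) (ξ : TangentSpace (cotangentModel ES) p) :
    detectingForm EK K b X (cotangentLift k p)
        (mfderiv (cotangentModel ES) (cotangentModel ES) (cotangentLift k) p ξ) =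
      detectingForm EK K b X p ξ := by
  have hT := isSmoothAction_cotangentLift (EK := EK) (ES := ES) (K := K) (S := S)
  have hS := isSmoothAction_smul (EK := EK) (ES := ES) (K := K) (S := S)
  have hV := hb.horizontalPart_equivariant (EK := EK) hfree hX k p
  have hf := footDeriv_cotangentLift EK k p
  have h1 := hb.invariant k p.proj (footDeriv p (horizontalPart EK K b X p)) (footDeriv p ξ)
  rw [← hf, ← hf, ← hV] at h1
  have hΨ := hb.orbitalVelocityDeriv_equivariant (EK := EK) hfree hX hXs k p
  have h2 := hb.invariant k p.proj
    (baseGenerator EK K p.proj (orbitalVelocityDeriv EK K b X p (horizontalPart EK K b X p)))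
    (baseGenerator EK K p.proj (orbitalVelocityDeriv EK K b X p ξ))
  have hζ : ∀ Z : EK, mfderiv 𝓘(ℝ, ES) 𝓘(ℝ, ES) (fun s : S => k • s) p.proj
    (baseGenerator EK K p.proj Z) = baseGenerator EK K (k • p.proj) (adjoint k Z) :=
    fun Z => hS.mfderiv_fundamental k p.proj Z
  rw [hζ, hζ, ← hΨ, ← hΨ, ← hV] at h2
  have h3 : ∀ η, differential (horizontalSpeedSqDeriv EK K b X) (cotangentLift k p)
      (mfderiv (cotangentModel ES) (cotangentModel ES) (cotangentLift k) p η) =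
      differential (horizontalSpeedSqDeriv EK K b X) p η := fun η =>
    hT.mfderiv_equivariant (L := ContinuousLinearMap.id ℝ ℝ)
      (hb.contMDiff_horizontalSpeedSqDeriv (EK := EK) hfree hXs)
      (hb.horizontalSpeedSqDeriv_invariant hfree hX hXs k) p η
  have h4 := h3 (horizontalPart EK K b X p)
  rw [← hV] at h4
  exact congrArg₂ (· + ·) (congrArg₂ (· + ·) h1 h2) (congrArg₂ (· * ·) h4 (h3 ξ))

theorem detectingForm_generator
    (hXs : ContMDiff (cotangentModel ES) (cotangentModel ES).tangent ∞ (fun p =>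
      (⟨p, X p⟩ : TangentBundle (cotangentModel ES) (CotangentBundle ES S))))
    (p : CotangentBundle ES S) (Z : EK) :
    detectingForm EK K b X p (liftedGenerator EK K p Z) = 0 := by
  have hT := isSmoothAction_cotangentLift (EK := EK) (ES := ES) (K := K) (S := S)
  have h0 := (hb.isPrincipalConnectionOn_liftedConnection (EK := EK) hfree).fundamental_eq p
    (mem_univ p) Z
  have h1 : b p.proj (footDeriv p (horizontalPart EK K b X p))
      (footDeriv p (liftedGenerator EK K p Z)) = 0 := by
    rw [horizontalPart, ContinuousLinearMap.map_sub, footDeriv_liftedGenerator,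
      footDeriv_liftedGenerator]
    exact hb.orthogonal_generator hfree p.proj (footDeriv p (X p)) Z
  have h2 : orbitalVelocityDeriv EK K b X p (liftedGenerator EK K p Z) = 0 := by
    change differential (orbitalVelocity EK K b X) p
      (liftedGenerator EK K p Z - liftedGenerator EK K p
        (liftedConnection EK K b p (liftedGenerator EK K p Z))) = 0
    rw [show liftedConnection EK K b p (liftedGenerator EK K p Z) = Z from h0, sub_self,
      ContinuousLinearMap.map_zero]
  have h3 : differential (horizontalSpeedSqDeriv EK K b X) p (liftedGenerator EK K p Z) = 0 :=
    hT.mfderiv_fundamental_of_invariant (hb.horizontalSpeedSqDeriv_invariant hfree hX hXs)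
      ((hb.contMDiff_horizontalSpeedSqDeriv (EK := EK) hfree hXs).mdifferentiableAt (by simp)) Z
  have h2' : lockedInertia EK K b p.proj
      (orbitalVelocityDeriv EK K b X p (horizontalPart EK K b X p))
      (orbitalVelocityDeriv EK K b X p (liftedGenerator EK K p Z)) = 0 := by
    rw [h2, ContinuousLinearMap.map_zero]
  have h3' : differential (horizontalSpeedSqDeriv EK K b X) p (horizontalPart EK K b X p) *
      differential (horizontalSpeedSqDeriv EK K b X) p (liftedGenerator EK K p Z) = 0 := by
    rw [h3, mul_zero]
  refine (congrArg₂ (· + ·) (congrArg₂ (· + ·) h1 h2') h3').trans ?_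
  simp

/-- At a zero of the detecting form evaluated on `X`, the horizontal part `V` of `X` is the
vertical lift of a covector `β`. Let `w` be the vector dual to `β`. Along the line `p + t β` the
foot velocity of `X` is affine with slope `w`, so the orbital velocity has slope `σ(w)`, which vanishes
by the second square, and the horizontal speed squared is `t² b(w, w)`. Its second derivative along
`V` is `2 b(w, w)`, which vanishes by the third square. -/
theorem exists_generator_of_detectingForm
    (hXs : ContMDiff (cotangentModel ES) (cotangentModel ES).tangent ∞ (fun p =>
      (⟨p, X p⟩ : TangentBundle (cotangentModel ES) (CotangentBundle ES S))))
    (hX2 : ∀ p : CotangentBundle ES S, b p.proj (footDeriv p (X p)) = p.2)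
    (p : CotangentBundle ES S) (h : detectingForm EK K b X p (X p) = 0) :
    ∃ Y : EK, X p = liftedGenerator EK K p Y := by
  refine ⟨orbitalVelocity EK K b X p, sub_eq_zero.1 ?_⟩
  change horizontalPart EK K b X p = 0
  set V := horizontalPart EK K b X p with hVdef
  -- the value of the detecting form on `X` is its value on `V`, a sum of three squares
  have hXV : X p = V + liftedGenerator EK K p (orbitalVelocity EK K b X p) :=
    (sub_add_cancel _ _).symm
  rw [hXV, ContinuousLinearMap.map_add, hb.detectingForm_generator hfree hX hXs, add_zero] at h
  set Y := orbitalVelocityDeriv EK K b X p V with hY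
  set r := differential (horizontalSpeedSqDeriv EK K b X) p V with hr
  have h' : b p.proj (footDeriv p V) (footDeriv p V) +
    b p.proj (baseGenerator EK K p.proj Y) (baseGenerator EK K p.proj Y) + r * r = 0 := h
  have n1 := hb.nonneg p.proj (footDeriv p V)
  have n2 := hb.nonneg p.proj (baseGenerator EK K p.proj Y)
  have n3 := mul_self_nonneg r
  have hu : footDeriv p V = 0 := hb.eq_zero_of_apply_self (by linarith)
  have hY0 : Y = 0 := baseGenerator_injective hfree p.proj
    ((hb.eq_zero_of_apply_self (by linarith)).trans (map_zero _).symm)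
  have hr0 : r = 0 := mul_self_eq_zero.1 (by linarith)
  -- `V` is the vertical lift of a covector `β`, which is tested along a line in the fibre
  set β : ES →L[ℝ] ℝ := (V : ES × (ES →L[ℝ] ℝ)).2 with hβ
  have hVβ : (V : ES × (ES →L[ℝ] ℝ)) = (0, β) := Prod.ext ((footDeriv_apply p V).symm.trans hu) rfl
  set w : TangentSpace 𝓘(ℝ, ES) p.proj := (b p.proj).inverse β with hw
  have hbw : b p.proj w = β := (hb.isInvertible p.proj).self_apply_inverse _
  set v₀ : TangentSpace 𝓘(ℝ, ES) p.proj := footDeriv p (X p) with hv₀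
  have hfoot : ∀ t : ℝ, (footDeriv (fibreLine p β t) (X (fibreLine p β t)) :
      TangentSpace 𝓘(ℝ, ES) p.proj) = v₀ + t • w := by
    intro t
    refine (hb.isInvertible p.proj).injective ?_
    rw [ContinuousLinearMap.map_add, ContinuousLinearMap.map_smul, hbw, hX2 p]
    exact hX2 (fibreLine p β t)
  have ha : ∀ t : ℝ, orbitalVelocity EK K b X (fibreLine p β t) =
      mechanicalConnection EK K b p.proj v₀ + t • mechanicalConnection EK K b p.proj w := by
    intro t
    rw [← ContinuousLinearMap.map_smul, ← ContinuousLinearMap.map_add]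
    exact congrArg (mechanicalConnection EK K b p.proj) (hfoot t)
  have hAw : mechanicalConnection EK K b p.proj w = 0 := by
    have h1 := mfderiv_comp_fibreLine p β
      ((hb.contMDiff_orbitalVelocity (EK := EK) hfree hXs).mdifferentiableAt (x := p) (by simp))
    rw [← hVβ, funext ha] at h1
    have h2 : HasDerivAt (fun t : ℝ => mechanicalConnection EK K b p.proj v₀ +
        t • mechanicalConnection EK K b p.proj w) (mechanicalConnection EK K b p.proj w) 0 := by
      simpa using ((hasDerivAt_id (0 : ℝ)).smul_const
        (mechanicalConnection EK K b p.proj w)).const_add (mechanicalConnection EK K b p.proj v₀)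
    have h3 : Y = differential (orbitalVelocity EK K b X) p V := by
      change differential (orbitalVelocity EK K b X) p
        (V - liftedGenerator EK K p (mechanicalConnection EK K b p.proj (footDeriv p V))) = _
      rw [hu, ContinuousLinearMap.map_zero, ContinuousLinearMap.map_zero, sub_zero]
    exact (h2.unique h1).trans (h3.symm.trans hY0)
  have hu' : v₀ - baseGenerator EK K p.proj (mechanicalConnection EK K b p.proj v₀) = 0 := by
    rw [← hu, hVdef, horizontalPart, ContinuousLinearMap.map_sub, footDeriv_liftedGenerator]
    rfl
  have hf : ∀ t : ℝ, horizontalSpeedSq EK K b X (fibreLine p β t) = t ^ 2 * b p.proj w w := by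
    intro t
    have h1 : (footDeriv (fibreLine p β t) (horizontalPart EK K b X (fibreLine p β t)) :
        TangentSpace 𝓘(ℝ, ES) p.proj) = t • w := by
      rw [horizontalPart, ContinuousLinearMap.map_sub, footDeriv_liftedGenerator, ha, hAw,
        smul_zero, add_zero]
      refine (congrArg (fun z : TangentSpace 𝓘(ℝ, ES) p.proj => z -
        baseGenerator EK K p.proj (mechanicalConnection EK K b p.proj v₀)) (hfoot t)).trans ?_
      change v₀ + t • w - baseGenerator EK K p.proj (mechanicalConnection EK K b p.proj v₀) = t • w
      rw [add_sub_right_comm, hu', zero_add]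
    refine (congrArg₂ (fun x y : TangentSpace 𝓘(ℝ, ES) p.proj => b p.proj x y) h1 h1).trans ?_
    simp only [ContinuousLinearMap.map_smul, smul_apply, smul_eq_mul]
    ring
  have hw0 : w = 0 := by
    have h1 := mfderiv_mfderiv_of_isMin (hb.contMDiff_horizontalSpeedSq (EK := EK) hfree hXs)
      (hb.contMDiff_horizontalPart (EK := EK) hfree hXs) (p := p) (N := b p.proj w w)
      (v := ((0, β) : ES × (ES →L[ℝ] ℝ)))
      (fun q => by
        have h2 : horizontalSpeedSq EK K b X p = 0 := by
          rw [horizontalSpeedSq, ← hVdef, hu, ContinuousLinearMap.map_zero]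
        rw [h2]
        exact hb.nonneg q.proj _) hVβ
      (fun t => by rw [(extChartAt_fibreLine p β t).2, hf])
    have h2 : r = 2 * b p.proj w w := h1
    exact hb.eq_zero_of_apply_self (by linarith)
  have hβ0 : β = 0 := by
    rw [← hbw, hw0, ContinuousLinearMap.map_zero]
    rfl
  rw [hβ0] at hVβ
  exact hVβ

end Equivariance

end IsInvariantMetric

end SecondOrder

section SecondOrder

variable {ES : Type*} [NormedAddCommGroup ES] [NormedSpace ℝ ES] [FiniteDimensional ℝ ES]
  {S : Type*} [TopologicalSpace S] [ChartedSpace ES S] [IsManifold 𝓘(ℝ, ES) ∞ S]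
  {EK K : Type*} [NormedAddCommGroup EK] [NormedSpace ℝ EK] [FiniteDimensional ℝ EK]
  [TopologicalSpace K] [ChartedSpace EK K] [Group K] [LieGroup 𝓘(ℝ, EK) ∞ K]
  [MulAction K S] [ContMDiffSMul 𝓘(ℝ, EK) 𝓘(ℝ, ES) ∞ K S]
  {b : ∀ s : S, TangentSpace 𝓘(ℝ, ES) s →L[ℝ] TangentSpace 𝓘(ℝ, ES) s →L[ℝ] ℝ}

/-- For an invariant second order vector field `X` on `T*S`, the points where `X` is not tangent to
the orbits form an open set, which carries a principal connection that annihilates `X`. -/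
theorem IsInvariantMetric.exists_connection (hb : IsInvariantMetric K b)
    (hfree : ∀ (k : K) (s : S), k • s = s → k = 1)
    {X : ∀ p : CotangentBundle ES S, TangentSpace (cotangentModel ES) p}
    (hX : ∀ (k : K) p, X (cotangentLift k p) =
      mfderiv (cotangentModel ES) (cotangentModel ES) (cotangentLift k) p (X p))
    (hXs : ContMDiff (cotangentModel ES) (cotangentModel ES).tangent ∞ (fun p =>
      (⟨p, X p⟩ : TangentBundle (cotangentModel ES) (CotangentBundle ES S))))
    (hX2 : ∀ p : CotangentBundle ES S, b p.proj (footDeriv p (X p)) = p.2) :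
    IsOpen {p | ∃ Y : EK, X p = fundamental (cotangentModel ES) (cotangentLift (K := K)) p Y}ᶜ ∧
      ∃ σ : ∀ p : CotangentBundle ES S, TangentSpace (cotangentModel ES) p →L[ℝ] EK,
        IsPrincipalConnectionOn (cotangentModel ES) (cotangentLift (K := K))
          {p | ∃ Y : EK, X p = fundamental (cotangentModel ES) (cotangentLift (K := K)) p Y}ᶜ σ ∧
        ∀ p ∈ {p | ∃ Y : EK,
          X p = fundamental (cotangentModel ES) (cotangentLift (K := K)) p Y}ᶜ, σ p (X p) = 0 :=
  (hb.isPrincipalConnectionOn_liftedConnection hfree).exists_correction hX hXs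
    (hb.smoothForm_detectingForm (EK := EK) hfree hXs)
    (hb.detectingForm_invariant (EK := EK) hfree hX hXs)
    (hb.detectingForm_generator (EK := EK) hfree hX hXs)
    (hb.exists_generator_of_detectingForm (EK := EK) hfree hX hXs hX2)

end SecondOrder

/-! ### Principal bundles -/

section Bundles

variable {EQ ES EG Q S G : Type*}
  [NormedAddCommGroup EQ] [NormedSpace ℝ EQ] [NormedAddCommGroup ES] [NormedSpace ℝ ES]
  [NormedAddCommGroup EG] [NormedSpace ℝ EG]
  [TopologicalSpace Q] [ChartedSpace EQ Q] [TopologicalSpace S] [ChartedSpace ES S]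
  [TopologicalSpace G] [ChartedSpace EG G] [Group G] [MulAction G Q] {pr : Q → S}

namespace IsPrincipalBundle

variable (h : IsPrincipalBundle (EQ := EQ) (ES := ES) (EG := EG) G pr)
include h

theorem contMDiff : ContMDiff 𝓘(ℝ, EQ) 𝓘(ℝ, ES) ∞ pr := by
  intro q
  obtain ⟨V, hs, -, φ, hsrc, -, hφ⟩ := h.locally_trivial (pr q)
  have hq : φ.source ∈ nhds q := φ.open_source.mem_nhds (by rw [hsrc]; exact hs)
  have h1 : ContMDiffAt 𝓘(ℝ, EQ) 𝓘(ℝ, ES) ∞ (fun x => (φ x).1) q :=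
    contMDiffAt_fst.comp q (φ.contMDiffOn_toFun.contMDiffAt hq)
  refine h1.congr_of_eventuallyEq ?_
  filter_upwards [hq] with x hx
  exact ((hφ x hx).1).symm

/-- A principal bundle has smooth local sections through each of its points. -/
theorem exists_section (q : Q) : ∃ σ : S → Q, ContMDiffAt 𝓘(ℝ, ES) 𝓘(ℝ, EQ) ∞ σ (pr q) ∧
    σ (pr q) = q ∧ ∀ᶠ s in nhds (pr q), pr (σ s) = s := by
  obtain ⟨V, hs, hV, φ, hsrc, htgt, hφ⟩ := h.locally_trivial (pr q)
  have hq : q ∈ φ.source := by rw [hsrc]; exact hs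
  have hmem : ∀ s ∈ V, ((s, (φ q).2) : S × G) ∈ φ.target := fun s hs => by
    rw [htgt]; exact ⟨hs, mem_univ _⟩
  have hpair : ((pr q, (φ q).2) : S × G) = φ q := Prod.ext (hφ q hq).1.symm rfl
  refine ⟨fun s => φ.invFun (s, (φ q).2), ?_, ?_, ?_⟩
  · have h1 : ContMDiffAt (𝓘(ℝ, ES).prod 𝓘(ℝ, EG)) 𝓘(ℝ, EQ) ∞ φ.invFun (pr q, (φ q).2) :=
      φ.contMDiffOn_invFun.contMDiffAt (φ.open_target.mem_nhds (hmem _ hs))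
    exact h1.comp (pr q) (contMDiffAt_id.prodMk contMDiffAt_const)
  · change φ.invFun (pr q, (φ q).2) = q
    rw [hpair]
    exact φ.left_inv hq
  · filter_upwards [hV.mem_nhds hs] with s hs'
    have h1 := (hφ _ (φ.map_target (hmem s hs'))).1
    exact h1.symm.trans (congrArg Prod.fst (φ.right_inv (hmem s hs')))

theorem mfderiv_surjective (q : Q) :
    Function.Surjective (mfderiv 𝓘(ℝ, EQ) 𝓘(ℝ, ES) pr q) := by
  obtain ⟨σ, hσ, hσq, hpr⟩ := h.exists_section q
  intro u
  have h1 := mfderiv_comp_apply (pr q) (f := σ) (g := pr) (I'' := 𝓘(ℝ, ES))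
    (h.contMDiff.mdifferentiableAt (by simp)) (hσ.mdifferentiableAt (by simp)) u
  have h2 : (mfderiv 𝓘(ℝ, ES) 𝓘(ℝ, ES) (pr ∘ σ) (pr q) : ES →L[ℝ] ES) =
      ContinuousLinearMap.id ℝ ES :=
    (show pr ∘ σ =ᶠ[nhds (pr q)] id from hpr).mfderiv_eq.trans mfderiv_id
  refine ⟨(mfderiv 𝓘(ℝ, ES) 𝓘(ℝ, EQ) σ (pr q) u : EQ), ?_⟩
  refine (mfderiv_congr_base hσq.symm _).trans (h1.symm.trans ?_)
  exact congrArg (fun L : ES →L[ℝ] ES => L u) h2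

/-- The group acts transitively on the fibres. -/
theorem exists_smul_eq {q q' : Q} (hq : pr q = pr q') : ∃ g : G, g • q = q' := by
  obtain ⟨V, hs, -, φ, hsrc, -, hφ⟩ := h.locally_trivial (pr q)
  have h1 : q ∈ φ.source := by rw [hsrc]; exact hs
  have h2 : q' ∈ φ.source := by rw [hsrc, mem_preimage, ← hq]; exact hs
  refine ⟨(φ q').2 * ((φ q).2)⁻¹, ?_⟩
  have h3 : ((φ q').2 * ((φ q).2)⁻¹) • q ∈ φ.source := by
    rw [hsrc, mem_preimage, h.invariant]; exact hs
  refine φ.injOn h3 h2 (Prod.ext ?_ ?_)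
  · exact (hφ _ h3).1.trans ((h.invariant _ q).trans (hq.trans (hφ q' h2).1.symm))
  · exact ((hφ q h1).2 _).trans (by rw [inv_mul_cancel_right])

theorem finrank_eq (q : Q) : Module.finrank ℝ EQ = Module.finrank ℝ (ES × EG) := by
  obtain ⟨V, hs, -, φ, hsrc, -, hφ⟩ := h.locally_trivial (pr q)
  have hq : q ∈ φ.source := by rw [hsrc]; exact hs
  have e := (PartialDiffeomorph.isLocalDiffeomorphAt _ _ _ φ
    hq).mfderivToContinuousLinearEquiv (by simp)
  exact LinearEquiv.finrank_eq (e.toLinearEquiv : EQ ≃ₗ[ℝ] ES × EG)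

end IsPrincipalBundle

end Bundles

/-! ### Horizontal lifts -/

namespace ChaplyginSystem

variable {EQ ES EG EH Q S G H : Type*}
  [NormedAddCommGroup EQ] [NormedSpace ℝ EQ] [NormedAddCommGroup ES] [NormedSpace ℝ ES]
  [NormedAddCommGroup EG] [NormedSpace ℝ EG] [NormedAddCommGroup EH] [NormedSpace ℝ EH]
  [TopologicalSpace Q] [ChartedSpace EQ Q] [IsManifold 𝓘(ℝ, EQ) ∞ Q]
  [TopologicalSpace S] [ChartedSpace ES S] [IsManifold 𝓘(ℝ, ES) ∞ S]
  [TopologicalSpace G] [ChartedSpace EG G] [Group G]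
  [TopologicalSpace H] [ChartedSpace EH H] [Group H]
  [MulAction G Q] [MulAction H S]
  (C : ChaplyginSystem EQ ES EG EH Q S G H)

theorem proj_lift (s : S) : C.proj (C.lift s) = s := Function.surjInv_eq _ s

theorem smoothForm_conn : SmoothForm C.conn := by
  have := C.conn_principal.smooth
  rwa [show {v : TangentBundle 𝓘(ℝ, EQ) Q | v.proj ∈ (univ : Set Q)} = univ from by ext; simp,
    contMDiffOn_univ] at this

/-- The isomorphism `(Tπ, 𝒜) : T_q Q → T_{π(q)}S × 𝔤`. -/
def split (q : Q) : TangentSpace 𝓘(ℝ, EQ) q →L[ℝ] TangentSpace 𝓘(ℝ, ES) (C.proj q) × EG :=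
  (mfderiv 𝓘(ℝ, EQ) 𝓘(ℝ, ES) C.proj q).prod (C.conn q)

theorem split_apply (q : Q) (v : TangentSpace 𝓘(ℝ, EQ) q) :
    C.split q v = (mfderiv 𝓘(ℝ, EQ) 𝓘(ℝ, ES) C.proj q v, C.conn q v) := rfl

section SmoothAction

variable [ContMDiffSMul 𝓘(ℝ, EG) 𝓘(ℝ, EQ) ∞ G Q]

theorem mfderiv_proj_fundamental (q : Q) (Z : EG) :
    mfderiv 𝓘(ℝ, EQ) 𝓘(ℝ, ES) C.proj q
      (fundamental 𝓘(ℝ, EQ) (fun (g : G) (q : Q) => g • q) q Z) = 0 :=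
  (isSmoothAction_smul (EK := EG) (ES := EQ) (K := G) (S := Q)).mfderiv_fundamental_of_invariant
    C.principal.invariant (C.principal.contMDiff.mdifferentiableAt (by simp)) Z

variable [FiniteDimensional ℝ EQ] [FiniteDimensional ℝ ES] [FiniteDimensional ℝ EG]

theorem isInvertible_split (q : Q) : (C.split q).IsInvertible := by
  have hsurj : Function.Surjective (C.split q) := by
    rintro ⟨u, Z⟩
    obtain ⟨v, hv⟩ := C.principal.mfderiv_surjective q u
    refine ⟨v + fundamental 𝓘(ℝ, EQ) (fun (g : G) (q : Q) => g • q) q (Z - C.conn q v), ?_⟩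
    rw [split_apply, ContinuousLinearMap.map_add, ContinuousLinearMap.map_add, hv,
      C.mfderiv_proj_fundamental, C.conn_principal.fundamental_eq q (mem_univ q), add_zero,
      add_sub_cancel]
  have hfin := C.principal.finrank_eq q
  have hinj : Function.Injective (C.split q) :=
    (LinearMap.injective_iff_surjective_of_finrank_eq_finrank
      (V := EQ) (V₂ := ES × EG) (f := (C.split q).toLinearMap) hfin).2 hsurj
  exact isInvertible_of_injective (V := EQ) (W := ES × EG) hinj hfin

theorem split_horLiftAt (q : Q) (u : TangentSpace 𝓘(ℝ, ES) (C.proj q)) :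
    C.split q (C.horLiftAt q u) = (u, 0) :=
  (C.isInvertible_split q).self_apply_inverse _

theorem mfderiv_proj_horLiftAt (q : Q) (u : TangentSpace 𝓘(ℝ, ES) (C.proj q)) :
    mfderiv 𝓘(ℝ, EQ) 𝓘(ℝ, ES) C.proj q (C.horLiftAt q u) = u :=
  congrArg Prod.fst (C.split_horLiftAt q u)

theorem conn_horLiftAt (q : Q) (u : TangentSpace 𝓘(ℝ, ES) (C.proj q)) :
    C.conn q (C.horLiftAt q u) = 0 :=
  congrArg Prod.snd (C.split_horLiftAt q u)

theorem tangent_ext {q : Q} {v w : TangentSpace 𝓘(ℝ, EQ) q}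
    (h1 : mfderiv 𝓘(ℝ, EQ) 𝓘(ℝ, ES) C.proj q v = mfderiv 𝓘(ℝ, EQ) 𝓘(ℝ, ES) C.proj q w)
    (h2 : C.conn q v = C.conn q w) : v = w :=
  (C.isInvertible_split q).injective (Prod.ext h1 h2)

theorem horLiftAt_injective (q : Q) : Function.Injective (C.horLiftAt q) := fun u u' h => by
  rw [← C.mfderiv_proj_horLiftAt q u, h, C.mfderiv_proj_horLiftAt]

theorem horProj_horLiftAt (q : Q) (u : TangentSpace 𝓘(ℝ, ES) (C.proj q)) :
    C.horProj q (C.horLiftAt q u) = C.horLiftAt q u := by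
  change C.horLiftAt q u - fundamental 𝓘(ℝ, EQ) (fun (g : G) (q : Q) => g • q) q
    (C.conn q (C.horLiftAt q u)) = C.horLiftAt q u
  rw [C.conn_horLiftAt, ContinuousLinearMap.map_zero, sub_zero]

/-- Horizontal lifts depend smoothly on the point and on the vector which is lifted. -/
theorem contMDiffAt_horLiftAt {EN HN N : Type*} [NormedAddCommGroup EN] [NormedSpace ℝ EN]
    [TopologicalSpace HN] {J : ModelWithCorners ℝ EN HN} [TopologicalSpace N] [ChartedSpace HN N]
    {g : N → Q} {u : ∀ n, TangentSpace 𝓘(ℝ, ES) (C.proj (g n))} {n₀ : N}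
    (hg : ContMDiffAt J 𝓘(ℝ, EQ) ∞ g n₀)
    (hu : ContMDiffAt J 𝓘(ℝ, ES).tangent ∞
      (fun n => (⟨C.proj (g n), u n⟩ : TangentBundle 𝓘(ℝ, ES) S)) n₀) :
    ContMDiffAt J 𝓘(ℝ, EQ).tangent ∞
      (fun n => (⟨g n, C.horLiftAt (g n) (u n)⟩ : TangentBundle 𝓘(ℝ, EQ) Q)) n₀ := by
  have : CompleteSpace EQ := FiniteDimensional.complete ℝ EQ
  refine contMDiffAt_vec_iff.2 ⟨hg, ?_⟩
  -- the isomorphism `(Tπ, 𝒜)` in the frames at `g n₀` and `π (g n₀)`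
  let L : N → EQ →L[ℝ] ES × EG := fun n =>
    ((coord 𝓘(ℝ, ES) (C.proj (g n₀)) (C.proj (g n))).prodMap (ContinuousLinearMap.id ℝ EG)).comp
      ((C.split (g n)).comp (frame 𝓘(ℝ, EQ) (g n₀) (g n)))
  have hL : ContMDiffAt J 𝓘(ℝ, EQ →L[ℝ] ES × EG) ∞ L n₀ := by
    refine contMDiffAt_clm_of_apply fun e => ?_
    have hfr := contMDiffAt_frame hg (contMDiffAt_const (c := e))
    have h1 := contMDiffAt_coord (contMDiffAt_mfderiv_vec C.principal.contMDiff hfr)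
    have h2 := C.smoothForm_conn.apply hfr
    exact h1.prodMk_space h2
  have hinv : ∀ n, g n ∈ (chartAt EQ (g n₀)).source →
      C.proj (g n) ∈ (chartAt ES (C.proj (g n₀))).source → (L n).IsInvertible := by
    intro n hn hn'
    refine isInvertible_of_injective (fun e e' he => ?_) (C.principal.finrank_eq (g n))
    have h1 : C.split (g n) (frame 𝓘(ℝ, EQ) (g n₀) (g n) e) =
        C.split (g n) (frame 𝓘(ℝ, EQ) (g n₀) (g n) e') := by
      have he1 := congrArg Prod.fst he
      have he2 := congrArg Prod.snd he
      refine Prod.ext ?_ he2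
      rw [← frame_coord (I := 𝓘(ℝ, ES)) hn' (C.split (g n) _).1,
        ← frame_coord (I := 𝓘(ℝ, ES)) hn' (C.split (g n) (frame 𝓘(ℝ, EQ) (g n₀) (g n) e')).1]
      exact congrArg (frame 𝓘(ℝ, ES) (C.proj (g n₀)) (C.proj (g n))) he1
    rw [← coord_frame (I := 𝓘(ℝ, EQ)) hn e, (C.isInvertible_split (g n)).injective h1,
      coord_frame hn]
  have hchart := eventually_mem_chart (contMDiffAt_foot hu)
  have h3 : ContMDiffAt J 𝓘(ℝ, (ES × EG) →L[ℝ] EQ) ∞ (fun n => (L n).inverse) n₀ :=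
    ((hinv n₀ (mem_chart_source EQ _)
      (mem_chart_source ES _)).contDiffAt_map_inverse (n := ∞)).contMDiffAt.comp n₀ hL
  have h4 : ContMDiffAt J 𝓘(ℝ, ES × EG) ∞
      (fun n => ((coord 𝓘(ℝ, ES) (C.proj (g n₀)) (C.proj (g n)) (u n), 0) : ES × EG)) n₀ :=
    (contMDiffAt_coord hu).prodMk_space contMDiffAt_const
  refine (h3.clm_apply h4).congr_of_eventuallyEq ?_
  filter_upwards [eventually_mem_chart hg, hchart] with n hn hn'
  symm
  have h5 : ((coord 𝓘(ℝ, ES) (C.proj (g n₀)) (C.proj (g n)) (u n), 0) : ES × EG) =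
      L n (coord 𝓘(ℝ, EQ) (g n₀) (g n) (C.horLiftAt (g n) (u n))) := by
    simp only [L, ContinuousLinearMap.comp_apply, frame_coord hn]
    rw [C.split_horLiftAt]
    rfl
  rw [h5, (hinv n hn hn').inverse_apply_self]

end SmoothAction

end ChaplyginSystem

/-! ### Symmetries of the bundle -/

namespace ChaplyginSystem

variable {EQ ES EG EH Q S G H : Type*}
  [NormedAddCommGroup EQ] [NormedSpace ℝ EQ] [NormedAddCommGroup ES] [NormedSpace ℝ ES]
  [NormedAddCommGroup EG] [NormedSpace ℝ EG] [NormedAddCommGroup EH] [NormedSpace ℝ EH]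
  [TopologicalSpace Q] [ChartedSpace EQ Q] [IsManifold 𝓘(ℝ, EQ) ∞ Q]
  [TopologicalSpace S] [ChartedSpace ES S] [IsManifold 𝓘(ℝ, ES) ∞ S]
  [TopologicalSpace G] [ChartedSpace EG G] [Group G]
  [TopologicalSpace H] [ChartedSpace EH H] [Group H]
  [MulAction G Q] [MulAction H S]
  (C : ChaplyginSystem EQ ES EG EH Q S G H)

/-- `f : Q → Q` is an isometry which covers the action of `k` on `S` and transforms the connection
form by the linear map `ρ` of the Lie algebra. -/
structure IsSymmetry (k : H) (f : Q → Q) (ρ : EG →L[ℝ] EG) : Prop where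
  smooth : ContMDiff 𝓘(ℝ, EQ) 𝓘(ℝ, EQ) ∞ f
  proj_eq : ∀ q, C.proj (f q) = k • C.proj q
  conn_eq : ∀ (q : Q) (v : TangentSpace 𝓘(ℝ, EQ) q),
    C.conn (f q) (mfderiv 𝓘(ℝ, EQ) 𝓘(ℝ, EQ) f q v) = ρ (C.conn q v)
  metric_eq : ∀ (q : Q) (v w : TangentSpace 𝓘(ℝ, EQ) q),
    C.metric.inner (f q) (mfderiv 𝓘(ℝ, EQ) 𝓘(ℝ, EQ) f q v)
      (mfderiv 𝓘(ℝ, EQ) 𝓘(ℝ, EQ) f q w) = C.metric.inner q v w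

theorem isSmoothAction_d : IsSmoothAction 𝓘(ℝ, EQ) EH (fun (k : H) (q : Q) => C.d k q) where
  smooth := C.d_smooth
  one q := by simp
  mul k j q := by simp

variable [ContMDiffSMul 𝓘(ℝ, EG) 𝓘(ℝ, EQ) ∞ G Q] [FiniteDimensional ℝ EG]

/-- Any two points over `s` and `k.s` are related by a symmetry covering `k`, namely by `d_k`
followed by the action of an element of `G`. -/
theorem exists_symmetry (k : H) {q q' : Q} (hq : C.proj q' = k • C.proj q) :
    ∃ (f : Q → Q) (ρ : EG →L[ℝ] EG), C.IsSymmetry k f ρ ∧ f q = q' := by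
  have hG := isSmoothAction_smul (EK := EG) (ES := EQ) (K := G) (S := Q)
  obtain ⟨g, hg⟩ := C.principal.exists_smul_eq (q := C.d k q) (q' := q')
    (by rw [hq, C.proj_d])
  have hcomp : ∀ (q : Q) (v : TangentSpace 𝓘(ℝ, EQ) q),
      mfderiv 𝓘(ℝ, EQ) 𝓘(ℝ, EQ) (fun q => g • C.d k q) q v =
      mfderiv 𝓘(ℝ, EQ) 𝓘(ℝ, EQ) (fun q : Q => g • q) (C.d k q)
        (mfderiv 𝓘(ℝ, EQ) 𝓘(ℝ, EQ) (C.d k) q v) := fun q v =>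
    mfderiv_comp_apply q (hG.mdifferentiableAt_left g _)
      (C.isSmoothAction_d.mdifferentiableAt_left k q) v
  refine ⟨fun q => g • C.d k q, (adjoint g).comp (LinearMap.toContinuousLinearMap (C.rep k)),
    ⟨(hG.contMDiff_left g).comp (C.isSmoothAction_d.contMDiff_left k), fun q => ?_,
      fun q v => ?_, fun q v w => ?_⟩, hg⟩
  · rw [C.principal.invariant, C.proj_d]
  · rw [hcomp]
    refine (C.conn_principal.equivariant g _ (mem_univ _) _).trans ?_
    rw [C.conn_d]
    rfl
  · rw [hcomp, hcomp, C.metric_G, C.metric_d]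

variable [FiniteDimensional ℝ EQ] [FiniteDimensional ℝ ES]

/-- The horizontal lift at `q`, on the model space of `S`, which is every tangent space of `S`; so
lifts at two points can be compared when their projections are only propositionally equal. -/
def horLiftModel (q : Q) : ES →L[ℝ] TangentSpace 𝓘(ℝ, EQ) q := C.horLiftAt q

/-- The momentum of the horizontal lift of `w` evaluated on the curvature of the horizontal lifts
of `u` and `v`. -/
def gyroAt (q : Q) (w u v : ES) : ℝ :=
  C.metric.inner q (C.horLiftModel q w) (fundamental 𝓘(ℝ, EQ) (fun (g : G) (q : Q) => g • q) q
    (extDerivOneForm 𝓘(ℝ, EQ) C.conn q (C.horLiftModel q u) (C.horLiftModel q v)))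

/-- On horizontal lifts the curvature is `d𝒜`, without the horizontal projections. -/
theorem momentum_curvature (q : Q) (w u v : ES) :
    C.momentum q (C.horLiftModel q w) (C.curvature q (C.horLiftModel q u) (C.horLiftModel q v)) =
      C.gyroAt q w u v := by
  have h : ∀ u, C.horProj q (C.horLiftModel q u) = C.horLiftModel q u := C.horProj_horLiftAt q
  have h1 : C.curvature q (C.horLiftModel q u) (C.horLiftModel q v) =
      extDerivOneForm 𝓘(ℝ, EQ) C.conn q (C.horLiftModel q u) (C.horLiftModel q v) := by
    rw [curvature, pullbackBilin_apply, h, h]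
  rw [h1]
  rfl

namespace IsSymmetry

variable {C} {k : H} {f : Q → Q} {ρ : EG →L[ℝ] EG} (hf : C.IsSymmetry k f ρ)
  [ContMDiffSMul 𝓘(ℝ, EH) 𝓘(ℝ, ES) ∞ H S]
include hf

variable (EH) in
theorem mfderiv_proj (q : Q) (v : TangentSpace 𝓘(ℝ, EQ) q) :
    (mfderiv 𝓘(ℝ, EQ) 𝓘(ℝ, ES) C.proj (f q) (mfderiv 𝓘(ℝ, EQ) 𝓘(ℝ, EQ) f q v) : ES) =
      mfderiv 𝓘(ℝ, ES) 𝓘(ℝ, ES) (fun s : S => k • s) (C.proj q)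
        (mfderiv 𝓘(ℝ, EQ) 𝓘(ℝ, ES) C.proj q v) := by
  have hS := isSmoothAction_smul (EK := EH) (ES := ES) (K := H) (S := S)
  have hp : ∀ q, MDifferentiableAt 𝓘(ℝ, EQ) 𝓘(ℝ, ES) C.proj q := fun q =>
    C.principal.contMDiff.mdifferentiableAt (by simp)
  have h1 := mfderiv_comp_apply q (hp (f q)) (hf.smooth.mdifferentiableAt (by simp)) v
  have h2 := mfderiv_comp_apply q (hS.mdifferentiableAt_left k (C.proj q)) (hp q) v
  have h3 : C.proj ∘ f = (fun s => k • s) ∘ C.proj := funext hf.proj_eq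
  rw [h3] at h1
  exact h1.symm.trans h2

theorem horLiftModel_eq (q : Q) (u : ES) :
    C.horLiftModel (f q) (mfderiv 𝓘(ℝ, ES) 𝓘(ℝ, ES) (fun s : S => k • s) (C.proj q) u : ES) =
      mfderiv 𝓘(ℝ, EQ) 𝓘(ℝ, EQ) f q (C.horLiftModel q u) := by
  refine C.tangent_ext ?_ ?_
  · refine (C.mfderiv_proj_horLiftAt (f q) _).trans ?_
    refine Eq.trans ?_ (hf.mfderiv_proj EH q _).symm
    exact congrArg (mfderiv 𝓘(ℝ, ES) 𝓘(ℝ, ES) (fun s : S => k • s) (C.proj q))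
      (C.mfderiv_proj_horLiftAt q u).symm
  · refine (C.conn_horLiftAt (f q) _).trans ?_
    rw [hf.conn_eq]
    exact ((congrArg ρ (C.conn_horLiftAt q u)).trans (map_zero ρ)).symm

/-- A symmetry sends `ζ_Z` to `ζ_{ρ Z}`, because both sides have the same projection to `S` and the
same value under the connection form. -/
theorem mfderiv_fundamental (q : Q) (Z : EG) :
    mfderiv 𝓘(ℝ, EQ) 𝓘(ℝ, EQ) f q (fundamental 𝓘(ℝ, EQ) (fun (g : G) (q : Q) => g • q) q Z) =
      fundamental 𝓘(ℝ, EQ) (fun (g : G) (q : Q) => g • q) (f q) (ρ Z) := by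
  refine C.tangent_ext ?_ ?_
  · refine (hf.mfderiv_proj EH q _).trans ?_
    rw [C.mfderiv_proj_fundamental, C.mfderiv_proj_fundamental, ContinuousLinearMap.map_zero]
    rfl
  · rw [hf.conn_eq, C.conn_principal.fundamental_eq q (mem_univ q),
      C.conn_principal.fundamental_eq (f q) (mem_univ _)]

/-- The exterior derivative of the connection form is transformed by `ρ` as well. -/
theorem extDeriv_conn (q : Q) (v w : TangentSpace 𝓘(ℝ, EQ) q) :
    extDerivOneForm 𝓘(ℝ, EQ) C.conn (f q) (mfderiv 𝓘(ℝ, EQ) 𝓘(ℝ, EQ) f q v)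
        (mfderiv 𝓘(ℝ, EQ) 𝓘(ℝ, EQ) f q w) =
      ρ (extDerivOneForm 𝓘(ℝ, EQ) C.conn q v w) := by
  rw [← extDerivOneForm_comp C.smoothForm_conn ρ]
  exact (extDerivOneForm_pullback C.smoothForm_conn (hf.smooth q)
    (Filter.Eventually.of_forall fun q v => (hf.conn_eq q v).symm) v w).symm

theorem metric_horLiftModel (q : Q) (u v : ES) :
    C.metric.inner (f q)
      (C.horLiftModel (f q) (mfderiv 𝓘(ℝ, ES) 𝓘(ℝ, ES) (fun s : S => k • s) (C.proj q) u : ES))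
      (C.horLiftModel (f q) (mfderiv 𝓘(ℝ, ES) 𝓘(ℝ, ES) (fun s : S => k • s) (C.proj q) v : ES)) =
    C.metric.inner q (C.horLiftModel q u) (C.horLiftModel q v) := by
  rw [hf.horLiftModel_eq, hf.horLiftModel_eq, hf.metric_eq]

theorem gyroAt_eq (q : Q) (w u v : ES) :
    C.gyroAt (f q) (mfderiv 𝓘(ℝ, ES) 𝓘(ℝ, ES) (fun s : S => k • s) (C.proj q) w : ES)
      (mfderiv 𝓘(ℝ, ES) 𝓘(ℝ, ES) (fun s : S => k • s) (C.proj q) u : ES)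
      (mfderiv 𝓘(ℝ, ES) 𝓘(ℝ, ES) (fun s : S => k • s) (C.proj q) v : ES) =
    C.gyroAt q w u v := by
  unfold gyroAt
  rw [hf.horLiftModel_eq, hf.horLiftModel_eq, hf.horLiftModel_eq, hf.extDeriv_conn,
    ← hf.mfderiv_fundamental, hf.metric_eq]

end IsSymmetry

end ChaplyginSystem

/-! ### The induced metric and the gyroscopic form -/

namespace ChaplyginSystem

variable {EQ ES EG EH Q S G H : Type*}
  [NormedAddCommGroup EQ] [NormedSpace ℝ EQ] [NormedAddCommGroup ES] [NormedSpace ℝ ES]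
  [NormedAddCommGroup EG] [NormedSpace ℝ EG] [NormedAddCommGroup EH] [NormedSpace ℝ EH]
  [TopologicalSpace Q] [ChartedSpace EQ Q] [IsManifold 𝓘(ℝ, EQ) ∞ Q]
  [TopologicalSpace S] [ChartedSpace ES S] [IsManifold 𝓘(ℝ, ES) ∞ S]
  [TopologicalSpace G] [ChartedSpace EG G] [Group G]
  [TopologicalSpace H] [ChartedSpace EH H] [Group H]
  [MulAction G Q] [MulAction H S]
  (C : ChaplyginSystem EQ ES EG EH Q S G H)
  [ContMDiffSMul 𝓘(ℝ, EG) 𝓘(ℝ, EQ) ∞ G Q] [ContMDiffSMul 𝓘(ℝ, EH) 𝓘(ℝ, ES) ∞ H S]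
  [FiniteDimensional ℝ EG] [FiniteDimensional ℝ EQ] [FiniteDimensional ℝ ES]
  {EN HN N : Type*} [NormedAddCommGroup EN] [NormedSpace ℝ EN]
  [TopologicalSpace HN] {J : ModelWithCorners ℝ EN HN} [TopologicalSpace N] [ChartedSpace HN N]

omit [IsManifold 𝓘(ℝ, ES) ∞ S] [ContMDiffSMul 𝓘(ℝ, EG) 𝓘(ℝ, EQ) ∞ G Q]
  [ContMDiffSMul 𝓘(ℝ, EH) 𝓘(ℝ, ES) ∞ H S]
  [FiniteDimensional ℝ EG] [FiniteDimensional ℝ EQ] [FiniteDimensional ℝ ES] in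
theorem contMDiffAt_metric {g : N → Q} {v w : ∀ n, TangentSpace 𝓘(ℝ, EQ) (g n)} {n₀ : N}
    (hv : ContMDiffAt J 𝓘(ℝ, EQ).tangent ∞
      (fun n => (⟨g n, v n⟩ : TangentBundle 𝓘(ℝ, EQ) Q)) n₀)
    (hw : ContMDiffAt J 𝓘(ℝ, EQ).tangent ∞
      (fun n => (⟨g n, w n⟩ : TangentBundle 𝓘(ℝ, EQ) Q)) n₀) :
    ContMDiffAt J 𝓘(ℝ, ℝ) ∞ (fun n => C.metric.inner (g n) (v n) (w n)) n₀ := by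
  have h1 : ContMDiffAt J (𝓘(ℝ, EQ).prod 𝓘(ℝ, ℝ)) ∞ (fun n =>
      TotalSpace.mk' ℝ (E := Bundle.Trivial Q ℝ) (g n) (C.metric.inner (g n) (v n) (w n))) n₀ :=
    ContMDiffAt.clm_bundle_apply₂ (F₁ := EQ) (F₂ := EQ)
      ((C.metric.contMDiff (g n₀)).comp n₀ (contMDiffAt_foot hv)) hv hw
  simp only [contMDiffAt_totalSpace] at h1
  exact h1.2

variable (H) in
omit [FiniteDimensional ℝ ES] [ContMDiffSMul 𝓘(ℝ, EH) 𝓘(ℝ, ES) ∞ H S] [IsManifold 𝓘(ℝ, ES) ∞ S]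
  [TopologicalSpace H] [ChartedSpace EH H] in
theorem mfderiv_one_smul (s : S) (u : ES) :
    (mfderiv 𝓘(ℝ, ES) 𝓘(ℝ, ES) (fun s : S => (1 : H) • s) s : ES →L[ℝ] ES) u = u := by
  have h1 : (fun s : S => (1 : H) • s) = id := funext (one_smul H)
  have h2 : (mfderiv 𝓘(ℝ, ES) 𝓘(ℝ, ES) (fun s : S => (1 : H) • s) s : ES →L[ℝ] ES) =
      ContinuousLinearMap.id ℝ ES := by
    rw [h1]; exact mfderiv_id
  rw [h2]
  rfl

/-- The induced metric may be computed at any point of the fibre. -/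
theorem baseMetric_eq {q : Q} {s : S} (hq : C.proj q = s) (u v : ES) :
    (C.baseMetric s : ES →L[ℝ] ES →L[ℝ] ℝ) u v =
      C.metric.inner q (C.horLiftModel q u) (C.horLiftModel q v) := by
  obtain ⟨f, ρ, hf, rfl⟩ := C.exists_symmetry 1 (q := C.lift s) (q' := q)
    (by rw [one_smul, C.proj_lift, hq])
  have h := hf.metric_horLiftModel (C.lift s) u v
  have h1 := fun u : ES => mfderiv_one_smul H (C.proj (C.lift s)) u
  refine Eq.trans ?_ (h.symm.trans ?_)
  · rfl
  · exact congrArg₂ (fun u v : ES => C.metric.inner (f (C.lift s))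
      (C.horLiftModel (f (C.lift s)) u) (C.horLiftModel (f (C.lift s)) v)) (h1 u) (h1 v)

/-- The form `gyroAt` as a trilinear function on `T_s S`. -/
def gyroBase (s : S) (w u v : ES) : ℝ := C.gyroAt (C.lift s) w u v

/-- The gyroscopic form may be computed at any point of the fibre. -/
theorem gyroBase_eq {q : Q} {s : S} (hq : C.proj q = s) (w u v : ES) :
    C.gyroBase s w u v = C.gyroAt q w u v := by
  obtain ⟨f, ρ, hf, rfl⟩ := C.exists_symmetry 1 (q := C.lift s) (q' := q)
    (by rw [one_smul, C.proj_lift, hq])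
  have h := hf.gyroAt_eq (C.lift s) w u v
  have h1 := fun u : ES => mfderiv_one_smul H (C.proj (C.lift s)) u
  refine Eq.trans ?_ (h.symm.trans ?_)
  · rfl
  · rw [show (mfderiv 𝓘(ℝ, ES) 𝓘(ℝ, ES) (fun s : S => (1 : H) • s) (C.proj (C.lift s)) w : ES) = w
      from h1 w, show (mfderiv 𝓘(ℝ, ES) 𝓘(ℝ, ES) (fun s : S => (1 : H) • s)
        (C.proj (C.lift s)) u : ES) = u from h1 u,
      show (mfderiv 𝓘(ℝ, ES) 𝓘(ℝ, ES) (fun s : S => (1 : H) • s)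
        (C.proj (C.lift s)) v : ES) = v from h1 v]

theorem baseMetric_smul (k : H) (s : S) (u v : TangentSpace 𝓘(ℝ, ES) s) :
    C.baseMetric (k • s) (mfderiv 𝓘(ℝ, ES) 𝓘(ℝ, ES) (fun s : S => k • s) s u)
      (mfderiv 𝓘(ℝ, ES) 𝓘(ℝ, ES) (fun s : S => k • s) s v) = C.baseMetric s u v := by
  obtain ⟨q, rfl⟩ := C.principal.surjective s
  obtain ⟨f, ρ, hf, -⟩ := C.exists_symmetry k (C.proj_d k q)
  exact (C.baseMetric_eq (hf.proj_eq q) _ _).trans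
    ((hf.metric_horLiftModel q u v).trans (C.baseMetric_eq rfl u v).symm)

theorem gyroBase_smul (k : H) (s : S) (w u v : TangentSpace 𝓘(ℝ, ES) s) :
    C.gyroBase (k • s) (mfderiv 𝓘(ℝ, ES) 𝓘(ℝ, ES) (fun s : S => k • s) s w)
      (mfderiv 𝓘(ℝ, ES) 𝓘(ℝ, ES) (fun s : S => k • s) s u)
      (mfderiv 𝓘(ℝ, ES) 𝓘(ℝ, ES) (fun s : S => k • s) s v) = C.gyroBase s w u v := by
  obtain ⟨q, rfl⟩ := C.principal.surjective s
  obtain ⟨f, ρ, hf, -⟩ := C.exists_symmetry k (C.proj_d k q)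
  exact (C.gyroBase_eq (hf.proj_eq q) _ _ _).trans
    ((hf.gyroAt_eq q w u v).trans (C.gyroBase_eq rfl w u v).symm)

/-- The horizontal lift along a local section depends smoothly on the vector. -/
theorem contMDiffAt_horLiftModel_section {σ : S → Q} {g : N → S}
    {u : ∀ n, TangentSpace 𝓘(ℝ, ES) (g n)} {n₀ : N}
    (hσ : ContMDiffAt 𝓘(ℝ, ES) 𝓘(ℝ, EQ) ∞ σ (g n₀))
    (hpr : ∀ᶠ s in nhds (g n₀), C.proj (σ s) = s)
    (hu : ContMDiffAt J 𝓘(ℝ, ES).tangent ∞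
      (fun n => (⟨g n, u n⟩ : TangentBundle 𝓘(ℝ, ES) S)) n₀) :
    ContMDiffAt J 𝓘(ℝ, EQ).tangent ∞
      (fun n => (⟨σ (g n), C.horLiftModel (σ (g n)) (u n)⟩ : TangentBundle 𝓘(ℝ, EQ) Q)) n₀ := by
  have hg := contMDiffAt_foot hu
  refine C.contMDiffAt_horLiftAt (g := fun n => σ (g n)) (u := fun n => (u n : ES))
    (hσ.comp n₀ hg) (hu.congr_of_eventuallyEq ?_)
  filter_upwards [hg.continuousAt.eventually hpr] with n hn
  exact tangent_mk_congr hn _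

theorem contMDiffAt_gyroBase {g : N → S} {w u v : ∀ n, TangentSpace 𝓘(ℝ, ES) (g n)} {n₀ : N}
    (hw : ContMDiffAt J 𝓘(ℝ, ES).tangent ∞
      (fun n => (⟨g n, w n⟩ : TangentBundle 𝓘(ℝ, ES) S)) n₀)
    (hu : ContMDiffAt J 𝓘(ℝ, ES).tangent ∞
      (fun n => (⟨g n, u n⟩ : TangentBundle 𝓘(ℝ, ES) S)) n₀)
    (hv : ContMDiffAt J 𝓘(ℝ, ES).tangent ∞
      (fun n => (⟨g n, v n⟩ : TangentBundle 𝓘(ℝ, ES) S)) n₀) [LieGroup 𝓘(ℝ, EG) ∞ G] :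
    ContMDiffAt J 𝓘(ℝ, ℝ) ∞ (fun n => C.gyroBase (g n) (w n) (u n) (v n)) n₀ := by
  obtain ⟨σ, hσ, -, hpr⟩ := C.principal.exists_section (C.lift (g n₀))
  rw [C.proj_lift] at hσ hpr
  have hg := contMDiffAt_foot hw
  have h1 := C.smoothForm_conn.extDeriv.apply (C.contMDiffAt_horLiftModel_section hσ hpr hu)
    (C.contMDiffAt_horLiftModel_section hσ hpr hv)
  have h2 := (isSmoothAction_smul (EK := EG) (ES := EQ) (K := G) (S := Q)).contMDiffAt_fundamental
    (hσ.comp n₀ hg) h1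
  refine (C.contMDiffAt_metric (C.contMDiffAt_horLiftModel_section hσ hpr hw)
    h2).congr_of_eventuallyEq ?_
  filter_upwards [hg.continuousAt.eventually hpr] with n hn
  exact C.gyroBase_eq hn _ _ _

/-- The metric induced on `S` is a Riemannian metric which is invariant under `H`. -/
theorem isInvariantMetric_baseMetric : IsInvariantMetric H C.baseMetric where
  smooth := by
    refine SmoothBilin.of_apply fun s₀ e e' => ?_
    obtain ⟨σ, hσ, -, hpr⟩ := C.principal.exists_section (C.lift s₀)
    rw [C.proj_lift] at hσ hpr
    have hfr : ∀ e : ES, ContMDiffAt 𝓘(ℝ, ES) 𝓘(ℝ, ES).tangent ∞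
        (fun s => (⟨s, frame 𝓘(ℝ, ES) s₀ s e⟩ : TangentBundle 𝓘(ℝ, ES) S)) s₀ := fun e =>
      contMDiffAt_frame (g := fun s : S => s) contMDiffAt_id contMDiffAt_const
    refine (C.contMDiffAt_metric
      (C.contMDiffAt_horLiftModel_section (g := fun s => s) hσ hpr (hfr e))
      (C.contMDiffAt_horLiftModel_section (g := fun s => s) hσ hpr (hfr e'))).congr_of_eventuallyEq
        ?_
    filter_upwards [hpr] with s hs
    exact C.baseMetric_eq hs _ _
  symm s u v := C.metric.symm _ _ _
  pos s u hu := C.metric.pos _ _ fun h =>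
    hu (C.horLiftAt_injective (C.lift s) (h.trans (map_zero (C.horLiftAt (C.lift s))).symm))
  invariant := C.baseMetric_smul

end ChaplyginSystem

/-! ### The nonholonomic vector field -/

namespace ChaplyginSystem

variable {EQ ES EG EH Q S G H : Type*}
  [NormedAddCommGroup EQ] [NormedSpace ℝ EQ] [NormedAddCommGroup ES] [NormedSpace ℝ ES]
  [NormedAddCommGroup EG] [NormedSpace ℝ EG] [NormedAddCommGroup EH] [NormedSpace ℝ EH]
  [TopologicalSpace Q] [ChartedSpace EQ Q] [IsManifold 𝓘(ℝ, EQ) ∞ Q]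
  [TopologicalSpace S] [ChartedSpace ES S] [IsManifold 𝓘(ℝ, ES) ∞ S]
  [TopologicalSpace G] [ChartedSpace EG G] [Group G] [LieGroup 𝓘(ℝ, EG) ∞ G]
  [TopologicalSpace H] [ChartedSpace EH H] [Group H] [LieGroup 𝓘(ℝ, EH) ∞ H]
  [MulAction G Q] [MulAction H S]
  (C : ChaplyginSystem EQ ES EG EH Q S G H)
  [ContMDiffSMul 𝓘(ℝ, EG) 𝓘(ℝ, EQ) ∞ G Q] [ContMDiffSMul 𝓘(ℝ, EH) 𝓘(ℝ, ES) ∞ H S]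
  [FiniteDimensional ℝ EG] [FiniteDimensional ℝ EQ] [FiniteDimensional ℝ ES]

theorem baseMetric_sharp (p : CotangentBundle ES S) :
    C.baseMetric p.proj (C.sharp p) = (p.2 : TangentSpace 𝓘(ℝ, ES) p.proj →L[ℝ] ℝ) :=
  (C.isInvariantMetric_baseMetric.isInvertible p.proj).self_apply_inverse _

theorem contMDiff_sharp : ContMDiff (cotangentModel ES) 𝓘(ℝ, ES).tangent ∞
    (fun p : CotangentBundle ES S => (⟨p.proj, C.sharp p⟩ : TangentBundle 𝓘(ℝ, ES) S)) := by
  intro p₀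
  have hid : ContMDiffAt (cotangentModel ES) (cotangentModel ES) ∞
    (fun p : CotangentBundle ES S => p) p₀ := contMDiffAt_id
  have hb := C.isInvariantMetric_baseMetric
  exact hb.smooth.contMDiffAt_inverse hb.isInvertible (contMDiff_cotangent_proj p₀)
    (contMDiffAt_cotangent_iff.1 hid).2

theorem compressedHamiltonian_eq (p : CotangentBundle ES S) :
    C.compressedHamiltonian p =
      (1 / 2 : ℝ) * (p.2 : TangentSpace 𝓘(ℝ, ES) p.proj →L[ℝ] ℝ) (C.sharp p) := by
  rw [← C.baseMetric_sharp p]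
  rfl

theorem contMDiff_compressedHamiltonian :
    ContMDiff (cotangentModel ES) 𝓘(ℝ, ℝ) ∞ C.compressedHamiltonian := by
  intro p
  rw [funext C.compressedHamiltonian_eq]
  exact contMDiffAt_const.mul (contMDiffAt_pairing (g := fun p : CotangentBundle ES S => p)
    contMDiffAt_id (C.contMDiff_sharp p))

theorem sharp_cotangentLift (k : H) (p : CotangentBundle ES S) :
    C.sharp (cotangentLift k p) =
      mfderiv 𝓘(ℝ, ES) 𝓘(ℝ, ES) (fun s : S => k • s) p.proj (C.sharp p) := by
  have hS := isSmoothAction_smul (EK := EH) (ES := ES) (K := H) (S := S)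
  refine (C.isInvariantMetric_baseMetric.isInvertible (k • p.proj)).injective ?_
  refine (C.baseMetric_sharp (cotangentLift k p)).trans ?_
  refine ContinuousLinearMap.ext fun v => ?_
  obtain ⟨v, rfl⟩ := hS.mfderiv_surjective k p.proj v
  have h1 := C.baseMetric_smul k p.proj (C.sharp p) v
  rw [C.baseMetric_sharp] at h1
  exact (cotangentLift_mfderiv EH k p v).trans h1.symm

theorem compressedHamiltonian_cotangentLift (k : H) (p : CotangentBundle ES S) :
    C.compressedHamiltonian (cotangentLift k p) = C.compressedHamiltonian p := by
  rw [C.compressedHamiltonian_eq, C.compressedHamiltonian_eq, C.sharp_cotangentLift]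
  exact congrArg ((1 / 2 : ℝ) * ·) (cotangentLift_mfderiv EH k p (C.sharp p))

/-- The Legendre transformation: the fibre derivative of the Hamiltonian `ℋ_c`. -/
theorem mfderiv_compressedHamiltonian_vertical (p : CotangentBundle ES S) (β : ES →L[ℝ] ℝ) :
    (mfderiv (cotangentModel ES) 𝓘(ℝ, ℝ) C.compressedHamiltonian p
      (((0, β) : ES × (ES →L[ℝ] ℝ)) : TangentSpace (cotangentModel ES) p) : ℝ) =
      β (C.sharp p) := by
  have hb := C.isInvariantMetric_baseMetric
  have h1 := mfderiv_comp_fibreLine p β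
    (C.contMDiff_compressedHamiltonian.mdifferentiableAt (x := p) (by simp))
  let l : ES →L[ℝ] ℝ := p.2
  let v : ES := C.sharp p
  let w : ES := (C.baseMetric p.proj).inverse β
  have hw : C.baseMetric p.proj w = β := (hb.isInvertible p.proj).self_apply_inverse _
  have hsharp : ∀ t : ℝ, (C.sharp (fibreLine p β t) : ES) = v + t • w := fun t =>
    ((C.baseMetric p.proj).inverse.map_add l (t • β)).trans
      (congrArg (fun z : ES => v + z) ((C.baseMetric p.proj).inverse.map_smul t β))
  have hsymm : l w = β v := by
    have h2 : C.baseMetric p.proj v w = l w :=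
      congrArg (fun L : ES →L[ℝ] ℝ => L w) (C.baseMetric_sharp p)
    have h3 : C.baseMetric p.proj w v = β v := congrArg (fun L : ES →L[ℝ] ℝ => L v) hw
    rw [← h2, ← h3, hb.symm]
  have hH : ∀ t : ℝ, C.compressedHamiltonian (fibreLine p β t) =
      (1 / 2 : ℝ) * (l v + t * (2 * β v) + t ^ 2 * β w) := by
    intro t
    rw [C.compressedHamiltonian_eq]
    refine congrArg ((1 / 2 : ℝ) * ·) ?_
    refine (congrArg (l + t • β) (hsharp t)).trans ?_
    simp only [add_apply, map_add, map_smul, smul_apply, smul_eq_mul, hsymm]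
    ring
  have h4 : HasDerivAt (fun t : ℝ => (1 / 2 : ℝ) * (l v + t * (2 * β v) + t ^ 2 * β w))
      (β v) 0 := by
    have := (((hasDerivAt_id (0 : ℝ)).mul_const (2 * β v)).const_add (l v)).add
      (((hasDerivAt_id (0 : ℝ)).pow 2).mul_const (β w)) |>.const_mul (1 / 2 : ℝ)
    simpa using this
  rw [funext hH] at h1
  exact h1.unique h4

theorem gyroTwoForm_apply (p : CotangentBundle ES S) (ξ η : TangentSpace (cotangentModel ES) p) :
    C.gyroTwoForm p ξ η =
      C.gyroBase p.proj (C.sharp p) (footDeriv p ξ) (footDeriv p η) :=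
  C.momentum_curvature (C.lift p.proj) (C.sharp p) (footDeriv p ξ) (footDeriv p η)

theorem smoothBilin_gyroTwoForm : SmoothBilin (I := cotangentModel ES) C.gyroTwoForm := by
  refine SmoothBilin.of_apply fun p₀ e e' => ?_
  have hfr : ∀ e, ContMDiffAt (cotangentModel ES) 𝓘(ℝ, ES).tangent ∞
      (fun p : CotangentBundle ES S => (⟨p.proj, footDeriv p (frame (cotangentModel ES) p₀ p e)⟩ :
        TangentBundle 𝓘(ℝ, ES) S)) p₀ := fun e =>
    contMDiffAt_footDeriv
      (contMDiffAt_frame (g := fun p : CotangentBundle ES S => p) contMDiffAt_id contMDiffAt_const)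
  refine (C.contMDiffAt_gyroBase (C.contMDiff_sharp p₀) (hfr e)
    (hfr e')).congr_of_eventuallyEq (Filter.Eventually.of_forall fun p => ?_)
  exact C.gyroTwoForm_apply p _ _

theorem gyroTwoForm_cotangentLift (k : H) (p : CotangentBundle ES S)
    (ξ η : TangentSpace (cotangentModel ES) p) :
    C.gyroTwoForm (cotangentLift k p)
        (mfderiv (cotangentModel ES) (cotangentModel ES) (cotangentLift k) p ξ)
        (mfderiv (cotangentModel ES) (cotangentModel ES) (cotangentLift k) p η) =
      C.gyroTwoForm p ξ η := by
  rw [C.gyroTwoForm_apply, C.gyroTwoForm_apply, C.sharp_cotangentLift,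
    footDeriv_cotangentLift EH, footDeriv_cotangentLift EH]
  exact C.gyroBase_smul k p.proj _ _ _

theorem smoothBilin_nhTwoForm : SmoothBilin (I := cotangentModel ES) C.nhTwoForm := by
  refine SmoothBilin.of_apply fun p₀ e e' => ?_
  have hfr : ∀ e, ContMDiffAt (cotangentModel ES) (cotangentModel ES).tangent ∞
      (fun p : CotangentBundle ES S => (⟨p, frame (cotangentModel ES) p₀ p e⟩ :
        TangentBundle (cotangentModel ES) (CotangentBundle ES S))) p₀ := fun e =>
    contMDiffAt_frame (g := fun p : CotangentBundle ES S => p) contMDiffAt_id contMDiffAt_const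
  have h1 := (smoothForm_canonicalOneForm (ES := ES) (S := S)).extDeriv.apply (hfr e) (hfr e')
  exact h1.neg.sub (C.smoothBilin_gyroTwoForm.apply (hfr e) (hfr e'))

theorem nhTwoForm_apply (p : CotangentBundle ES S) (ξ η : TangentSpace (cotangentModel ES) p) :
    C.nhTwoForm p ξ η = (η : ES × (ES →L[ℝ] ℝ)).2 (ξ : ES × (ES →L[ℝ] ℝ)).1 -
        (ξ : ES × (ES →L[ℝ] ℝ)).2 (η : ES × (ES →L[ℝ] ℝ)).1 - C.gyroTwoForm p ξ η := by
  rw [← canonicalTwoForm_apply p]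
  rfl

theorem gyroTwoForm_eq_zero_left {p : CotangentBundle ES S}
    {ξ : TangentSpace (cotangentModel ES) p} (h : footDeriv p ξ = 0)
    (η : TangentSpace (cotangentModel ES) p) : C.gyroTwoForm p ξ η = 0 := by
  rw [gyroTwoForm, pullbackBilin_apply, ContinuousLinearMap.comp_apply (C.horLift p.proj) _ ξ, h,
    ContinuousLinearMap.map_zero, ContinuousLinearMap.map_zero]
  rfl

theorem gyroTwoForm_eq_zero_right {p : CotangentBundle ES S}
    (ξ : TangentSpace (cotangentModel ES) p) {η : TangentSpace (cotangentModel ES) p}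
    (h : footDeriv p η = 0) : C.gyroTwoForm p ξ η = 0 := by
  rw [gyroTwoForm, pullbackBilin_apply, ContinuousLinearMap.comp_apply (C.horLift p.proj) _ η, h,
    ContinuousLinearMap.map_zero, ContinuousLinearMap.map_zero]

theorem nhTwoForm_vertical (p : CotangentBundle ES S) (ξ : TangentSpace (cotangentModel ES) p)
    (β : ES →L[ℝ] ℝ) :
    C.nhTwoForm p ξ (((0, β) : ES × (ES →L[ℝ] ℝ)) : TangentSpace (cotangentModel ES) p) =
      β (ξ : ES × (ES →L[ℝ] ℝ)).1 := by
  have h1 := C.gyroTwoForm_eq_zero_right ξ (footDeriv_apply p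
    (((0, β) : ES × (ES →L[ℝ] ℝ)) : TangentSpace (cotangentModel ES) p))
  refine (C.nhTwoForm_apply p ξ _).trans ?_
  refine (congrArg₂ (· - ·) rfl h1).trans ?_
  change β (ξ : ES × (ES →L[ℝ] ℝ)).1 - (ξ : ES × (ES →L[ℝ] ℝ)).2 0 - 0 = _
  rw [map_zero, sub_zero, sub_zero]

/-- The form `Ω_nh` is non-degenerate, since it differs from the canonical form by a semi-basic
form. -/
theorem isInvertible_nhTwoForm (p : CotangentBundle ES S) : (C.nhTwoForm p).IsInvertible := by
  have h : Function.Injective (C.nhTwoForm p) := by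
    refine (injective_iff_map_eq_zero (C.nhTwoForm p)).2 fun ξ hξ => ?_
    have h0 : ∀ η, C.nhTwoForm p ξ η = 0 := fun η => by rw [hξ]; rfl
    have h1 : (ξ : ES × (ES →L[ℝ] ℝ)).1 = 0 := by
      by_contra hne
      obtain ⟨β, hβ⟩ := SeparatingDual.exists_ne_zero (R := ℝ) hne
      exact hβ ((C.nhTwoForm_vertical p ξ β).symm.trans (h0 _))
    have h3 : (ξ : ES × (ES →L[ℝ] ℝ)).2 = 0 := by
      refine ContinuousLinearMap.ext fun v => ?_
      have h4 := (C.nhTwoForm_apply p ξ ((v, 0) : ES × (ES →L[ℝ] ℝ))).symm.trans (h0 _)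
      have h5 := C.gyroTwoForm_eq_zero_left ((footDeriv_apply p ξ).trans h1)
        (((v, 0) : ES × (ES →L[ℝ] ℝ)) : TangentSpace (cotangentModel ES) p)
      have h6 : (0 : ℝ) - (ξ : ES × (ES →L[ℝ] ℝ)).2 v - 0 = 0 :=
        (congrArg₂ (· - ·) rfl h5.symm).trans h4
      simpa using h6
    exact Prod.ext h1 h3
  exact isInvertible_of_injective (V := ES × (ES →L[ℝ] ℝ)) (W := (ES × (ES →L[ℝ] ℝ)) →L[ℝ] ℝ) h
    finrank_dual_eq

theorem nhTwoForm_nhField (p : CotangentBundle ES S) (η : TangentSpace (cotangentModel ES) p) :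
    C.nhTwoForm p (C.nhField p) η =
      (mfderiv (cotangentModel ES) 𝓘(ℝ, ℝ) C.compressedHamiltonian p :
        TangentSpace (cotangentModel ES) p →L[ℝ] ℝ) η :=
  congrArg (fun L : TangentSpace (cotangentModel ES) p →L[ℝ] ℝ => L η)
    ((C.isInvertible_nhTwoForm p).self_apply_inverse _)

theorem contMDiff_nhField : ContMDiff (cotangentModel ES) (cotangentModel ES).tangent ∞ (fun p =>
    (⟨p, C.nhField p⟩ : TangentBundle (cotangentModel ES) (CotangentBundle ES S))) := fun _ =>
  C.smoothBilin_nhTwoForm.contMDiffAt_inverse C.isInvertible_nhTwoForm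
    (g := fun p : CotangentBundle ES S => p) contMDiffAt_id fun _ =>
      (smoothForm_mfderiv C.contMDiff_compressedHamiltonian).apply
        (contMDiffAt_frame (g := fun p : CotangentBundle ES S => p) contMDiffAt_id
          contMDiffAt_const)

theorem nhField_equivariant (k : H) (p : CotangentBundle ES S) :
    C.nhField (cotangentLift k p) =
      mfderiv (cotangentModel ES) (cotangentModel ES) (cotangentLift k) p (C.nhField p) := by
  have hT := isSmoothAction_cotangentLift (EK := EH) (ES := ES) (K := H) (S := S)
  refine (C.isInvertible_nhTwoForm (cotangentLift k p)).injective ?_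
  refine ContinuousLinearMap.ext fun η => ?_
  obtain ⟨η, rfl⟩ := hT.mfderiv_surjective k p η
  rw [C.nhTwoForm_nhField]
  have h1 := hT.mfderiv_equivariant (L := ContinuousLinearMap.id ℝ ℝ)
    C.contMDiff_compressedHamiltonian (C.compressedHamiltonian_cotangentLift k) p η
  refine h1.trans ?_
  refine (C.nhTwoForm_nhField p η).symm.trans ?_
  exact (congrArg₂ (· - ·) (canonicalTwoForm_cotangentLift EH k p _ η)
    (C.gyroTwoForm_cotangentLift k p _ η)).symm

/-- The vector field `X_nh` is of second order. -/
theorem baseMetric_footDeriv_nhField (p : CotangentBundle ES S) :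
    C.baseMetric p.proj (footDeriv p (C.nhField p)) = p.2 := by
  refine Eq.trans (congrArg (C.baseMetric p.proj) ?_) (C.baseMetric_sharp p)
  refine (footDeriv_apply p (C.nhField p)).trans ?_
  by_contra hne
  obtain ⟨β, hβ⟩ := SeparatingDual.exists_ne_zero (R := ℝ) (V := ES) (sub_ne_zero.2 hne)
  refine hβ ?_
  exact (map_sub β _ _).trans (sub_eq_zero.2 ((C.nhTwoForm_vertical p (C.nhField p) β).symm.trans
    ((C.nhTwoForm_nhField p _).trans (C.mfderiv_compressedHamiltonian_vertical p β))))

end ChaplyginSystem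

end Nonholonomic

end

open Nonholonomic in
theorem proposition3p3 {EQ ES EG EH Q S G H : Type*}
    [NormedAddCommGroup EQ] [NormedSpace ℝ EQ] [FiniteDimensional ℝ EQ]
    [NormedAddCommGroup ES] [NormedSpace ℝ ES] [FiniteDimensional ℝ ES]
    [NormedAddCommGroup EG] [NormedSpace ℝ EG] [FiniteDimensional ℝ EG]
    [NormedAddCommGroup EH] [NormedSpace ℝ EH] [FiniteDimensional ℝ EH]
    [TopologicalSpace Q] [T2Space Q] [SecondCountableTopology Q]
    [ChartedSpace EQ Q] [IsManifold 𝓘(ℝ, EQ) ∞ Q]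
    [TopologicalSpace S] [T2Space S] [SecondCountableTopology S]
    [ChartedSpace ES S] [IsManifold 𝓘(ℝ, ES) ∞ S]
    [TopologicalSpace G] [T2Space G] [SecondCountableTopology G]
    [ChartedSpace EG G] [Group G] [LieGroup 𝓘(ℝ, EG) ∞ G]
    [TopologicalSpace H] [T2Space H] [SecondCountableTopology H]
    [ChartedSpace EH H] [Group H] [LieGroup 𝓘(ℝ, EH) ∞ H]
    [MulAction G Q] [ContMDiffSMul 𝓘(ℝ, EG) 𝓘(ℝ, EQ) ∞ G Q] [ProperSMul G Q]
    [MulAction H S] [ContMDiffSMul 𝓘(ℝ, EH) 𝓘(ℝ, ES) ∞ H S] [ProperSMul H S]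
    (C : ChaplyginSystem EQ ES EG EH Q S G H) :
    -- (1) invariance under `H` and under the dynamics
    ((∀ (h : H), ∀ p ∈ C.relativeEquilibria, cotangentLift h p ∈ C.relativeEquilibria) ∧
      (∀ (h : H), ∀ p ∈ C.relativeEquilibriaᶜ, cotangentLift h p ∈ C.relativeEquilibriaᶜ) ∧
      IsFlowInvariant (cotangentModel ES) C.nhField C.relativeEquilibria ∧
      IsFlowInvariant (cotangentModel ES) C.nhField C.relativeEquilibriaᶜ) ∧
    -- (2) the connection on the open set of the other points
    (IsOpen C.relativeEquilibriaᶜ ∧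
      ∃ σ : ∀ p : CotangentBundle ES S, TangentSpace (cotangentModel ES) p →L[ℝ] EH,
        IsPrincipalConnectionOn (cotangentModel ES) (cotangentLift (K := H))
          C.relativeEquilibriaᶜ σ ∧
        ∀ p ∈ C.relativeEquilibriaᶜ, σ p (C.nhField p) = 0) := by
  have hT := isSmoothAction_cotangentLift (EK := EH) (ES := ES) (K := H) (S := S)
  have hX := C.nhField_equivariant
  have hXs := C.contMDiff_nhField
  have hconn := C.isInvariantMetric_baseMetric.exists_connection (EK := EH) C.free_H hX hXs
    C.baseMetric_footDeriv_nhField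
  have hinv : ∀ (h : H), ∀ p ∈ C.relativeEquilibria, cotangentLift h p ∈ C.relativeEquilibria :=
    fun h p hp => hT.tangent_set_invariant hX h hp
  refine ⟨⟨hinv, fun h p hp hp' => hp ?_, hT.isFlowInvariant hX hXs ?_⟩, hconn⟩
  · have := hinv h⁻¹ _ hp'
    rwa [hT.inv_left] at this
  · exact isOpen_compl_iff.1 hconn.1
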